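/- Let $\mathbb K=\mathbb R$ or $\mathbb C$, let $d\ge 0$, and let $B$ be a separable $C^*$-algebra over $\mathbb K$ (a real $C^*$-algebra being a Banach $*$-algebra over $\mathbb R$ that embeds isometrically in a complex $C^*$-algebra), trivially graded. Let $(B,\mathbb R^d,\alpha,\theta)$ be a twisted dynamical system: $\alpha:\mathbb R^d\to\mathrm{Aut}(B)$ is strongly continuous, $\theta:\mathbb R^d\times\mathbb R^d\to\mathcal U(\mathcal M(B))$ is strictly continuous, and for all $x,y,z\in\mathbb R^d$, $b\in B$, $$\theta(x,y)\theta(x+y,z)=\alpha_x(\theta(y,z))\,\theta(x,y+z),\qquad \theta(x,0)=\theta(0,x)=1,\qquad \alpha_x\alpha_y(b)=\theta(x,y)\,\alpha_{x+y}(b)\,\theta(x,y)^*.$$ Assume also that $\theta(x,-x)=1$ for all $x$. Let $C_c(\mathbb R^d,B)$ be the $*$-algebra with $$(f_1*f_2)(x)=\int_{\mathbb R^d}\alpha_{-x}(\theta(y,x-y))\,\alpha_{y-x}(f_1(y))\,f_2(x-y)\,dy,\qquad f^*(x)=\alpha_{-x}(f(-x)^*).$$ Let $L^2(\mathbb R^d,B)$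 be the Hilbert $B$-module obtained by completing $C_c(\mathbb R^d,B)$ for $(f_1\mid f_2)_B=\int f_1(x)^*f_2(x)\,dx$ and $(f\cdot b)(x)=f(x)b$, and let $X_j$ be the closure of the operator $(X_jf)(x)=x_jf(x)$ on $C_c(\mathbb R^d,B)$. Let $C\ell_{0,d}$ be the real Clifford algebra with anticommuting odd generators $\rho^1,\dots,\rho^d$, $(\rho^j)^2=-1$, $(\rho^j)^*=-\rho^j$. Give $\bigwedge^*\mathbb R^d$ its standard inner product and the grading by parity of degree, let $C\ell_{0,d}$ act on it by $\rho^j\omega=e_j\wedge\omega-\iota(e_j)\omega$, and put $\gamma^j\omega=e_j\wedge\omega+\iota(e_j)\omega$. Let $$X=\sum_{j=1}^d X_j\otimes\gamma^j\quad\text{on}\quad \mathrm{Dom}\,X=\Big(\bigcap_j\mathrm{Dom}\,X_j\Big)\otimes\textstyle\bigwedge^*\mathbb R^d\ \subset\ E:=L^2(\mathbb R^d,B)_B\otimes\bigwedge^*\mathbb R^d .$$ Let $\mathcal A=C_c(\mathbb R^d,B)\otimes C\ell_{0,d}$, graded through $C\ell_{0,d}$, and let $\|a\|$ be the supremum of $\|\varphi(a)\|$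 over all $*$-homomorphisms $\varphi$ from $\mathcal A$ to $C^*$-algebras such that $\|\varphi(f\otimes 1)\|\le\int\|f(x)\|\,dx$ for all $f\in C_c(\mathbb R^d,B)$. Then $\|\cdot\|$ is a $C^*$-norm on $\mathcal A$; its completion $A=(B\rtimes_\theta\mathbb R^d)\otimes C\ell_{0,d}$ is a separable graded $C^*$-algebra over $\mathbb K$, containing $\mathcal A$ as a dense, grading-invariant $*$-subalgebra. The action $$\pi(f\otimes c)(\psi\otimes\omega)=(f*\psi)\otimes c\,\omega\qquad(f,\psi\in C_c(\mathbb R^d,B),\ c\in C\ell_{0,d},\ \omega\in\textstyle\bigwedge^*\mathbb R^d)$$ extends to a graded $*$-representation $\pi$ of $A$ on $E$ by adjointable operators. With this representation, $$\lambda_d=\Big(C_c(\mathbb R^d,B)\otimes C\ell_{0,d},\ L^2(\mathbb R^d,B)_B\otimes\textstyle\bigwedge^*\mathbb R^d,\ X=\sum_{j=1}^dX_j\otimes\gamma^j\Big)$$ is an unbounded Kasparov module (real if $\mathbb K=\mathbb R$, complex if $\mathbb K=\mathbb C$). That is, $X$ is densely defined, odd, self-adjoint and regular, and for every $a\in\mathcal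 A$ the operator $\pi(a)$ preserves $\mathrm{Dom}\,X$, the graded commutator $[X,\pi(a)]_\pm$ extends to an adjointable operator on $E$, and $\pi(a)(1+X^2)^{-1/2}$ is a compact endomorphism of $E$. -/

import Mathlib

open MeasureTheory Topology
open scoped TensorProduct MultiplierAlgebra CompactlySupported

universe u v

set_option linter.unusedSectionVars false

namespace KK

/-- The positivity axiom of real `C⋆`-algebras: `B` embeds isometrically, as a ⋆-ring, into a complex
`C⋆`-algebra. Together with completeness and the `C⋆`-identity this says, for `ℝ`-algebras, that `B` is
a real `C⋆`-algebra (the `C⋆`-identity alone also holds in `ℂ` with the trivial involution); for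
complex `C⋆`-algebras it is automatic. -/
class RealCStar (B : Type u) [NonUnitalNormedRing B] [StarRing B] : Prop where
  exists_isometry : ∃ (C : Type u) (_ : NonUnitalCStarAlgebra C) (φ : B →⋆ₙ+* C), Isometry φ

instance (priority := 50) RealCStar.ofComplex (B : Type u) [NonUnitalCStarAlgebra B] :
    RealCStar B :=
  ⟨B, inferInstance, NonUnitalStarRingHom.id B, isometry_id⟩

namespace RealCStar

lemma isUnit_one_sub_of_quasiInverse {C : Type*} [NonUnitalCStarAlgebra C] (c q : C)
    (hc : IsSelfAdjoint c) (hq : q = c + c * q) : IsUnit (1 - (c : Unitization ℂ C)) := by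
  have h1 : (1 - (c : Unitization ℂ C)) * (1 + (q : Unitization ℂ C)) = 1 := by
    have : (q : Unitization ℂ C) = c + c * q := by
      conv_lhs => rw [hq]
      simp
    calc _ = 1 + ((q : Unitization ℂ C) - (c + c * q)) := by noncomm_ring
      _ = 1 := by rw [← this]; simp
  have h2 : star (1 + (q : Unitization ℂ C)) * (1 - (c : Unitization ℂ C)) = 1 := by
    have := congrArg star h1
    have hs : star (c : Unitization ℂ C) = c := by rw [← Unitization.inr_star, hc.star_eq]
    rwa [star_mul, star_sub, star_one, hs] at this
  exact isUnit_iff_exists.2 ⟨1 + q, h1, by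
    rw [← left_inv_eq_right_inv h2 h1]; exact h2⟩

variable {B : Type u} [NonUnitalNormedRing B] [StarRing B] [CStarRing B] [CompleteSpace B]
  [NormedSpace ℝ B] [IsScalarTower ℝ B B] [SMulCommClass ℝ B B] [StarModule ℝ B] [RealCStar B]

lemma norm_le_of_isSelfAdjoint (φ : B →⋆ₙ+* B) (hφ : ∀ (r : ℝ) b, φ (r • b) = r • φ b)
    (b : B) (hb : IsSelfAdjoint b) : ‖φ b‖ ≤ ‖b‖ := by
  by_contra! hlt
  obtain ⟨C, _, j, hj⟩ := RealCStar.exists_isometry (B := B)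
  have hjr : ∀ (r : ℝ) b, j (r • b) = r • j b := fun r b => map_real_smul j hj.continuous r b
  have hjn : ∀ b, ‖j b‖ = ‖b‖ := fun b => by simpa using hj.dist_eq b 0
  have hn : ‖(j (φ b) : Unitization ℂ C)‖ = ‖φ b‖ := by rw [Unitization.norm_inr, hjn]
  have hsa : IsSelfAdjoint (j (φ b) : Unitization ℂ C) := by
    rw [IsSelfAdjoint, ← Unitization.inr_star, ← map_star, ← map_star, hb.star_eq]
  have hpos : 0 < ‖φ b‖ := (norm_nonneg b).trans_lt hlt
  obtain ⟨t, ht, hts⟩ : ∃ t : ℝ, |t| = ‖φ b‖ ∧ t ∈ spectrum ℝ (j (φ b) : Unitization ℂ C) := by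
    rcases CStarAlgebra.norm_or_neg_norm_mem_spectrum hsa with h | h
    · exact ⟨_, by rw [hn, abs_of_pos hpos], h⟩
    · exact ⟨_, by rw [hn, abs_neg, abs_of_pos hpos], h⟩
  have ht0 : t ≠ 0 := by rintro rfl; simp at ht; exact hpos.ne ht.symm.symm
  set w : B := t⁻¹ • b with hw
  have hwn : ‖w‖ < 1 := by
    rw [hw, norm_smul, norm_inv, Real.norm_eq_abs, ht, inv_mul_lt_one₀ hpos]; exact hlt
  have hcontr : ContractingWith ‖w‖₊ (fun q : B => w + w * q) := by
    refine ⟨by exact_mod_cast hwn, LipschitzWith.of_dist_le_mul fun x y => ?_⟩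
    rw [dist_add_left, dist_eq_norm, dist_eq_norm, ← mul_sub]
    exact norm_mul_le _ _
  set q := hcontr.fixedPoint with hq
  have hfix : q = w + w * q := hcontr.fixedPoint_isFixedPt.symm
  have hu := isUnit_one_sub_of_quasiInverse (j (φ w)) (j (φ q))
    (by rw [IsSelfAdjoint, ← map_star, ← map_star, hw, star_smul, hb.star_eq]; simp)
    (by conv_lhs => rw [hfix]
        simp)
  refine spectrum.mem_iff.1 hts ?_
  have : algebraMap ℝ (Unitization ℂ C) t - (j (φ b) : Unitization ℂ C)
      = algebraMap ℝ (Unitization ℂ C) t * (1 - (j (φ w) : Unitization ℂ C)) := by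
    rw [mul_sub, mul_one, hw, hφ, hjr, Unitization.inr_smul, Algebra.algebraMap_eq_smul_one,
      smul_one_mul, smul_smul, mul_inv_cancel₀ ht0, one_smul]
  rw [this]
  exact ((IsUnit.mk0 t ht0).map (algebraMap ℝ _)).mul hu

lemma norm_le (φ : B →⋆ₙ+* B) (hφ : ∀ (r : ℝ) b, φ (r • b) = r • φ b) (b : B) :
    ‖φ b‖ ≤ ‖b‖ := by
  have h := norm_le_of_isSelfAdjoint φ hφ (star b * b) (.star_mul_self b)
  rw [map_mul, map_star, CStarRing.norm_star_mul_self, CStarRing.norm_star_mul_self] at h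
  exact (mul_self_le_mul_self_iff (norm_nonneg _) (norm_nonneg _)).2 h

end RealCStar

section Multiplier

variable {𝕜 : Type v} {B : Type u} [RCLike 𝕜] [NonUnitalNormedRing B] [StarRing B] [CStarRing B]
  [CompleteSpace B] [NormedSpace ℝ B] [NormedSpace 𝕜 B] [IsScalarTower ℝ 𝕜 B]
  [IsScalarTower 𝕜 B B] [SMulCommClass 𝕜 B B] [StarModule 𝕜 B]

lemma isScalarTower_real_self (𝕜 : Type v) (B : Type u) [RCLike 𝕜] [NonUnitalNormedRing B]
    [NormedSpace ℝ B] [NormedSpace 𝕜 B] [IsScalarTower ℝ 𝕜 B] [IsScalarTower 𝕜 B B] :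
    IsScalarTower ℝ B B :=
  ⟨fun r a b => by
    rw [← algebraMap_smul 𝕜 r a, ← algebraMap_smul 𝕜 r (a • b), smul_assoc]⟩

lemma smulCommClass_real_self (𝕜 : Type v) (B : Type u) [RCLike 𝕜] [NonUnitalNormedRing B]
    [NormedSpace ℝ B] [NormedSpace 𝕜 B] [IsScalarTower ℝ 𝕜 B] [SMulCommClass 𝕜 B B] :
    SMulCommClass ℝ B B :=
  ⟨fun r a b => by
    rw [← algebraMap_smul 𝕜 r b, ← algebraMap_smul 𝕜 r (a • b), smul_comm]⟩

lemma starModule_real (𝕜 : Type v) (B : Type u) [RCLike 𝕜] [NonUnitalNormedRing B] [StarRing B]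
    [NormedSpace ℝ B] [NormedSpace 𝕜 B] [IsScalarTower ℝ 𝕜 B] [StarModule 𝕜 B] :
    StarModule ℝ B :=
  ⟨fun r a => by
    rw [← algebraMap_smul 𝕜 r a, star_smul, ← algebraMap_smul 𝕜 (star r) (star a)]
    simp⟩

variable [RealCStar B]

/-- ⋆-automorphisms of a real or complex `C⋆`-algebra are isometric. -/
lemma StarAlgEquiv.norm_apply_eq (φ : B ≃⋆ₐ[𝕜] B) (b : B) : ‖φ b‖ = ‖b‖ := by
  have := isScalarTower_real_self 𝕜 B
  have := smulCommClass_real_self 𝕜 B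
  have := starModule_real 𝕜 B
  have key : ∀ (ψ : B ≃⋆ₐ[𝕜] B) b, ‖ψ b‖ ≤ ‖b‖ := fun ψ b =>
    RealCStar.norm_le
      { toFun := ψ, map_mul' := map_mul ψ, map_zero' := map_zero ψ, map_add' := map_add ψ,
        map_star' := map_star ψ }
      (fun r b => by
        change ψ (r • b) = r • ψ b
        rw [← algebraMap_smul 𝕜 r b, ← algebraMap_smul 𝕜 r (ψ b), map_smul]) b
  exact le_antisymm (key φ b) (by simpa using key φ.symm (φ b))

/-- A ⋆-automorphism of `B` as a continuous linear map. -/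
noncomputable def StarAlgEquiv.toCLM (φ : B ≃⋆ₐ[𝕜] B) : B →L[𝕜] B :=
  LinearMap.mkContinuous
    { toFun := φ, map_add' := map_add φ, map_smul' := map_smul φ } 1
    (fun b => by simpa using (StarAlgEquiv.norm_apply_eq φ b).le)

@[simp] lemma StarAlgEquiv.toCLM_apply (φ : B ≃⋆ₐ[𝕜] B) (b : B) :
    StarAlgEquiv.toCLM φ b = φ b := rfl

/-- The extension of a ⋆-automorphism of `B` to the multiplier algebra of `B`, characterised by
`φ(m) φ(b) = φ(m b)` and `φ(b) φ(m) = φ(b m)`. -/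
noncomputable def StarAlgEquiv.multiplierMap (φ : B ≃⋆ₐ[𝕜] B) (m : 𝓜(𝕜, B)) : 𝓜(𝕜, B) where
  fst := (StarAlgEquiv.toCLM φ).comp (m.fst.comp (StarAlgEquiv.toCLM φ.symm))
  snd := (StarAlgEquiv.toCLM φ).comp (m.snd.comp (StarAlgEquiv.toCLM φ.symm))
  central x y := by
    have := congrArg φ (m.central (φ.symm x) (φ.symm y))
    simpa using this

@[simp] lemma StarAlgEquiv.multiplierMap_fst (φ : B ≃⋆ₐ[𝕜] B) (m : 𝓜(𝕜, B)) (b : B) :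
    (StarAlgEquiv.multiplierMap φ m).fst b = φ (m.fst (φ.symm b)) := rfl

@[simp] lemma StarAlgEquiv.multiplierMap_snd (φ : B ≃⋆ₐ[𝕜] B) (m : 𝓜(𝕜, B)) (b : B) :
    (StarAlgEquiv.multiplierMap φ m).snd b = φ (m.snd (φ.symm b)) := rfl

end Multiplier

/-- A twisted `ℝᵈ`-dynamical system `(B, ℝᵈ, α, θ)`. -/
structure TwistedSystem (𝕜 : Type v) (B : Type u) [RCLike 𝕜] [NonUnitalNormedRing B] [StarRing B]
    [CStarRing B] [CompleteSpace B] [NormedSpace ℝ B] [NormedSpace 𝕜 B] [IsScalarTower ℝ 𝕜 B]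
    [IsScalarTower 𝕜 B B] [SMulCommClass 𝕜 B B] [StarModule 𝕜 B] [RealCStar B] (d : ℕ) where
  /-- The action by ⋆-automorphisms. -/
  α : (Fin d → ℝ) → B ≃⋆ₐ[𝕜] B
  /-- The twist, with values in the unitary group of the multiplier algebra. -/
  θ : (Fin d → ℝ) → (Fin d → ℝ) → unitary 𝓜(𝕜, B)
  /-- `α` is strongly continuous. -/
  continuous_α : ∀ b, Continuous fun x => α x b
  /-- `θ` is strictly continuous. -/
  continuous_θ_fst : ∀ b, Continuous fun p : (Fin d → ℝ) × (Fin d → ℝ) =>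
    (θ p.1 p.2 : 𝓜(𝕜, B)).fst b
  continuous_θ_snd : ∀ b, Continuous fun p : (Fin d → ℝ) × (Fin d → ℝ) =>
    (θ p.1 p.2 : 𝓜(𝕜, B)).snd b
  cocycle : ∀ x y z, (θ x y * θ (x + y) z : 𝓜(𝕜, B)) =
    StarAlgEquiv.multiplierMap (α x) (θ y z) * θ x (y + z)
  θ_zero_right : ∀ x, θ x 0 = 1
  θ_zero_left : ∀ x, θ 0 x = 1
  twist : ∀ x y b, ((α x (α y b) : B) : 𝓜(𝕜, B)) =
    θ x y * ((α (x + y) b : B) : 𝓜(𝕜, B)) * star (θ x y : 𝓜(𝕜, B))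

/-- The normalisation `θ(x, -x) = 1`. -/
class TwistedSystem.IsNormalized {𝕜 : Type v} {B : Type u} [RCLike 𝕜] [NonUnitalNormedRing B]
    [StarRing B] [CStarRing B] [CompleteSpace B] [NormedSpace ℝ B] [NormedSpace 𝕜 B]
    [IsScalarTower ℝ 𝕜 B] [IsScalarTower 𝕜 B B] [SMulCommClass 𝕜 B B] [StarModule 𝕜 B]
    [RealCStar B] {d : ℕ} (S : TwistedSystem 𝕜 B d) : Prop where
  θ_neg : ∀ x, S.θ x (-x) = 1

namespace TwistedSystem

variable {𝕜 : Type v} {B : Type u} [RCLike 𝕜] [NonUnitalNormedRing B]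
  [StarRing B] [CStarRing B] [CompleteSpace B] [NormedSpace ℝ B] [NormedSpace 𝕜 B]
  [IsScalarTower ℝ 𝕜 B] [IsScalarTower 𝕜 B B] [SMulCommClass 𝕜 B B] [StarModule 𝕜 B]
  [RealCStar B] {d : ℕ} (S : TwistedSystem 𝕜 B d)

lemma continuous_α_apply {X : Type*} [TopologicalSpace X] {s : X → Fin d → ℝ} {b : X → B}
    (hs : Continuous s) (hb : Continuous b) : Continuous fun p => S.α (s p) (b p) := by
  rw [continuous_iff_continuousAt]
  intro p
  rw [ContinuousAt, tendsto_iff_norm_sub_tendsto_zero]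
  have h1 : Filter.Tendsto (fun q => ‖b q - b p‖ + ‖S.α (s q) (b p) - S.α (s p) (b p)‖)
      (𝓝 p) (𝓝 0) := by
    have c1 : Continuous fun q => ‖b q - b p‖ + ‖S.α (s q) (b p) - S.α (s p) (b p)‖ :=
      (hb.sub continuous_const).norm.add
        ((((S.continuous_α (b p)).comp hs).sub continuous_const).norm)
    simpa using c1.tendsto p
  refine squeeze_zero (fun _ => norm_nonneg _) (fun q => ?_) h1
  calc ‖S.α (s q) (b q) - S.α (s p) (b p)‖
      = ‖S.α (s q) (b q - b p) + (S.α (s q) (b p) - S.α (s p) (b p))‖ := by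
        rw [map_sub]; congr 1; abel
    _ ≤ _ := (norm_add_le _ _).trans (by rw [StarAlgEquiv.norm_apply_eq])

lemma norm_θ_fst (x y : Fin d → ℝ) (b : B) : ‖(S.θ x y : 𝓜(𝕜, B)).fst b‖ = ‖b‖ := by
  have hu : star (S.θ x y : 𝓜(𝕜, B)) * (S.θ x y : 𝓜(𝕜, B)) = 1 := Unitary.coe_star_mul_self _
  have h : star ((S.θ x y : 𝓜(𝕜, B)).fst b) * (S.θ x y : 𝓜(𝕜, B)).fst b = star b * b := by
    have h1 := (star (S.θ x y : 𝓜(𝕜, B))).central (star b) ((S.θ x y : 𝓜(𝕜, B)).fst b)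
    rw [DoubleCentralizer.star_snd, star_star] at h1
    rw [h1]
    congr 1
    exact congrArg (fun m : 𝓜(𝕜, B) => m.fst b) hu
  have h2 := congrArg norm h
  rw [CStarRing.norm_star_mul_self, CStarRing.norm_star_mul_self] at h2
  exact (mul_self_inj (norm_nonneg _) (norm_nonneg _)).1 h2

lemma continuous_θ_fst_apply {X : Type*} [TopologicalSpace X] {s t : X → Fin d → ℝ} {b : X → B}
    (hs : Continuous s) (ht : Continuous t) (hb : Continuous b) :
    Continuous fun p => (S.θ (s p) (t p) : 𝓜(𝕜, B)).fst (b p) := by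
  rw [continuous_iff_continuousAt]
  intro p
  rw [ContinuousAt, tendsto_iff_norm_sub_tendsto_zero]
  have h1 : Filter.Tendsto (fun q => ‖b q - b p‖ + ‖(S.θ (s q) (t q) : 𝓜(𝕜, B)).fst (b p)
      - (S.θ (s p) (t p) : 𝓜(𝕜, B)).fst (b p)‖) (𝓝 p) (𝓝 0) := by
    have c1 : Continuous fun q => ‖b q - b p‖ + ‖(S.θ (s q) (t q) : 𝓜(𝕜, B)).fst (b p)
      - (S.θ (s p) (t p) : 𝓜(𝕜, B)).fst (b p)‖ :=
      (hb.sub continuous_const).norm.add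
        ((((S.continuous_θ_fst (b p)).comp (hs.prodMk ht)).sub continuous_const).norm)
    simpa using c1.tendsto p
  refine squeeze_zero (fun _ => norm_nonneg _) (fun q => ?_) h1
  calc ‖(S.θ (s q) (t q) : 𝓜(𝕜, B)).fst (b q) - (S.θ (s p) (t p) : 𝓜(𝕜, B)).fst (b p)‖
      = ‖(S.θ (s q) (t q) : 𝓜(𝕜, B)).fst (b q - b p) +
        ((S.θ (s q) (t q) : 𝓜(𝕜, B)).fst (b p) - (S.θ (s p) (t p) : 𝓜(𝕜, B)).fst (b p))‖ := by
        rw [map_sub]; congr 1; abel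
    _ ≤ _ := (norm_add_le _ _).trans (by rw [norm_θ_fst])

section Normalized

variable [S.IsNormalized]

lemma α_zero (b : B) : S.α 0 b = b := by
  have h2 : ∀ c, S.α 0 (S.α 0 b) * c = S.α 0 b * c := fun c => by
    have := congrArg (fun m : 𝓜(𝕜, B) => m.fst c) (S.twist 0 0 b)
    simpa [S.θ_zero_left] using this
  have h3 : S.α 0 (S.α 0 b) = S.α 0 b := by
    rw [← sub_eq_zero, ← CStarRing.mul_star_self_eq_zero_iff, sub_mul, h2, sub_self]
  exact (S.α 0).injective h3

lemma mul_left_ext {a b : B} (h : ∀ c, a * c = b * c) : a = b := by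
  rw [← sub_eq_zero, ← CStarRing.mul_star_self_eq_zero_iff, sub_mul, h, sub_self]

lemma α_α_mul (x y : Fin d → ℝ) (b c : B) : S.α x (S.α y b) * c =
    (S.θ x y : 𝓜(𝕜, B)).fst (S.α (x + y) b * (star (S.θ x y : 𝓜(𝕜, B))).fst c) :=
  congrArg (fun m : 𝓜(𝕜, B) => m.fst c) (S.twist x y b)

lemma α_neg_α (x : Fin d → ℝ) (b : B) : S.α (-x) (S.α x b) = b := by
  refine mul_left_ext fun c => ?_
  have hn : S.θ (-x) x = 1 := by simpa using IsNormalized.θ_neg (S := S) (-x)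
  rw [S.α_α_mul, hn, neg_add_cancel, S.α_zero]
  simp

lemma α_symm (x : Fin d → ℝ) (b : B) : (S.α x).symm b = S.α (-x) b := by
  rw [StarAlgEquiv.symm_apply_eq]
  simpa using (S.α_neg_α (-x) b).symm

lemma fst_mul (m : 𝓜(𝕜, B)) (a b : B) : m.fst (a * b) = m.fst a * b := by
  have h : ∀ c, c * m.fst (a * b) = c * (m.fst a * b) := fun c => by
    rw [← m.central, ← mul_assoc, ← mul_assoc, m.central]
  rw [← sub_eq_zero, ← CStarRing.star_mul_self_eq_zero_iff, mul_sub, h, sub_self]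

lemma multiplierMap_one (φ : B ≃⋆ₐ[𝕜] B) : StarAlgEquiv.multiplierMap φ (1 : 𝓜(𝕜, B)) = 1 := by
  ext b
  · change φ (φ.symm b) = b
    simp
  · change φ (φ.symm b) = b
    simp

lemma θ_mul_θ (x y : Fin d → ℝ) : (S.θ x y * S.θ (x + y) (-y) : 𝓜(𝕜, B)) = 1 := by
  rw [S.cocycle, IsNormalized.θ_neg, add_neg_cancel, S.θ_zero_right]
  simp [multiplierMap_one]

lemma star_θ (x y : Fin d → ℝ) : star (S.θ x y : 𝓜(𝕜, B)) = S.θ (x + y) (-y) := by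
  have h : star (S.θ x y : 𝓜(𝕜, B)) * (S.θ x y : 𝓜(𝕜, B)) = 1 := Unitary.coe_star_mul_self _
  exact left_inv_eq_right_inv h (S.θ_mul_θ x y)

lemma θ_fst_θ_fst (x y : Fin d → ℝ) (b : B) :
    (S.θ x y : 𝓜(𝕜, B)).fst ((S.θ (x + y) (-y) : 𝓜(𝕜, B)).fst b) = b :=
  congrArg (fun m : 𝓜(𝕜, B) => m.fst b) (S.θ_mul_θ x y)

/-- Under the normalisation, `α_{-x}(θ(y, x - y)) = θ(-x, y)`. -/
lemma multiplierMap_θ (x y : Fin d → ℝ) :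
    StarAlgEquiv.multiplierMap (S.α (-x)) (S.θ y (x - y)) = S.θ (-x) y := by
  have h := S.cocycle (-x) y (x - y)
  have h1 : S.θ (-x + y) (x - y) = 1 := by
    have := IsNormalized.θ_neg (S := S) (-x + y)
    rwa [show -(-x + y) = x - y by abel] at this
  have h2 : S.θ (-x) x = 1 := by simpa using IsNormalized.θ_neg (S := S) (-x)
  rw [add_sub_cancel, h1, h2] at h
  simpa using h.symm

lemma α_θ_fst (a b c : Fin d → ℝ) (u : B) : S.α a ((S.θ b c : 𝓜(𝕜, B)).fst u) =
    (S.θ a b : 𝓜(𝕜, B)).fst ((S.θ (a + b) c : 𝓜(𝕜, B)).fst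
      ((S.θ (a + (b + c)) (-(b + c)) : 𝓜(𝕜, B)).fst (S.α a u))) := by
  have h := congrArg (fun m : 𝓜(𝕜, B) => m.fst
    ((S.θ (a + (b + c)) (-(b + c)) : 𝓜(𝕜, B)).fst (S.α a u))) (S.cocycle a b c)
  change (S.θ a b : 𝓜(𝕜, B)).fst ((S.θ (a + b) c : 𝓜(𝕜, B)).fst _) =
    S.α a ((S.θ b c : 𝓜(𝕜, B)).fst ((S.α a).symm ((S.θ a (b + c) : 𝓜(𝕜, B)).fst _))) at h
  rw [h, S.θ_fst_θ_fst]
  simp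

end Normalized

/-- The pointwise identity behind associativity of the twisted convolution. -/
lemma assoc_aux [S.IsNormalized] (x y z : Fin d → ℝ) (a b c : B) :
    (S.θ (-x) y : 𝓜(𝕜, B)).fst
      (S.α (y - x) ((S.θ (-y) z : 𝓜(𝕜, B)).fst (S.α (z - y) a * b)) * c) =
    (S.θ (-x) z : 𝓜(𝕜, B)).fst (S.α (z - x) a *
      (S.θ (z - x) (y - z) : 𝓜(𝕜, B)).fst (S.α (y - x) b * c)) := by
  rw [S.α_θ_fst, ← fst_mul, ← fst_mul, ← fst_mul]
  have e1 : y - x = -x + y := by abel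
  have e2 : -x + y + -y = -x := by abel
  have e3 : -x + y + (-y + z) = z - x := by abel
  have e4 : -(-y + z) = y - z := by abel
  rw [map_mul (S.α (y - x)), mul_assoc, S.α_α_mul, S.star_θ]
  have e5 : y - x + (z - y) = z - x := by abel
  have e6 : -(z - y) = y - z := by abel
  rw [e5, e6, e1, S.θ_fst_θ_fst, e2, e3, e4]
  have h := S.θ_fst_θ_fst (z - x) (y - z)
  have e7 : z - x + (y - z) = -x + y := by abel
  have e8 : -(y - z) = z - y := by abel
  rw [e7, e8] at h
  rw [h]

/-- The underlying space of the twisted convolution algebra `C_c(ℝᵈ, B)`. -/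
def Cc (_ : TwistedSystem 𝕜 B d) : Type u := C_c(Fin d → ℝ, B)

namespace Cc

variable {S}

noncomputable instance : AddCommGroup S.Cc := inferInstanceAs (AddCommGroup C_c(Fin d → ℝ, B))
noncomputable instance : Module 𝕜 S.Cc := inferInstanceAs (Module 𝕜 C_c(Fin d → ℝ, B))
noncomputable instance : Module ℝ S.Cc := inferInstanceAs (Module ℝ C_c(Fin d → ℝ, B))
instance : FunLike S.Cc (Fin d → ℝ) B := inferInstanceAs (FunLike C_c(Fin d → ℝ, B) _ _)

lemma continuous (f : S.Cc) : Continuous f := f.toContinuousMap.continuous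
lemma hasCompactSupport (f : S.Cc) : HasCompactSupport f := f.hasCompactSupport'

@[ext] lemma ext {f g : S.Cc} (h : ∀ x, f x = g x) : f = g := DFunLike.ext _ _ h

@[simp] lemma add_apply (f g : S.Cc) (x : Fin d → ℝ) : (f + g) x = f x + g x := rfl
@[simp] lemma zero_apply (x : Fin d → ℝ) : (0 : S.Cc) x = 0 := rfl
@[simp] lemma smul_apply (k : 𝕜) (f : S.Cc) (x : Fin d → ℝ) : (k • f) x = k • f x := rfl
@[simp] lemma real_smul_apply (k : ℝ) (f : S.Cc) (x : Fin d → ℝ) : (k • f) x = k • f x := rfl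

instance : IsScalarTower ℝ 𝕜 S.Cc := ⟨fun r k f => by ext x; simp [smul_assoc]⟩

end Cc
end TwistedSystem

namespace TwistedSystem

variable {𝕜 : Type v} {B : Type u} [RCLike 𝕜] [NonUnitalNormedRing B]
  [StarRing B] [CStarRing B] [CompleteSpace B] [NormedSpace ℝ B] [NormedSpace 𝕜 B]
  [IsScalarTower ℝ 𝕜 B] [IsScalarTower 𝕜 B B] [SMulCommClass 𝕜 B B] [StarModule 𝕜 B]
  [RealCStar B] {d : ℕ} (S : TwistedSystem 𝕜 B d)

/-- The pointwise identity behind `(f ∗ g)^* = g^* ∗ f^*`. -/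
lemma star_aux [S.IsNormalized] (x y : Fin d → ℝ) (p q : B) :
    S.α (-x) (star ((S.θ x (y - x) : 𝓜(𝕜, B)).fst (S.α y (star q) * star p))) =
    (S.θ (-x) y : 𝓜(𝕜, B)).fst (S.α (y - x) (S.α (-y) p) * S.α (y - x) q) := by
  have hR : (S.θ (-x) y : 𝓜(𝕜, B)).fst (S.α (y - x) (S.α (-y) p) * S.α (y - x) q) =
      S.α (-x) p * (S.θ (-x) y : 𝓜(𝕜, B)).fst (S.α (y - x) q) := by
    rw [S.α_α_mul, S.star_θ, show y - x + -y = -x by abel, neg_neg,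
      show y - x = -x + y by abel, S.θ_fst_θ_fst]
  rw [hR]
  refine mul_left_ext fun c => ?_
  obtain ⟨w, rfl⟩ : ∃ w, S.α (-x) w = c := (S.α (-x)).surjective c
  have hL : star ((S.θ x (y - x) : 𝓜(𝕜, B)).fst (S.α y (star q) * star p)) * w =
      p * (S.α y q * (S.θ y (x - y) : 𝓜(𝕜, B)).fst w) := by
    have h := (star (S.θ x (y - x) : 𝓜(𝕜, B))).central (p * S.α y q) w
    rw [DoubleCentralizer.star_snd, S.star_θ, show x + (y - x) = y by abel,
      show -(y - x) = x - y by abel, star_mul, ← map_star (S.α y), mul_assoc] at h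
    exact h
  have hm : S.α (-x) ((S.θ y (x - y) : 𝓜(𝕜, B)).fst w) =
      (S.θ (-x) y : 𝓜(𝕜, B)).fst (S.α (-x) w) := by
    rw [← S.multiplierMap_θ, StarAlgEquiv.multiplierMap_fst]
    simp
  have hs : ∀ v, (star (S.θ (-x) y : 𝓜(𝕜, B))).fst ((S.θ (-x) y : 𝓜(𝕜, B)).fst v) = v := fun v =>
    congrArg (fun m : 𝓜(𝕜, B) => m.fst v) (Unitary.coe_star_mul_self (S.θ (-x) y))
  rw [← map_mul, hL, map_mul, map_mul, hm, S.α_α_mul, hs, mul_assoc, fst_mul,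
    show -x + y = y - x by abel]

namespace Cc

variable {S} [S.IsNormalized]

/-- The integrand of the twisted convolution. -/
noncomputable def convIntegrand (f g : S.Cc) (x y : Fin d → ℝ) : B :=
  (StarAlgEquiv.multiplierMap (S.α (-x)) (S.θ y (x - y))).fst (S.α (y - x) (f y) * g (x - y))

lemma convIntegrand_eq (f g : S.Cc) (x y : Fin d → ℝ) : convIntegrand f g x y =
    (S.θ (-x) y : 𝓜(𝕜, B)).fst (S.α (y - x) (f y) * g (x - y)) := by
  rw [convIntegrand, S.multiplierMap_θ]

lemma continuous_convIntegrand (f g : S.Cc) :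
    Continuous (Function.uncurry (convIntegrand f g)) := by
  have : Function.uncurry (convIntegrand f g) = fun p : (Fin d → ℝ) × (Fin d → ℝ) =>
      (S.θ (-p.1) p.2 : 𝓜(𝕜, B)).fst (S.α (p.2 - p.1) (f p.2) * g (p.1 - p.2)) :=
    funext fun p => convIntegrand_eq f g p.1 p.2
  rw [this]
  exact S.continuous_θ_fst_apply (by fun_prop) (by fun_prop)
    ((S.continuous_α_apply (by fun_prop) (f.continuous.comp continuous_snd)).mul
      (g.continuous.comp (by fun_prop)))

lemma convIntegrand_eq_zero_left (f g : S.Cc) (x y : Fin d → ℝ) (h : f y = 0) :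
    convIntegrand f g x y = 0 := by
  simp [convIntegrand_eq, h]

lemma convIntegrand_eq_zero_right (f g : S.Cc) (x y : Fin d → ℝ) (h : g (x - y) = 0) :
    convIntegrand f g x y = 0 := by
  simp [convIntegrand_eq, h]

lemma integrable_convIntegrand (f g : S.Cc) (x : Fin d → ℝ) :
    Integrable (convIntegrand f g x) := by
  refine Continuous.integrable_of_hasCompactSupport
    ((continuous_convIntegrand f g).comp (Continuous.prodMk_right x)) ?_
  exact f.hasCompactSupport.mono fun y hy hf =>
    hy (convIntegrand_eq_zero_left f g x y hf)

/-- The twisted convolution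
`(f ∗ g)(x) = ∫ α_{-x}(θ(y, x - y)) α_{y-x}(f(y)) g(x - y) dy`. -/
noncomputable instance : Mul S.Cc where
  mul f g :=
    { toFun := fun x => ∫ y, convIntegrand f g x y
      continuous_toFun := by
        have : (fun x => ∫ y, convIntegrand f g x y) =
            fun x => ∫ y in tsupport f, convIntegrand f g x y := funext fun x =>
          (setIntegral_eq_integral_of_forall_compl_eq_zero fun y hy =>
            convIntegrand_eq_zero_left f g x y (image_eq_zero_of_notMem_tsupport hy)).symm
        rw [this]
        exact continuous_parametric_integral_of_continuous (continuous_convIntegrand f g)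
          f.hasCompactSupport
      hasCompactSupport' := by
        refine HasCompactSupport.intro (IsCompact.add f.hasCompactSupport g.hasCompactSupport) fun x hx => ?_
        rw [integral_eq_zero_of_ae]
        refine Filter.Eventually.of_forall fun y => ?_
        by_cases hy : y ∈ tsupport f
        · refine convIntegrand_eq_zero_right f g x y (image_eq_zero_of_notMem_tsupport fun h => ?_)
          exact hx ⟨y, hy, x - y, h, by simp⟩
        · exact convIntegrand_eq_zero_left f g x y (image_eq_zero_of_notMem_tsupport hy) }

lemma mul_apply (f g : S.Cc) (x : Fin d → ℝ) : (f * g) x = ∫ y, (StarAlgEquiv.multiplierMap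
    (S.α (-x)) (S.θ y (x - y))).fst (S.α (y - x) (f y) * g (x - y)) := rfl

lemma mul_apply' (f g : S.Cc) (x : Fin d → ℝ) : (f * g) x = ∫ y, convIntegrand f g x y := rfl

/-- The involution `f^*(x) = α_{-x}(f(-x)^*)`. -/
noncomputable instance : Star S.Cc where
  star f :=
    { toFun := fun x => S.α (-x) (star (f (-x)))
      continuous_toFun := S.continuous_α_apply (by fun_prop)
        ((f.continuous.comp continuous_neg).star)
      hasCompactSupport' := by
        have h : HasCompactSupport fun x => f (-x) :=
          f.hasCompactSupport.comp_homeomorph (Homeomorph.neg _)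
        exact h.mono fun x hx hf => hx (by simp [hf]) }

lemma star_apply (f : S.Cc) (x : Fin d → ℝ) : (star f) x = S.α (-x) (star (f (-x))) := rfl

lemma conv_assoc (f g h : S.Cc) : f * g * h = f * (g * h) := by
  ext x
  have hL : ∀ y, convIntegrand (f * g) h x y = ∫ z, (S.θ (-x) z : 𝓜(𝕜, B)).fst
      (S.α (z - x) (f z) * (S.θ (z - x) (y - z) : 𝓜(𝕜, B)).fst
        (S.α (y - x) (g (y - z)) * h (x - y))) := fun y => by
    have hT := ((S.θ (-x) y : 𝓜(𝕜, B)).fst.comp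
      (((ContinuousLinearMap.mul 𝕜 B).flip (h (x - y))).comp
        (StarAlgEquiv.toCLM (S.α (y - x))))).integral_comp_comm (integrable_convIntegrand f g y)
    rw [convIntegrand_eq, mul_apply']
    refine hT.symm.trans (integral_congr_ae (Filter.Eventually.of_forall fun z => ?_))
    simp only [ContinuousLinearMap.comp_apply, ContinuousLinearMap.flip_apply,
      ContinuousLinearMap.mul_apply', StarAlgEquiv.toCLM_apply, convIntegrand_eq]
    exact S.assoc_aux x y z _ _ _
  have hR : ∀ z, convIntegrand f (g * h) x z = ∫ y, (S.θ (-x) z : 𝓜(𝕜, B)).fst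
      (S.α (z - x) (f z) * (S.θ (z - x) (y - z) : 𝓜(𝕜, B)).fst
        (S.α (y - x) (g (y - z)) * h (x - y))) := fun z => by
    have hT := ((S.θ (-x) z : 𝓜(𝕜, B)).fst.comp
      ((ContinuousLinearMap.mul 𝕜 B) (S.α (z - x) (f z)))).integral_comp_comm
        (integrable_convIntegrand g h (x - z))
    rw [convIntegrand_eq, mul_apply']
    refine hT.symm.trans ?_
    rw [← integral_sub_right_eq_self _ z]
    refine integral_congr_ae (Filter.Eventually.of_forall fun y => ?_)
    simp only [ContinuousLinearMap.comp_apply, ContinuousLinearMap.mul_apply', convIntegrand_eq]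
    rw [show -(x - z) = z - x by abel, show y - z - (x - z) = y - x by abel,
      show x - z - (y - z) = x - y by abel]
  rw [mul_apply', mul_apply']
  simp_rw [hL, hR]
  refine integral_integral_swap_of_hasCompactSupport ?_ ?_
  · exact S.continuous_θ_fst_apply (by fun_prop) (by fun_prop)
      ((S.continuous_α_apply (by fun_prop) (f.continuous.comp (by fun_prop))).mul
        (S.continuous_θ_fst_apply (by fun_prop) (by fun_prop)
          ((S.continuous_α_apply (by fun_prop) (g.continuous.comp (by fun_prop))).mul
            (h.continuous.comp (by fun_prop)))))
  · refine HasCompactSupport.intro ((IsCompact.add f.hasCompactSupport g.hasCompactSupport).prod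
      f.hasCompactSupport) fun p hp => ?_
    by_cases h2 : p.2 ∈ tsupport f
    · have : g (p.1 - p.2) = 0 := image_eq_zero_of_notMem_tsupport fun h1 =>
        hp ⟨⟨p.2, h2, p.1 - p.2, h1, by simp⟩, h2⟩
      simp [Function.uncurry, this]
    · simp [Function.uncurry, image_eq_zero_of_notMem_tsupport h2]

noncomputable instance : NonUnitalRing S.Cc where
  left_distrib f g h := by
    ext x
    rw [add_apply, mul_apply', mul_apply', mul_apply',
      ← integral_add (integrable_convIntegrand f g x) (integrable_convIntegrand f h x)]
    exact integral_congr_ae (Filter.Eventually.of_forall fun y => by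
      simp [convIntegrand_eq, mul_add])
  right_distrib f g h := by
    ext x
    rw [add_apply, mul_apply', mul_apply', mul_apply',
      ← integral_add (integrable_convIntegrand f h x) (integrable_convIntegrand g h x)]
    exact integral_congr_ae (Filter.Eventually.of_forall fun y => by
      simp [convIntegrand_eq, add_mul])
  zero_mul f := by ext x; simp [mul_apply', convIntegrand_eq]
  mul_zero f := by ext x; simp [mul_apply', convIntegrand_eq]
  mul_assoc := conv_assoc

instance : IsScalarTower 𝕜 S.Cc S.Cc := ⟨fun k f g => by
  ext x
  simp only [smul_eq_mul, smul_apply, mul_apply']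
  rw [← integral_smul]
  exact integral_congr_ae (Filter.Eventually.of_forall fun y => by
      simp [convIntegrand_eq, smul_mul_assoc])⟩

instance : SMulCommClass 𝕜 S.Cc S.Cc := ⟨fun k f g => by
  ext x
  simp only [smul_eq_mul, smul_apply, mul_apply']
  rw [← integral_smul]
  exact integral_congr_ae (Filter.Eventually.of_forall fun y => by
      simp [convIntegrand_eq, mul_smul_comm])⟩

instance : IsScalarTower ℝ S.Cc S.Cc := ⟨fun k f g => by
  rw [← algebraMap_smul 𝕜 k f, ← algebraMap_smul 𝕜 k (f • g), smul_assoc]⟩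

instance : SMulCommClass ℝ S.Cc S.Cc := ⟨fun k f g => by
  rw [← algebraMap_smul 𝕜 k g, ← algebraMap_smul 𝕜 k (f • g), smul_comm]⟩

noncomputable instance : StarRing S.Cc where
  star_involutive f := by
    ext x
    have := S.α_neg_α x (f x)
    simp [star_apply, ← map_star, S.α_neg_α]
  star_add f g := by ext x; simp [star_apply]
  star_mul f g := by
    ext x
    have := starModule_real 𝕜 B
    have h1 := ((StarAlgEquiv.toCLM (S.α (-x))).restrictScalars ℝ |>.comp
      ((starL' ℝ : B ≃L[ℝ] B) : B →L[ℝ] B)).integral_comp_comm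
        (integrable_convIntegrand f g (-x))
    rw [star_apply, mul_apply', mul_apply']
    refine h1.symm.trans ?_
    rw [← integral_sub_right_eq_self _ x]
    refine integral_congr_ae (Filter.Eventually.of_forall fun y => ?_)
    change S.α (-x) (star (convIntegrand f g (-x) (y - x))) = _
    rw [convIntegrand_eq, convIntegrand_eq, star_apply, star_apply,
      show y - x - -x = y by abel, show -x - (y - x) = -y by abel, neg_neg,
      show -(x - y) = y - x by abel]
    simpa using S.star_aux x y (star (g (-y))) (star (f (y - x)))

instance : StarModule 𝕜 S.Cc := ⟨fun k f => by ext x; simp [star_apply]⟩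

instance : StarModule ℝ S.Cc := ⟨fun k f => by
  rw [← algebraMap_smul 𝕜 k f, star_smul, ← algebraMap_smul 𝕜 (star k) (star f)]
  simp⟩

end Cc
end TwistedSystem

section CauchySchwarz

lemma cauchySchwarz_aux {C : Type u} [NonUnitalCStarAlgebra C] {d : ℕ} (F G : (Fin d → ℝ) → C)
    (hF : Continuous F) (hFc : HasCompactSupport F) (hG : Continuous G)
    (hGc : HasCompactSupport G) :
    ‖∫ x, star (F x) * G x‖ ^ 2 ≤ ‖∫ x, star (F x) * F x‖ * ‖∫ x, star (G x) * G x‖ := by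
  let _ := CStarAlgebra.spectralOrder C
  have _ := CStarAlgebra.spectralOrderedRing C
  have hint : ∀ {U W : (Fin d → ℝ) → C}, Continuous U → Continuous W → HasCompactSupport W →
      Integrable fun x => star (U x) * W x := fun hU hW hWc =>
    (hU.star.mul hW).integrable_of_hasCompactSupport
      (hWc.mono fun x hx h => hx (by simp [h]))
  have hcm : ∀ {U : (Fin d → ℝ) → C} (c : C), Integrable U → Integrable fun x => c * U x :=
    fun c hU => (ContinuousLinearMap.mul ℝ C c).integrable_comp hU
  have hmc : ∀ {U : (Fin d → ℝ) → C} (c : C), Integrable U → Integrable fun x => U x * c :=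
    fun c hU => ((ContinuousLinearMap.mul ℝ C).flip c).integrable_comp hU
  set P := ∫ x, star (F x) * F x with hP
  set Q := ∫ x, star (F x) * G x with hQ
  set R := ∫ x, star (G x) * G x with hR
  have hQs : star Q = ∫ x, star (G x) * F x := by
    have := ((starL' ℝ : C ≃L[ℝ] C) : C →L[ℝ] C).integral_comp_comm (hint hF hG hGc)
    rw [hQ]
    refine this.symm.trans (integral_congr_ae (Filter.Eventually.of_forall fun x => ?_))
    simp
  have hPs : IsSelfAdjoint P := by
    have := ((starL' ℝ : C ≃L[ℝ] C) : C →L[ℝ] C).integral_comp_comm (hint hF hF hFc)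
    rw [IsSelfAdjoint, hP]
    refine this.symm.trans (integral_congr_ae (Filter.Eventually.of_forall fun x => ?_))
    simp
  have key : ∀ t : ℝ, 0 ≤ star Q * P * Q - t • (star Q * Q) - t • (star Q * Q) + t ^ 2 • R := by
    intro t
    have h0 : 0 ≤ ∫ x, star (F x * Q - t • G x) * (F x * Q - t • G x) :=
      integral_nonneg fun x => star_mul_self_nonneg _
    have e : ∀ x, star (F x * Q - t • G x) * (F x * Q - t • G x) =
        star Q * (star (F x) * F x) * Q - t • (star Q * (star (F x) * G x))
          - t • (star (G x) * F x * Q) + t ^ 2 • (star (G x) * G x) := fun x => by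
      simp only [star_sub, star_mul, star_smul, star_trivial, sub_mul, mul_sub, smul_mul_assoc,
        mul_smul_comm, smul_sub, mul_assoc, pow_two, mul_smul]
      abel
    simp_rw [e] at h0
    have i1 := hint hF hF hFc
    have i2 := hint hF hG hGc
    have i3 := hint hG hF hFc
    have i4 := hint hG hG hGc
    have c1 : ∫ x, star Q * (star (F x) * F x) * Q = star Q * P * Q := by
      rw [integral_mul_const_of_integrable (hcm (star Q) i1), integral_const_mul_of_integrable i1]
    have c2 : ∫ x, t • (star Q * (star (F x) * G x)) = t • (star Q * Q) := by
      rw [integral_smul, integral_const_mul_of_integrable i2]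
    have c3 : ∫ x, t • (star (G x) * F x * Q) = t • (star Q * Q) := by
      rw [integral_smul, integral_mul_const_of_integrable i3, hQs]
    have c4 : ∫ x, t ^ 2 • (star (G x) * G x) = t ^ 2 • R := by rw [integral_smul]
    rwa [integral_add, integral_sub, integral_sub, c1, c2, c3, c4] at h0
    · exact hmc Q (hcm (star Q) i1)
    · exact (hcm (star Q) i2).smul t
    · exact (hmc Q (hcm (star Q) i1)).sub ((hcm (star Q) i2).smul t)
    · exact (hmc Q i3).smul t
    · exact ((hmc Q (hcm (star Q) i1)).sub ((hcm (star Q) i2).smul t)).sub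
        ((hmc Q i3).smul t)
    · exact i4.smul _
  have main : ∀ ε : ℝ, 0 < ε → ‖Q‖ ^ 2 ≤ (‖P‖ + ε) * ‖R‖ := by
    intro ε hε
    set t := ‖P‖ + ε with ht
    have htpos : 0 < t := by positivity
    have h1 : star Q * P * Q ≤ t • (star Q * Q) :=
      (CStarAlgebra.star_left_conjugate_le_norm_smul hPs).trans
        (smul_le_smul_of_nonneg_right (by simp [ht, hε.le]) (star_mul_self_nonneg _))
    have h2 : t • (star Q * Q) ≤ t ^ 2 • R := by
      have h3 := key t
      have h4 : star Q * P * Q - t • (star Q * Q) - t • (star Q * Q) + t ^ 2 • R ≤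
          t • (star Q * Q) - t • (star Q * Q) - t • (star Q * Q) + t ^ 2 • R := by gcongr
      have h5 := h3.trans h4
      rw [sub_self, zero_sub] at h5
      simpa using add_le_add_left h5 (t • (star Q * Q))
    have h6 := CStarAlgebra.norm_le_norm_of_nonneg_of_le
      (smul_nonneg htpos.le (star_mul_self_nonneg Q)) h2
    rw [norm_smul, norm_smul, CStarRing.norm_star_mul_self, Real.norm_eq_abs, Real.norm_eq_abs,
      abs_of_pos htpos, abs_of_pos (by positivity), pow_two t, mul_assoc] at h6
    rw [pow_two]
    exact le_of_mul_le_mul_left h6 htpos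
  refine le_of_forall_pos_le_add fun ε hε => ?_
  have h := main (ε / (‖R‖ + 1)) (by positivity)
  refine h.trans ?_
  rw [add_mul]
  gcongr
  rw [div_mul_eq_mul_div, div_le_iff₀ (by positivity)]
  nlinarith [norm_nonneg R]

end CauchySchwarz

namespace TwistedSystem

variable {𝕜 : Type v} {B : Type u} [RCLike 𝕜] [NonUnitalNormedRing B]
  [StarRing B] [CStarRing B] [CompleteSpace B] [NormedSpace ℝ B] [NormedSpace 𝕜 B]
  [IsScalarTower ℝ 𝕜 B] [IsScalarTower 𝕜 B B] [SMulCommClass 𝕜 B B] [StarModule 𝕜 B]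
  [RealCStar B] {d : ℕ} (S : TwistedSystem 𝕜 B d)

namespace Cc

variable {S}

/-- The `B`-valued inner product `(f | g)_B = ∫ f(x)^* g(x) dx`. -/
noncomputable def inner (f g : S.Cc) : B := ∫ x, star (f x) * g x

/-- The norm `‖(f | f)_B‖^{1/2}` on `C_c(ℝᵈ, B)`. -/
noncomputable instance : Norm S.Cc := ⟨fun f => √‖inner f f‖⟩

lemma norm_def (f : S.Cc) : ‖f‖ = √‖inner f f‖ := rfl

lemma norm_sq (f : S.Cc) : ‖f‖ ^ 2 = ‖inner f f‖ := Real.sq_sqrt (norm_nonneg _)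

lemma integrable_inner (f g : S.Cc) : Integrable fun x => star (f x) * g x :=
  (f.continuous.star.mul g.continuous).integrable_of_hasCompactSupport
    (g.hasCompactSupport.mono fun x hx h => hx (by simp [h]))

lemma inner_add_right (f g h : S.Cc) : inner f (g + h) = inner f g + inner f h := by
  rw [inner, inner, inner, ← integral_add (integrable_inner f g) (integrable_inner f h)]
  simp [mul_add]

lemma inner_add_left (f g h : S.Cc) : inner (f + g) h = inner f h + inner g h := by
  rw [inner, inner, inner, ← integral_add (integrable_inner f h) (integrable_inner g h)]
  simp [add_mul]

lemma inner_smul_smul (k : 𝕜) (f : S.Cc) : inner (k • f) (k • f) = (star k * k) • inner f f := by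
  rw [inner, inner, ← integral_smul]
  simp [smul_mul_assoc, mul_smul_comm, smul_smul, mul_comm]

lemma norm_inner_le (f g : S.Cc) : ‖inner f g‖ ≤ ‖f‖ * ‖g‖ := by
  obtain ⟨C, _, j, hj⟩ := RealCStar.exists_isometry (B := B)
  have hjn : ∀ b, ‖j b‖ = ‖b‖ := fun b => by simpa using hj.dist_eq b 0
  let J : B →L[ℝ] C := AddMonoidHom.toRealLinearMap
    { toFun := j, map_zero' := map_zero j, map_add' := map_add j } hj.continuous
  have hJ : ∀ u w : S.Cc, j (inner u w) = ∫ x, star (j (u x)) * j (w x) := fun u w => by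
    refine (J.integral_comp_comm (integrable_inner u w)).symm.trans ?_
    refine integral_congr_ae (Filter.Eventually.of_forall fun x => ?_)
    change j (star (u x) * w x) = _
    rw [map_mul, map_star]
  have hc : ∀ u : S.Cc, HasCompactSupport fun x => j (u x) := fun u =>
    u.hasCompactSupport.mono fun x hx h => hx (by simp [h])
  have h := cauchySchwarz_aux (fun x => j (f x)) (fun x => j (g x))
    (hj.continuous.comp f.continuous) (hc f) (hj.continuous.comp g.continuous) (hc g)
  rw [← hJ, ← hJ, ← hJ, hjn, hjn, hjn, ← norm_sq, ← norm_sq, ← mul_pow] at h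
  exact (pow_le_pow_iff_left₀ (norm_nonneg _)
    (mul_nonneg (Real.sqrt_nonneg _) (Real.sqrt_nonneg _)) two_ne_zero).1 h

lemma seminormedCore : SeminormedSpace.Core 𝕜 S.Cc where
  norm_nonneg f := Real.sqrt_nonneg _
  norm_smul k f := by
    rw [norm_def, inner_smul_smul, norm_smul, norm_mul, norm_star, ← pow_two,
      Real.sqrt_mul (by positivity), Real.sqrt_sq (norm_nonneg _), norm_def]
  norm_triangle f g := by
    have h : ‖f + g‖ ^ 2 ≤ (‖f‖ + ‖g‖) ^ 2 := by
      rw [norm_sq, inner_add_right, inner_add_left, inner_add_left]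
      calc _ ≤ ‖inner f f‖ + ‖inner g f‖ + (‖inner f g‖ + ‖inner g g‖) :=
            (norm_add_le _ _).trans (add_le_add (norm_add_le _ _) (norm_add_le _ _))
        _ ≤ ‖f‖ ^ 2 + ‖g‖ * ‖f‖ + (‖f‖ * ‖g‖ + ‖g‖ ^ 2) := by
            rw [norm_sq, norm_sq]
            gcongr <;> exact norm_inner_le _ _
        _ = _ := by ring
    exact (pow_le_pow_iff_left₀ (Real.sqrt_nonneg _)
      (add_nonneg (Real.sqrt_nonneg _) (Real.sqrt_nonneg _)) two_ne_zero).1 h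

noncomputable instance : SeminormedAddCommGroup S.Cc :=
  SeminormedAddCommGroup.ofCore (𝕜 := 𝕜) seminormedCore

noncomputable instance : NormedSpace 𝕜 S.Cc where
  norm_smul_le k f := (seminormedCore.norm_smul k f).le

noncomputable instance : NormedSpace ℝ S.Cc where
  norm_smul_le k f := by
    rw [← algebraMap_smul 𝕜 k f, seminormedCore.norm_smul]
    simp

/-- Right multiplication of functions by an element of `B`. -/
noncomputable def mulRight (b : B) : S.Cc →L[𝕜] S.Cc :=
  LinearMap.mkContinuous
    { toFun := fun f =>
        { toFun := fun x => f x * b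
          continuous_toFun := f.continuous.mul continuous_const
          hasCompactSupport' := f.hasCompactSupport.mono fun x hx h => hx (by simp [h]) }
      map_add' := fun f g => by ext x; exact add_mul _ _ _
      map_smul' := fun k f => by ext x; exact smul_mul_assoc _ _ _ } ‖b‖ <| fun f => by
    refine (Real.sqrt_le_left (by positivity)).2 ?_
    have : (∫ x, star (f x * b) * (f x * b)) = star b * inner f f * b := by
      have h1 := (integrable_inner f f)
      have e := (((ContinuousLinearMap.mul 𝕜 B).flip b).comp
        (ContinuousLinearMap.mul 𝕜 B (star b))).integral_comp_comm h1
      refine Eq.trans (integral_congr_ae (Filter.Eventually.of_forall fun x => ?_)) e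
      simp [mul_assoc]
    change ‖∫ x, star (f x * b) * (f x * b)‖ ≤ _
    rw [this, mul_pow, norm_sq]
    calc ‖star b * inner f f * b‖ ≤ ‖star b‖ * ‖inner f f‖ * ‖b‖ :=
          (norm_mul_le _ _).trans (by gcongr; exact norm_mul_le _ _)
      _ = _ := by rw [norm_star]; ring

/-- Multiplication by the `j`-th coordinate function, `f ↦ (x ↦ x_j f(x))`. -/
noncomputable def coord (j : Fin d) : S.Cc →ₗ[𝕜] S.Cc where
  toFun f :=
    { toFun := fun x => x j • f x
      continuous_toFun := (continuous_apply j).smul f.continuous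
      hasCompactSupport' := f.hasCompactSupport.mono fun x hx h => hx (by simp [h]) }
  map_add' f g := by ext x; exact smul_add _ _ _
  map_smul' k f := by
    ext x
    change x j • k • f x = k • x j • f x
    rw [← algebraMap_smul 𝕜 (x j), ← algebraMap_smul 𝕜 (x j) (f x), smul_comm]

end Cc

/-- The Hilbert `B`-module `L²(ℝᵈ, B)`: the completion of `C_c(ℝᵈ, B)`. -/
abbrev L2 : Type u := UniformSpace.Completion S.Cc

namespace L2

variable {S}

/-- The `B`-valued inner product on `L²(ℝᵈ, B)`, extended from `C_c(ℝᵈ, B)` by continuity. -/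
noncomputable def inner : S.L2 → S.L2 → B :=
  Function.curry <| (UniformSpace.Completion.isDenseInducing_coe.prodMap
    UniformSpace.Completion.isDenseInducing_coe).extend (Function.uncurry (Cc.inner (S := S)))

/-- The right action of `B` on `L²(ℝᵈ, B)`, extended from `C_c(ℝᵈ, B)` by continuity. -/
noncomputable def mulRight (b : B) : S.L2 →L[𝕜] S.L2 := (Cc.mulRight b).completion

/-- The graph of the position operator `X_j`: the closure of the graph of multiplication by `x_j` on
`C_c(ℝᵈ, B)`. -/
noncomputable def positionGraph (S : TwistedSystem 𝕜 B d) (j : Fin d) :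
    Submodule 𝕜 (S.L2 × S.L2) :=
  (LinearMap.range ((UniformSpace.Completion.toComplL (𝕜 := 𝕜) (E := S.Cc)).toLinearMap.prod
    ((UniformSpace.Completion.toComplL (𝕜 := 𝕜) (E := S.Cc)).toLinearMap ∘ₗ
      Cc.coord j))).topologicalClosure

/-- The unbounded position operator `X_j` on `L²(ℝᵈ, B)`. -/
noncomputable def position (S : TwistedSystem 𝕜 B d) (j : Fin d) : S.L2 →ₗ.[𝕜] S.L2 :=
  (positionGraph S j).toLinearPMap

end L2
end TwistedSystem

section Clifford

variable (d : ℕ)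

/-- The real Clifford algebra `Cℓ_{0,d}`, with generators `ρ^i = ι e_i`, `(ρ^i)² = -1` and
`(ρ^i)^* = -ρ^i`. -/
abbrev Cl : Type :=
  CliffordAlgebra (QuadraticMap.weightedSumSquares ℝ fun _ : Fin d => (-1 : ℝ))

/-- The exterior algebra `⋀^* ℝᵈ`. -/
abbrev ExtAlg : Type := ExteriorAlgebra ℝ (Fin d → ℝ)

instance : StarModule ℝ (Cl d) := ⟨fun r x => CliffordAlgebra.star_smul r x⟩

variable {d}

/-- Exterior multiplication `ω ↦ v ∧ ω`. -/
noncomputable def wedge : (Fin d → ℝ) →ₗ[ℝ] Module.End ℝ (ExtAlg d) :=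
  LinearMap.mul ℝ (ExtAlg d) ∘ₗ ExteriorAlgebra.ι ℝ

/-- The contraction `ω ↦ ι(v) ω` along `v`. -/
noncomputable def contract : (Fin d → ℝ) →ₗ[ℝ] Module.End ℝ (ExtAlg d) :=
  CliffordAlgebra.contractLeft ∘ₗ dotProductBilin ℝ ℝ

/-- `γ^j(ω) = e_j ∧ ω + ι(e_j) ω`. -/
noncomputable def extGamma (j : Fin d) : Module.End ℝ (ExtAlg d) :=
  wedge (Pi.single j 1) + contract (Pi.single j 1)

/-- The representation of `Cℓ_{0,d}` on `⋀^* ℝᵈ` with `ρ^j(ω) = e_j ∧ ω - ι(e_j) ω`. -/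
noncomputable def cliffordRep : Cl d →ₐ[ℝ] Module.End ℝ (ExtAlg d) :=
  CliffordAlgebra.lift _ ⟨wedge - contract, fun v => by
    refine LinearMap.ext fun (ω : ExtAlg d) => ?_
    have h1 : ExteriorAlgebra.ι ℝ v * (ExteriorAlgebra.ι ℝ v * ω) = 0 := by
      rw [← mul_assoc, ExteriorAlgebra.ι_sq_zero, zero_mul]
    have h2 : CliffordAlgebra.contractLeft (dotProductBilin ℝ ℝ v)
        (ExteriorAlgebra.ι ℝ v * ω) = (v ⬝ᵥ v) • ω -
          ExteriorAlgebra.ι ℝ v * CliffordAlgebra.contractLeft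
            (dotProductBilin ℝ ℝ v) ω :=
      CliffordAlgebra.contractLeft_ι_mul _ v ω
    have h3 : CliffordAlgebra.contractLeft (dotProductBilin ℝ ℝ v)
        (CliffordAlgebra.contractLeft (dotProductBilin ℝ ℝ v) ω) = 0 :=
      CliffordAlgebra.contractLeft_contractLeft _ _
    have h4 : v ⬝ᵥ v = ∑ i, v i * v i := rfl
    change (ExteriorAlgebra.ι ℝ v * (ExteriorAlgebra.ι ℝ v * ω -
        CliffordAlgebra.contractLeft (dotProductBilin ℝ ℝ v) ω) -
      CliffordAlgebra.contractLeft (dotProductBilin ℝ ℝ v)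
        (ExteriorAlgebra.ι ℝ v * ω -
          CliffordAlgebra.contractLeft (dotProductBilin ℝ ℝ v) ω)) =
      (QuadraticMap.weightedSumSquares ℝ fun _ : Fin d => (-1 : ℝ)) v • ω
    rw [mul_sub, h1, map_sub, h2, h3, h4, QuadraticMap.weightedSumSquares_apply]
    simp only [smul_eq_mul, neg_mul, one_mul, Finset.sum_neg_distrib, neg_smul]
    abel⟩

end Clifford

/-- A `C⋆`-algebra over `𝕜` (that is, a real or complex `C⋆`-algebra). -/
structure CStarAlg (𝕜 : Type v) [RCLike 𝕜] where
  carrier : Type u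
  [ring : NonUnitalNormedRing carrier]
  [starRing : StarRing carrier]
  [cstarRing : CStarRing carrier]
  [complete : CompleteSpace carrier]
  [space : NormedSpace 𝕜 carrier]
  [tower : IsScalarTower 𝕜 carrier carrier]
  [comm : SMulCommClass 𝕜 carrier carrier]
  [starModule : StarModule 𝕜 carrier]
  [real : RealCStar carrier]

namespace CStarAlg

attribute [instance] ring starRing cstarRing complete space tower comm starModule real

instance (𝕜 : Type v) [RCLike 𝕜] : CoeSort (CStarAlg.{u, v} 𝕜) (Type u) := ⟨carrier⟩

end CStarAlg

/-- The data of a right action of `B` on `E` and a `B`-valued inner product on `E`. -/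
structure HilbertModuleData (B E : Type u) where
  act : E → B → E
  inner : E → E → B

namespace HilbertModuleData

variable {𝕜 : Type v} {B E : Type u} [RCLike 𝕜] [NonUnitalNormedRing B] [StarRing B]
  [NormedSpace 𝕜 B] [AddCommGroup E] [Module 𝕜 E] (M : HilbertModuleData B E)

/-- The norm `‖(x | x)_B‖^{1/2}`. -/
noncomputable def norm (x : E) : ℝ := √‖M.inner x x‖

variable (𝕜) in
/-- `E` is a (right) Hilbert `C⋆`-module over `B`. -/
structure IsHilbertModule : Prop where
  add_act : ∀ x y b, M.act (x + y) b = M.act x b + M.act y b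
  act_add : ∀ x b c, M.act x (b + c) = M.act x b + M.act x c
  act_mul : ∀ x b c, M.act x (b * c) = M.act (M.act x b) c
  smul_act : ∀ (k : 𝕜) x b, M.act (k • x) b = k • M.act x b
  act_smul : ∀ (k : 𝕜) x b, M.act x (k • b) = k • M.act x b
  inner_add : ∀ x y z, M.inner x (y + z) = M.inner x y + M.inner x z
  inner_smul : ∀ (k : 𝕜) x y, M.inner x (k • y) = k • M.inner x y
  inner_act : ∀ x y b, M.inner x (M.act y b) = M.inner x y * b
  star_inner : ∀ x y, star (M.inner x y) = M.inner y x
  inner_self_nonneg : ∀ x, ∃ b, M.inner x x = star b * b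
  inner_self_eq_zero : ∀ x, M.inner x x = 0 → x = 0
  complete : ∀ u : ℕ → E,
    (∀ ε > 0, ∃ N, ∀ m ≥ N, ∀ n ≥ N, M.norm (u m - u n) < ε) →
      ∃ x, ∀ ε > 0, ∃ N, ∀ n ≥ N, M.norm (u n - x) < ε

/-- `T'` is an adjoint of `T`. -/
def IsAdjoint (T T' : E → E) : Prop := ∀ x y, M.inner (T x) y = M.inner x (T' y)

/-- `T ∈ End_B(E)`. -/
def IsAdjointable (T : E → E) : Prop := ∃ T', M.IsAdjoint T T'

/-- `T ∈ End_B⁰(E)`: `T` is a norm limit of finite sums of the operators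
`Θ_{e,f}(x) = e · (f | x)_B`. -/
def IsCompactOp (T : E → E) : Prop :=
  M.IsAdjointable T ∧ ∀ ε > 0, ∃ (n : ℕ) (e f : Fin n → E), ∀ x,
    M.norm (T x - ∑ i, M.act (e i) (M.inner (f i) x)) ≤ ε * M.norm x

/-- The unbounded operator `D` is densely defined, self-adjoint (`D^* = D`) and regular (`1 + D^*D`
has dense range). -/
structure IsSelfAdjointRegular (D : E →ₗ.[𝕜] E) : Prop where
  dense : ∀ x, ∀ ε > 0, ∃ y ∈ D.domain, M.norm (x - y) < ε
  selfAdjoint : ∀ y z, (y, z) ∈ D.graph ↔ ∀ x : D.domain, M.inner (D x) y = M.inner x z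
  regular : ∀ z, ∀ ε > 0, ∃ x y w, (x, y) ∈ D.graph ∧ (y, w) ∈ D.graph ∧ M.norm (x + w - z) < ε

/-- `R = (1 + D²)^{-1/2}`: `R` is a positive element of `End_B(E)` with `R² = (1 + D²)^{-1}`. -/
structure IsInvSqrt (D : E →ₗ.[𝕜] E) (R : E → E) : Prop where
  pos : ∃ T T' : E → E, M.IsAdjoint T T' ∧ ∀ x, R x = T' (T x)
  right_inv : ∀ x, ∃ y w, (R (R x), y) ∈ D.graph ∧ (y, w) ∈ D.graph ∧ R (R x) + w = x
  left_inv : ∀ x y w, (x, y) ∈ D.graph → (y, w) ∈ D.graph → R (R (x + w)) = x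

end HilbertModuleData

/-- `(𝓐, _π E_B, D)` is an unbounded Kasparov module, where `𝓐` is a dense ⋆-subalgebra of the
graded separable `C⋆`-algebra `A`, with grading automorphism `gA`, the Hilbert module `E` over the
trivially graded `C⋆`-algebra `B` has the grading operator `gE`, and `π` is a graded representation of
`A` on `E`. It is real for `𝕜 = ℝ` and complex for `𝕜 = ℂ`.
The graded commutator is `[D, π(a)]_± = D π(a) - π(gA a) D`. -/
structure IsUnboundedKasparovModule {𝕜 : Type v} {B E : Type u} [RCLike 𝕜] [NonUnitalNormedRing B]
    [StarRing B] [NormedSpace 𝕜 B] [AddCommGroup E] [Module 𝕜 E]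
    (A : CStarAlg.{u, v} 𝕜) (gA : A →⋆ₙₐ[𝕜] A) (𝓐 : NonUnitalStarSubalgebra 𝕜 A)
    (M : HilbertModuleData B E) (gE : E → E) (π : A → E → E) (D : E →ₗ.[𝕜] E) : Prop where
  hilbert : M.IsHilbertModule 𝕜
  separable : TopologicalSpace.SeparableSpace A
  gA_gA : ∀ a, gA (gA a) = a
  dense : Dense (𝓐 : Set A)
  gA_mem : ∀ a ∈ 𝓐, gA a ∈ 𝓐
  gE_gE : ∀ x, gE (gE x) = x
  gE_act : ∀ x b, gE (M.act x b) = M.act (gE x) b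
  inner_gE : ∀ x y, M.inner (gE x) (gE y) = M.inner x y
  π_add : ∀ a b x, π (a + b) x = π a x + π b x
  π_smul : ∀ (k : 𝕜) a x, π (k • a) x = k • π a x
  π_mul : ∀ a b x, π (a * b) x = π a (π b x)
  π_star : ∀ a, M.IsAdjoint (π a) (π (star a))
  π_graded : ∀ a x, gE (π a x) = π (gA a) (gE x)
  D_selfAdjointRegular : M.IsSelfAdjointRegular D
  D_odd : ∀ x y, (x, y) ∈ D.graph → (gE x, -gE y) ∈ D.graph
  commutator : ∀ a ∈ 𝓐, ∃ T, M.IsAdjointable T ∧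
    ∀ x y, (x, y) ∈ D.graph → ∃ z, (π a x, z) ∈ D.graph ∧ z - π (gA a) y = T x
  compact : ∃ R, M.IsInvSqrt D R ∧ ∀ a ∈ 𝓐, M.IsCompactOp fun x => π a (R x)

namespace TwistedSystem

variable {𝕜 : Type v} {B : Type u} [RCLike 𝕜] [NonUnitalNormedRing B]
  [StarRing B] [CStarRing B] [CompleteSpace B] [NormedSpace ℝ B] [NormedSpace 𝕜 B]
  [IsScalarTower ℝ 𝕜 B] [IsScalarTower 𝕜 B B] [SMulCommClass 𝕜 B B] [StarModule 𝕜 B]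
  [RealCStar B] {d : ℕ} (S : TwistedSystem 𝕜 B d)

instance : SMulCommClass ℝ 𝕜 S.Cc := ⟨fun r k f => by
  rw [← algebraMap_smul 𝕜 r f, ← algebraMap_smul 𝕜 r (k • f), smul_comm]⟩

/-- The ⋆-algebra `C_c(ℝᵈ, B) ⊗ Cℓ_{0,d}`. The first factor is trivially graded, so the graded tensor
product is the ordinary tensor product of ⋆-algebras. -/
abbrev CcCl : Type u := S.Cc ⊗[ℝ] Cl d

/-- The grading automorphism of `C_c(ℝᵈ, B) ⊗ Cℓ_{0,d}`. -/
noncomputable def ccClGrading : S.CcCl →ₗ[ℝ] S.CcCl :=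
  LinearMap.lTensor S.Cc (CliffordAlgebra.involute (Q := QuadraticMap.weightedSumSquares ℝ
    fun _ : Fin d => (-1 : ℝ))).toLinearMap

/-- The underlying space `L²(ℝᵈ, B) ⊗ ⋀^* ℝᵈ`. -/
abbrev KMod : Type u := S.L2 ⊗[ℝ] ExtAlg d

/-- The coordinates of an element of `L²(ℝᵈ, B) ⊗ ⋀^* ℝᵈ` with respect to the orthonormal basis
`e_{i₁} ∧ ⋯ ∧ e_{iₖ}`, `i₁ < ⋯ < iₖ`, of `⋀^* ℝᵈ`. -/
noncomputable def extCoord : S.KMod ≃ₗ[ℝ] (Finset (Fin d) →₀ S.L2) :=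
  TensorProduct.equivFinsuppOfBasisRight (Pi.basisFun ℝ (Fin d)).ExteriorAlgebra

/-- The Hilbert `B`-module structure of `L²(ℝᵈ, B) ⊗ ⋀^* ℝᵈ`, with
`(ψ ⊗ ω) · b = (ψ · b) ⊗ ω` and `(ψ ⊗ ω | φ ⊗ η)_B = (ψ | φ)_B ⟨ω, η⟩`. -/
noncomputable def kModData : HilbertModuleData B S.KMod where
  act x b := LinearMap.rTensor (ExtAlg d) ((L2.mulRight (S := S) b).toLinearMap.restrictScalars ℝ) x
  inner x y := ∑ I : Finset (Fin d), L2.inner (S.extCoord x I) (S.extCoord y I)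

/-- The grading operator of `L²(ℝᵈ, B) ⊗ ⋀^* ℝᵈ`, given by the degree of forms. -/
noncomputable def kModGrading : S.KMod →ₗ[ℝ] S.KMod :=
  LinearMap.lTensor S.L2 (CliffordAlgebra.involute (Q := (0 : QuadraticForm ℝ (Fin d → ℝ)))).toLinearMap

/-- The operator `X = ∑ X_j ⊗ γ^j`, with domain `(⋂ Dom X_j) ⊗ ⋀^* ℝᵈ`. -/
noncomputable def diracX : S.KMod →ₗ.[𝕜] S.KMod :=
  (Submodule.span 𝕜 {p : S.KMod × S.KMod | ∃ (ψ : S.L2)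
    (hψ : ∀ j, ψ ∈ (L2.position S j).domain) (ω : ExtAlg d),
      p = (ψ ⊗ₜ ω, ∑ j, L2.position S j ⟨ψ, hψ j⟩ ⊗ₜ extGamma j ω)}).toLinearPMap

variable [S.IsNormalized]

/-- The norm of the full `C⋆`-completion `(B ⋊_θ ℝᵈ) ⊗ Cℓ_{0,d}` of `C_c(ℝᵈ, B) ⊗ Cℓ_{0,d}`: the
supremum of `‖φ(a)‖` over all ⋆-homomorphisms `φ` to `C⋆`-algebras which are bounded for the
`L¹`-norm on `C_c(ℝᵈ, B)`. -/
noncomputable def fullNorm (a : S.CcCl) : ℝ :=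
  sSup {r | ∃ (C : Type u) (_ : NonUnitalCStarAlgebra C) (φ : S.CcCl →⋆ₙₐ[ℝ] C),
    (∀ f : S.Cc, ‖φ (f ⊗ₜ 1)‖ ≤ ∫ x, ‖f x‖) ∧ r = ‖φ a‖}

end TwistedSystem

end KK

open KK

-- The operator `X` is Clifford multiplication by the coordinate vector `x`. Since the `γ^j`
-- anticommute and square to `1`, `X² = |x|²`. So `R = (1 + X²)^{-1/2}` is multiplication by `(1 +
-- |x|²)^{-1/2}`, and `F = X R` is `∑ x_j (1 + |x|²)^{-1/2} ⊗ γ^j`. Both are bounded, self-adjoint,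
-- commuting, with `F² + R² = 1`. Everything unbounded is reduced to them: cutting off with
-- compactly supported functions shows that the graph of `X` is exactly `{(ξ, η) | F ξ = R η}`
-- (`mem_graph_diracX`). Self-adjointness, regularity and the formula for `(1 + X²)^{-1/2}` then
-- follow by algebra (`IsHilbertModule.isSelfAdjointRegular`, `isInvSqrt`).
--
-- Commutators: writing `x = y + (x - y)` under the convolution integral gives the Leibniz rule `x_i
-- (f ∗ ψ) = (x_i f) ∗ ψ + f ∗ (x_i ψ)` (`coord_convMap`), and the `γ^i` graded-commute with the
-- `ρ^j` (`extGamma_mul_cliffordRep`). Hence `[X, π(f ⊗ c)]_±` is `∑ (x_i f) ⊗ γ^i c`, which is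
-- bounded and adjointable (`exists_commutator`).
--
-- Compactness: convolution by `f` followed on the right by a compactly supported multiplication
-- operator is an integral operator with a continuous compactly supported `B`-valued kernel. A
-- partition of unity and approximate units of `B` approximate this kernel by finite sums of
-- products, that is, by rank-one operators, and a Hilbert–Schmidt estimate turns uniform closeness
-- of kernels into closeness of operators. Since `(1 + |x|²)^{-1/2}` vanishes at infinity, it is a
-- uniform limit of compactly supported functions (`leftOp_comp_mulOp_resFun_mem_compacts`).
--
-- The full norm is finite because `Cℓ_{0,d}` is spanned by elements `u` with `u^* u = 1`, for which
-- the `C⋆`-identity gives `‖φ(f ⊗ u)‖ = ‖φ(f ⊗ 1)‖`. It is a norm, and `π` is bounded for it,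
-- because the regular representation is faithful and satisfies the `L¹`-bound. The representations
-- in the definition take values in complex `C⋆`-algebras while `B` may be real, so the regular
-- representation is also formed on `L²(ℝᵈ, C) ⊗ ⋀^* ℝᵈ` for a complex `C⋆`-algebra `C` containing
-- `B`, and then restricted to the isometric copy of `L²(ℝᵈ, B) ⊗ ⋀^* ℝᵈ` (`norm_kRepSelf_le`). The
-- completion is the closure of `𝓐` in the product of all admissible representations.

universe w

namespace KK

/-! ### Functional calculus in real `C⋆`-algebras. -/

namespace RealCStar

section Env

variable (B : Type u) [NonUnitalNormedRing B] [StarRing B] [RealCStar B]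

/-- A complex `C⋆`-algebra in which `B` embeds isometrically. -/
def Env : Type u := Classical.choose (RealCStar.exists_isometry (B := B))

noncomputable instance : NonUnitalCStarAlgebra (Env B) :=
  Classical.choose (Classical.choose_spec (RealCStar.exists_isometry (B := B)))

noncomputable instance : PartialOrder (Env B) := CStarAlgebra.spectralOrder _

instance : StarOrderedRing (Env B) := CStarAlgebra.spectralOrderedRing _

/-- The embedding of `B` in a complex `C⋆`-algebra. -/
noncomputable def emb : B →⋆ₙ+* Env B :=
  Classical.choose (Classical.choose_spec
    (Classical.choose_spec (RealCStar.exists_isometry (B := B))))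

lemma isometry_emb : Isometry (emb B) :=
  Classical.choose_spec (Classical.choose_spec
    (Classical.choose_spec (RealCStar.exists_isometry (B := B))))

variable {B}

lemma norm_emb (b : B) : ‖emb B b‖ = ‖b‖ := by simpa using (isometry_emb B).dist_eq b 0

lemma emb_injective : Function.Injective (emb B) := (isometry_emb B).injective

lemma continuous_emb : Continuous (emb B) := (isometry_emb B).continuous

variable [NormedSpace ℝ B]

lemma emb_smul (r : ℝ) (b : B) : emb B (r • b) = r • emb B b :=
  map_real_smul _ continuous_emb r b

variable (B) in
/-- The embedding of `B` in a complex `C⋆`-algebra, as a real linear ⋆-homomorphism. -/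
noncomputable def embₐ : B →⋆ₙₐ[ℝ] Env B :=
  { emb B with map_smul' := emb_smul }

variable (B) in
/-- The embedding of `B` in a complex `C⋆`-algebra, as a continuous real linear map. -/
noncomputable def embL : B →L[ℝ] Env B :=
  { toFun := emb B, map_add' := map_add _, map_smul' := emb_smul, cont := continuous_emb }

@[simp] lemma embL_apply (b : B) : embL B b = emb B b := rfl

end Env

section Sqrt

variable {B : Type u} [NonUnitalNormedRing B] [StarRing B] [CStarRing B] [CompleteSpace B]
  [NormedSpace ℝ B] [RealCStar B]

/-- The image of `B` is complete, hence a closed real ⋆-subalgebra, and such subalgebras are stable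
under real functional calculus. This lets square roots and approximate units be computed in the
complex algebra and pulled back to `B`. -/
lemma exists_emb_eq_cfcₙ (f : ℝ → ℝ) (b : B) : ∃ c : B, emb B c = cfcₙ f (emb B b) := by
  have hcl : IsClosed ((NonUnitalStarAlgHom.range (embₐ B) : NonUnitalStarSubalgebra ℝ (Env B)) :
      Set (Env B)) := by
    have := (isometry_emb B).isClosedEmbedding.isClosed_range
    convert this using 1
    ext x
    simp [embₐ]
  obtain ⟨c, hc⟩ := cfcₙ_mem (𝕜' := ℝ) (s := NonUnitalStarAlgHom.range (embₐ B)) (hs := hcl) f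
    (a := emb B b) ⟨b, rfl⟩
  exact ⟨c, hc⟩

/-- Positive elements of a real `C⋆`-algebra have square roots. -/
lemma exists_eq_star_mul_self {p : B} (hp : 0 ≤ emb B p) : ∃ b : B, p = star b * b := by
  obtain ⟨c, hc⟩ := exists_emb_eq_cfcₙ Real.sqrt p
  refine ⟨c, emb_injective ?_⟩
  have hs : IsSelfAdjoint (cfcₙ Real.sqrt (emb B p)) := IsSelfAdjoint.cfcₙ
  rw [map_mul, map_star, hc, hs.star_eq,
    ← cfcₙ_mul _ _ _ (Real.continuous_sqrt.continuousOn) (by simp)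
      (Real.continuous_sqrt.continuousOn) (by simp)]
  conv_lhs => rw [← cfcₙ_id ℝ (emb B p) (.of_nonneg hp)]
  refine cfcₙ_congr fun t ht => ?_
  exact (Real.mul_self_sqrt (quasispectrum_nonneg_of_nonneg _ hp t ht)).symm

/-- `B` has approximate right units. -/
lemma exists_norm_sub_mul_le (b : B) {ε : ℝ} (hε : 0 < ε) : ∃ e : B, ‖b - b * e‖ ≤ ε := by
  set p := star b * b with hp
  have hp0 : 0 ≤ emb B p := by rw [hp, map_mul, map_star]; exact star_mul_self_nonneg _
  -- With `e = p / (p + δ)`, the norm of `(1 - e) p (1 - e)` is at most the supremum of `t δ² / (t +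
  -- δ)²`, which is at most `δ`; by the `C⋆`-identity it is `‖b - b e‖²`, hence the choice `δ = ε²`.
  set δ := ε ^ 2 with hδ
  have hδ0 : 0 < δ := by positivity
  have hspec : ∀ t ∈ quasispectrum ℝ (emb B p), 0 ≤ t :=
    fun t ht => quasispectrum_nonneg_of_nonneg _ hp0 t ht
  obtain ⟨e, he⟩ := exists_emb_eq_cfcₙ (fun t => t / (t + δ)) p
  have hcont : ContinuousOn (fun t : ℝ => t / (t + δ)) (quasispectrum ℝ (emb B p)) :=
    continuousOn_id.div (by fun_prop) fun t ht => by have := hspec t ht; simp; positivity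
  have hes : star (emb B e) = emb B e := by rw [he]; exact IsSelfAdjoint.cfcₙ
  have hid : ContinuousOn (fun t : ℝ => t) (quasispectrum ℝ (emb B p)) := continuousOn_id
  refine ⟨e, ?_⟩
  have hpe : emb B p = cfcₙ (fun t : ℝ => t) (emb B p) := (cfcₙ_id' ℝ _ (.of_nonneg hp0)).symm
  have key : star (emb B (b - b * e)) * emb B (b - b * e) =
      cfcₙ (fun t : ℝ => t - t * (t / (t + δ)) - ((t / (t + δ)) * t - (t / (t + δ)) * t *
        (t / (t + δ)))) (emb B p) := by
    rw [cfcₙ_sub _ _ _ (by fun_prop) (by simp) (by fun_prop) (by simp),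
      cfcₙ_sub _ _ _ (by fun_prop) (by simp) (by fun_prop) (by simp),
      cfcₙ_sub _ _ _ (by fun_prop) (by simp) (by fun_prop) (by simp),
      cfcₙ_mul _ _ _ (by fun_prop) (by simp) (by fun_prop) (by simp),
      cfcₙ_mul _ _ _ (by fun_prop) (by simp) (by fun_prop) (by simp),
      cfcₙ_mul _ _ _ (by fun_prop) (by simp) (by fun_prop) (by simp),
      cfcₙ_mul _ _ _ (by fun_prop) (by simp) (by fun_prop) (by simp), ← he, ← hpe]
    simp only [map_sub, map_mul, star_sub, star_mul, hes, hp, map_star, mul_sub, sub_mul, mul_assoc]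
    abel
  have h1 : ‖star (emb B (b - b * e)) * emb B (b - b * e)‖ ≤ δ := by
    rw [key]
    refine norm_cfcₙ_le fun t ht => ?_
    have ht0 := hspec t ht
    have e1 : t - t * (t / (t + δ)) - ((t / (t + δ)) * t - (t / (t + δ)) * t * (t / (t + δ))) =
        t * δ ^ 2 / (t + δ) ^ 2 := by field_simp; ring
    rw [e1, Real.norm_of_nonneg (by positivity), div_le_iff₀ (by positivity)]
    nlinarith [mul_nonneg ht0 hδ0.le, mul_nonneg (mul_nonneg ht0 hδ0.le) ht0, pow_pos hδ0 3,
      mul_nonneg (mul_nonneg ht0 hδ0.le) hδ0.le]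
  rw [CStarRing.norm_star_mul_self, norm_emb, hδ, ← pow_two] at h1
  exact (pow_le_pow_iff_left₀ (norm_nonneg _) hε.le two_ne_zero).1 h1

end Sqrt

end RealCStar

/-! ### The Cauchy–Schwarz inequality in abstract Hilbert modules. -/

namespace HilbertModuleData

variable {𝕜 : Type v} {B E : Type u} [RCLike 𝕜] [NonUnitalNormedRing B] [StarRing B] [CStarRing B]
  [CompleteSpace B] [NormedSpace ℝ B] [NormedSpace 𝕜 B] [RealCStar B]
  [AddCommGroup E] [Module 𝕜 E] {M : HilbertModuleData B E}

open RealCStar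

lemma norm_nonneg (x : E) : 0 ≤ M.norm x := Real.sqrt_nonneg _

lemma norm_sq (x : E) : M.norm x ^ 2 = ‖M.inner x x‖ := Real.sq_sqrt (_root_.norm_nonneg _)

namespace IsHilbertModule

variable (hM : M.IsHilbertModule 𝕜)
include hM

lemma emb_inner_self_nonneg (x : E) : 0 ≤ emb B (M.inner x x) := by
  obtain ⟨b, hb⟩ := hM.inner_self_nonneg x
  rw [hb, map_mul, map_star]
  exact star_mul_self_nonneg _

lemma inner_zero (x : E) : M.inner x 0 = 0 := by
  simpa using hM.inner_smul 0 x 0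

lemma add_inner (x y z : E) : M.inner (x + y) z = M.inner x z + M.inner y z := by
  rw [← hM.star_inner, hM.inner_add, star_add, hM.star_inner, hM.star_inner]

lemma inner_neg (x y : E) : M.inner x (-y) = -M.inner x y := by
  simpa using hM.inner_smul (-1) x y

lemma neg_inner (x y : E) : M.inner (-x) y = -M.inner x y := by
  rw [← hM.star_inner, hM.inner_neg, star_neg, hM.star_inner]

lemma inner_sub (x y z : E) : M.inner x (y - z) = M.inner x y - M.inner x z := by
  rw [sub_eq_add_neg, hM.inner_add, hM.inner_neg, sub_eq_add_neg]

lemma sub_inner (x y z : E) : M.inner (x - y) z = M.inner x z - M.inner y z := by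
  rw [sub_eq_add_neg, hM.add_inner, hM.neg_inner, sub_eq_add_neg]

lemma act_inner (x y : E) (b : B) : M.inner (M.act x b) y = star b * M.inner x y := by
  rw [← hM.star_inner, hM.inner_act, star_mul, hM.star_inner]

/-- Positivity of the inner square of `x · (x | y) - t y`, combined with `Q^* P Q ≤ ‖P‖ Q^* Q`,
yields `t Q^* Q ≤ t² R` for every `t > ‖P‖`; take norms and let `t` decrease to `‖P‖`. The order is
that of the complex envelope. -/
lemma norm_inner_le_sq (x y : E) : ‖M.inner x y‖ ^ 2 ≤ ‖M.inner x x‖ * ‖M.inner y y‖ := by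
  set P := emb B (M.inner x x) with hP
  set Q := emb B (M.inner x y) with hQ
  set R := emb B (M.inner y y) with hR
  have hPs : IsSelfAdjoint P := by rw [IsSelfAdjoint, hP, ← map_star, hM.star_inner]
  have key : ∀ t : ℝ, 0 ≤ star Q * P * Q - t • (star Q * Q) - t • (star Q * Q) + t ^ 2 • R := by
    intro t
    have h := hM.emb_inner_self_nonneg (M.act x (M.inner x y) - (t : 𝕜) • y)
    have hs : ∀ z : E, M.inner z ((t : 𝕜) • y) = (t : 𝕜) • M.inner z y := fun z => hM.inner_smul _ _ _
    -- No compatibility of the real and the `𝕜`-scalars of `B` is assumed here; a continuous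
    -- additive map on `ℝ` is real linear in any case.
    have hr : ∀ b : B, emb B ((t : 𝕜) • b) = t • emb B b := fun b => by
      have hc : Continuous fun r : ℝ => r • b := by fun_prop
      let L : ℝ →+ Env B := 
        { toFun := fun r => emb B ((r : 𝕜) • b), map_zero' := by simp, map_add' := by simp [add_smul] }
      have hL : Continuous L := continuous_emb.comp (by fun_prop)
      have := map_real_smul L hL t 1
      simpa [L] using this
    have hs' : ∀ z : E, M.inner ((t : 𝕜) • y) z = star ((t : 𝕜) • M.inner z y) := fun z => by
      rw [← hM.star_inner, hs]
    rw [hM.inner_sub, hM.sub_inner, hM.sub_inner, hM.act_inner, hM.inner_act, hM.inner_act,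
      hs, hs, hs', hs', hM.act_inner] at h
    simp only [map_sub, map_mul, map_star, hr, star_smul, star_trivial, smul_mul_assoc,
      ← hP, ← hQ, ← hR] at h
    convert h using 1
    have hRs : star R = R := by rw [hR, ← map_star, hM.star_inner]
    rw [hRs, smul_smul, pow_two, mul_assoc]
    abel
  have main : ∀ ε : ℝ, 0 < ε → ‖Q‖ ^ 2 ≤ (‖P‖ + ε) * ‖R‖ := by
    intro ε hε
    -- The shift by `ε` keeps `t` positive, hence cancellable, also when `P = 0`.
    set t := ‖P‖ + ε with ht
    have htpos : 0 < t := by positivity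
    have h1 : star Q * P * Q ≤ t • (star Q * Q) :=
      (CStarAlgebra.star_left_conjugate_le_norm_smul hPs).trans
        (smul_le_smul_of_nonneg_right (by simp [ht, hε.le]) (star_mul_self_nonneg _))
    have h2 : t • (star Q * Q) ≤ t ^ 2 • R := by
      have h3 := key t
      have h4 : star Q * P * Q - t • (star Q * Q) - t • (star Q * Q) + t ^ 2 • R ≤
          t • (star Q * Q) - t • (star Q * Q) - t • (star Q * Q) + t ^ 2 • R := by gcongr
      have h5 := h3.trans h4
      rw [sub_self, zero_sub] at h5
      simpa using add_le_add_left h5 (t • (star Q * Q))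
    have h6 := CStarAlgebra.norm_le_norm_of_nonneg_of_le
      (smul_nonneg htpos.le (star_mul_self_nonneg Q)) h2
    rw [norm_smul, norm_smul, CStarRing.norm_star_mul_self, Real.norm_eq_abs, Real.norm_eq_abs,
      abs_of_pos htpos, abs_of_pos (by positivity), pow_two t, mul_assoc] at h6
    rw [pow_two]
    exact le_of_mul_le_mul_left h6 htpos
  rw [← norm_emb (M.inner x y), ← norm_emb (M.inner x x), ← norm_emb (M.inner y y)]
  refine le_of_forall_pos_le_add fun ε hε => ?_
  have h := main (ε / (‖R‖ + 1)) (by positivity)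
  refine h.trans ?_
  rw [add_mul]
  gcongr
  rw [div_mul_eq_mul_div, div_le_iff₀ (by positivity)]
  nlinarith [_root_.norm_nonneg R]

/-- The Cauchy–Schwarz inequality in Hilbert modules. -/
lemma norm_inner_le (x y : E) : ‖M.inner x y‖ ≤ M.norm x * M.norm y := by
  rw [norm, norm, ← Real.sqrt_mul (_root_.norm_nonneg _)]
  exact Real.le_sqrt_of_sq_le (hM.norm_inner_le_sq x y)

lemma norm_add_le (x y : E) : M.norm (x + y) ≤ M.norm x + M.norm y := by
  have h : M.norm (x + y) ^ 2 ≤ (M.norm x + M.norm y) ^ 2 := by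
    rw [norm_sq, hM.inner_add, hM.add_inner, hM.add_inner]
    calc _ ≤ ‖M.inner x x‖ + ‖M.inner y x‖ + (‖M.inner x y‖ + ‖M.inner y y‖) :=
          (_root_.norm_add_le _ _).trans (add_le_add (_root_.norm_add_le _ _) (_root_.norm_add_le _ _))
      _ ≤ M.norm x ^ 2 + M.norm y * M.norm x + (M.norm x * M.norm y + M.norm y ^ 2) := by
          rw [norm_sq, norm_sq]
          gcongr <;> exact hM.norm_inner_le _ _
      _ = _ := by ring
  exact (pow_le_pow_iff_left₀ (norm_nonneg _) (add_nonneg (norm_nonneg _) (norm_nonneg _))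
    two_ne_zero).1 h

lemma norm_eq_zero {x : E} (h : M.norm x = 0) : x = 0 :=
  hM.inner_self_eq_zero x (by
    rw [← _root_.norm_eq_zero, ← norm_sq, h]; simp)

end IsHilbertModule
end HilbertModuleData

/-! ### The inner product of `C_c(ℝᵈ, B)` and its extension to `L²(ℝᵈ, B)`. -/

namespace TwistedSystem

variable {𝕜 : Type v} {B : Type u} [RCLike 𝕜] [NonUnitalNormedRing B]
  [StarRing B] [CStarRing B] [CompleteSpace B] [NormedSpace ℝ B] [NormedSpace 𝕜 B]
  [IsScalarTower ℝ 𝕜 B] [IsScalarTower 𝕜 B B] [SMulCommClass 𝕜 B B] [StarModule 𝕜 B]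
  [RealCStar B] {d : ℕ} {S : TwistedSystem 𝕜 B d}

open RealCStar

namespace Cc

lemma inner_smul_right (k : 𝕜) (f g : S.Cc) : inner f (k • g) = k • inner f g := by
  rw [inner, inner, ← integral_smul]
  simp [mul_smul_comm]

lemma star_inner (f g : S.Cc) : star (inner f g) = inner g f := by
  have := starModule_real 𝕜 B
  have h := ((starL' ℝ : B ≃L[ℝ] B) : B →L[ℝ] B).integral_comp_comm (integrable_inner f g)
  refine h.symm.trans (integral_congr_ae (Filter.Eventually.of_forall fun x => ?_))
  simp

lemma inner_real_smul_right (r : ℝ) (f g : S.Cc) : inner f (r • g) = r • inner f g := by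
  rw [← algebraMap_smul 𝕜 r g, inner_smul_right, algebraMap_smul]

lemma inner_real_smul_left (r : ℝ) (f g : S.Cc) : inner (r • f) g = r • inner f g := by
  have := starModule_real 𝕜 B
  rw [← star_inner, inner_real_smul_right, star_smul, star_inner, star_trivial]

lemma mulRight_apply (b : B) (f : S.Cc) (x : Fin d → ℝ) : mulRight b f x = f x * b := rfl

lemma coord_apply (j : Fin d) (f : S.Cc) (x : Fin d → ℝ) : coord j f x = x j • f x := rfl

lemma inner_mulRight (f g : S.Cc) (b : B) : inner f (mulRight b g) = inner f g * b := by
  have e := ((ContinuousLinearMap.mul 𝕜 B).flip b).integral_comp_comm (integrable_inner f g)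
  refine Eq.trans (integral_congr_ae (Filter.Eventually.of_forall fun x => ?_)) e
  simp [mul_assoc, mulRight_apply]

lemma emb_inner (f g : S.Cc) : emb B (inner f g) = ∫ x, star (emb B (f x)) * emb B (g x) := by
  refine ((embL B).integral_comp_comm (integrable_inner f g)).symm.trans ?_
  refine integral_congr_ae (Filter.Eventually.of_forall fun x => ?_)
  simp [map_star]

lemma emb_inner_self_nonneg (f : S.Cc) : 0 ≤ emb B (inner f f) := by
  rw [emb_inner]
  exact integral_nonneg fun x => star_mul_self_nonneg _

/-- If `star f f ≤ w² star g g` pointwise up to translation, then `‖f‖ ≤ w ‖g‖`. -/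
lemma norm_le_of_star_mul_self_le {f g : S.Cc} {w : ℝ} (hw : 0 ≤ w) (y : Fin d → ℝ)
    (h : ∀ x, star (emb B (f x)) * emb B (f x) ≤
      w ^ 2 • (star (emb B (g (x - y))) * emb B (g (x - y)))) : ‖f‖ ≤ w * ‖g‖ := by
  have hint : ∀ u : S.Cc, Integrable fun x => star (emb B (u x)) * emb B (u x) := fun u =>
    ((embL B).integrable_comp (integrable_inner u u)).congr
      (Filter.Eventually.of_forall fun x => by simp [map_star])
  have h1 : emb B (inner f f) ≤ w ^ 2 • emb B (inner g g) := by
    rw [emb_inner, emb_inner,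
      ← integral_sub_right_eq_self (fun x => star (emb B (g x)) * emb B (g x)) y, ← integral_smul]
    exact integral_mono (hint f) (((hint g).comp_sub_right y).smul _) h
  have h2 := CStarAlgebra.norm_le_norm_of_nonneg_of_le (emb_inner_self_nonneg f) h1
  rw [norm_smul, norm_emb, norm_emb, ← norm_sq, ← norm_sq, Real.norm_of_nonneg (by positivity),
    ← mul_pow] at h2
  exact (pow_le_pow_iff_left₀ (norm_nonneg _) (by positivity) two_ne_zero).1 h2

variable (S) in
/-- The inner product as a continuous real bilinear map. -/
noncomputable def innerL : S.Cc →L[ℝ] S.Cc →L[ℝ] B :=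
  LinearMap.mkContinuous₂
    (LinearMap.mk₂ ℝ inner inner_add_left inner_real_smul_left inner_add_right
      (fun r f g => inner_real_smul_right r f g)) 1
    (fun f g => by simpa using norm_inner_le f g)

@[simp] lemma innerL_apply (f g : S.Cc) : innerL S f g = inner f g := rfl

lemma continuous_inner : Continuous fun p : S.Cc × S.Cc => inner p.1 p.2 :=
  (innerL S).continuous₂

/-- The function `x ↦ φ(x) f(x)`, for a continuous scalar function `φ` and `f ∈ C_c(ℝᵈ, B)`. -/
noncomputable def mulFun (φ : C(Fin d → ℝ, ℝ)) (f : S.Cc) : S.Cc where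
  toFun x := φ x • f x
  continuous_toFun := φ.continuous.smul f.continuous
  hasCompactSupport' := f.hasCompactSupport.mono fun x hx h => hx (by simp [h])

@[simp] lemma mulFun_apply (φ : C(Fin d → ℝ, ℝ)) (f : S.Cc) (x : Fin d → ℝ) :
    mulFun φ f x = φ x • f x := rfl

variable (S) in
/-- The function `x ↦ φ(x) b` in `C_c(ℝᵈ, B)`. -/
noncomputable def single (φ : (Fin d → ℝ) → ℝ) (hφ : Continuous φ) (hφc : HasCompactSupport φ)
    (b : B) : S.Cc where
  toFun x := φ x • b
  continuous_toFun := hφ.smul continuous_const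
  hasCompactSupport' := hφc.mono fun x hx h => hx (by simp [h])

@[simp] lemma single_apply (φ : (Fin d → ℝ) → ℝ) (hφ : Continuous φ) (hφc : HasCompactSupport φ)
    (b : B) (x : Fin d → ℝ) : single S φ hφ hφc b x = φ x • b := rfl

lemma mul_left_cancel_all {a : B} (h : ∀ c : B, c * a = 0) : a = 0 := by
  rw [← CStarRing.star_mul_self_eq_zero_iff, h]

/-- Smooth test functions already force `f = 0` almost everywhere, and Lebesgue measure charges
every nonempty open set, so continuity gives equality everywhere. -/
lemma eq_zero_of_forall_integral_smul {f : (Fin d → ℝ) → B} (hf : Continuous f)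
    (h : ∀ φ : (Fin d → ℝ) → ℝ, Continuous φ → HasCompactSupport φ → ∫ x, φ x • f x = 0) :
    f = 0 := by
  have h0 := ae_eq_zero_of_integral_contDiff_smul_eq_zero (μ := volume) hf.locallyIntegrable
    fun g hg hgc => h g hg.continuous hgc
  exact (Continuous.ae_eq_iff_eq volume hf continuous_const).1 h0

/-- By Cauchy–Schwarz, `f` is orthogonal to all functions `φ c^*`, which says `c ∫ φ f = 0` for all
`c` and `φ`. Thus no function is lost in the passage from `C_c(ℝᵈ, B)` to `L²(ℝᵈ, B)`. -/
lemma eq_zero_of_norm_eq_zero {f : S.Cc} (hf : ‖f‖ = 0) : f = 0 := by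
  refine DFunLike.coe_injective (eq_zero_of_forall_integral_smul f.continuous
    fun φ hφ hφc => mul_left_cancel_all fun c => ?_)
  have h1 : inner (single S φ hφ hφc (star c)) f = 0 := by
    rw [← norm_le_zero_iff]
    simpa [hf] using norm_inner_le (single S φ hφ hφc (star c)) f
  have hint : Integrable fun x => φ x • f x :=
    (hφ.smul f.continuous).integrable_of_hasCompactSupport
      (hφc.mono fun x hx h => hx (by simp [h]))
  have e := (ContinuousLinearMap.mul 𝕜 B c).integral_comp_comm hint
  refine e.symm.trans (Eq.trans ?_ h1)
  rw [inner]
  have := starModule_real 𝕜 B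
  have := isScalarTower_real_self 𝕜 B
  have := smulCommClass_real_self 𝕜 B
  refine integral_congr_ae (Filter.Eventually.of_forall fun x => ?_)
  simp [smul_mul_assoc]

end Cc

namespace L2

/-- A bilinear map is generally not uniformly continuous, so the extension rests on the theorem for
jointly continuous biadditive maps. All identities on `L²` are then obtained by density from `C_c`.
-/
lemma continuous_inner' : Continuous fun p : S.L2 × S.L2 => L2.inner p.1 p.2 := by
  let φ : S.Cc →+ S.Cc →+ B :=
    AddMonoidHom.mk' (fun f => (Cc.innerL S f : S.Cc →ₗ[ℝ] B).toAddMonoidHom)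
      (fun f g => by ext h; simp)
  have de := UniformSpace.Completion.isDenseInducing_toCompl S.Cc
  exact IsDenseInducing.extend_Z_bilin (φ := φ) de de Cc.continuous_inner

lemma continuous_inner {X : Type*} [TopologicalSpace X] {f g : X → S.L2} (hf : Continuous f)
    (hg : Continuous g) : Continuous fun x => L2.inner (f x) (g x) :=
  continuous_inner'.comp (hf.prodMk hg)

@[simp] lemma inner_coe (f g : S.Cc) : L2.inner (f : S.L2) (g : S.L2) = Cc.inner f g :=
  (UniformSpace.Completion.isDenseInducing_coe.prodMap
    UniformSpace.Completion.isDenseInducing_coe).extend_eq Cc.continuous_inner (f, g)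

@[simp] lemma mulRight_coe (b : B) (f : S.Cc) :
    L2.mulRight b (f : S.L2) = (Cc.mulRight b f : S.Cc) :=
  ContinuousLinearMap.completion_apply_coe _ _

open UniformSpace

lemma inner_add_right (x y z : S.L2) : L2.inner x (y + z) = L2.inner x y + L2.inner x z := by
  induction x, y, z using Completion.induction_on₃ with
  | hp =>
    exact isClosed_eq (continuous_inner (by fun_prop) (by fun_prop))
      ((continuous_inner (by fun_prop) (by fun_prop)).add
        (continuous_inner (by fun_prop) (by fun_prop)))
  | ih x y z => rw [← Completion.coe_add]; simp [Cc.inner_add_right]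

lemma inner_smul_right (k : 𝕜) (x y : S.L2) : L2.inner x (k • y) = k • L2.inner x y := by
  induction x, y using Completion.induction_on₂ with
  | hp =>
    exact isClosed_eq (continuous_inner continuous_fst (continuous_snd.const_smul k))
      ((continuous_inner (by fun_prop) (by fun_prop)).const_smul k)
  | ih x y => rw [← Completion.coe_smul, inner_coe, inner_coe, Cc.inner_smul_right]

lemma star_inner (x y : S.L2) : star (L2.inner x y) = L2.inner y x := by
  induction x, y using Completion.induction_on₂ with
  | hp =>
    exact isClosed_eq (continuous_inner (by fun_prop) (by fun_prop)).star
      (continuous_inner (by fun_prop) (by fun_prop))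
  | ih x y => simp [Cc.star_inner]

lemma inner_mulRight (x y : S.L2) (b : B) :
    L2.inner x (L2.mulRight b y) = L2.inner x y * b := by
  induction x, y using Completion.induction_on₂ with
  | hp =>
    exact isClosed_eq (continuous_inner (by fun_prop) (by fun_prop))
      ((continuous_inner (by fun_prop) (by fun_prop)).mul continuous_const)
  | ih x y => simp [Cc.inner_mulRight]

lemma emb_inner_self_nonneg (x : S.L2) : 0 ≤ emb B (L2.inner x x) := by
  induction x using Completion.induction_on with
  | hp =>
    exact isClosed_Ici.preimage (continuous_emb.comp (continuous_inner (by fun_prop) (by fun_prop)))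
  | ih x => simpa using Cc.emb_inner_self_nonneg x

lemma norm_sq (x : S.L2) : ‖x‖ ^ 2 = ‖L2.inner x x‖ := by
  induction x using Completion.induction_on with
  | hp => exact isClosed_eq (by fun_prop) (continuous_inner (by fun_prop) (by fun_prop)).norm
  | ih x => simpa using Cc.norm_sq x

lemma norm_inner_le (x y : S.L2) : ‖L2.inner x y‖ ≤ ‖x‖ * ‖y‖ := by
  induction x, y using Completion.induction_on₂ with
  | hp => exact isClosed_le (continuous_inner (by fun_prop) (by fun_prop)).norm (by fun_prop)
  | ih x y => simpa using Cc.norm_inner_le x y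

lemma mulRight_add (b c : B) (x : S.L2) : L2.mulRight (b + c) x = L2.mulRight b x + L2.mulRight c x := by
  induction x using Completion.induction_on with
  | hp => exact isClosed_eq (by fun_prop) (by fun_prop)
  | ih x =>
    simp only [mulRight_coe, ← Completion.coe_add]
    congr 1; ext y; simp [Cc.mulRight_apply, mul_add]

lemma mulRight_mul (b c : B) (x : S.L2) : L2.mulRight (b * c) x = L2.mulRight c (L2.mulRight b x) := by
  induction x using Completion.induction_on with
  | hp => exact isClosed_eq (by fun_prop) (by fun_prop)
  | ih x =>
    simp only [mulRight_coe]
    congr 1; ext y; simp [Cc.mulRight_apply, mul_assoc]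

lemma mulRight_smul (k : 𝕜) (b : B) (x : S.L2) : L2.mulRight (k • b) x = k • L2.mulRight b x := by
  induction x using Completion.induction_on with
  | hp => exact isClosed_eq (by fun_prop) ((L2.mulRight b).continuous.const_smul k)
  | ih x =>
    simp only [mulRight_coe, ← Completion.coe_smul]
    congr 1; ext y; simp [Cc.mulRight_apply, mul_smul_comm]

end L2

/-! ### The Hilbert module `L²(ℝᵈ, B) ⊗ ⋀^* ℝᵈ` -/

section KMod

lemma extCoord_tmul (ψ : S.L2) (ω : ExtAlg d) (I : Finset (Fin d)) :
    S.extCoord (ψ ⊗ₜ ω) I = (Pi.basisFun ℝ (Fin d)).ExteriorAlgebra.repr ω I • ψ :=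
  TensorProduct.equivFinsuppOfBasisRight_apply_tmul_apply _ _ _ _

lemma kMod_ext {x y : S.KMod} (h : ∀ I, S.extCoord x I = S.extCoord y I) : x = y :=
  S.extCoord.injective (Finsupp.ext h)

lemma extCoord_add (x y : S.KMod) (I : Finset (Fin d)) :
    S.extCoord (x + y) I = S.extCoord x I + S.extCoord y I := by simp

lemma extCoord_smul (k : 𝕜) (x : S.KMod) (I : Finset (Fin d)) :
    S.extCoord (k • x) I = k • S.extCoord x I := by
  induction x using TensorProduct.induction_on with
  | zero => simp
  | tmul ψ ω => rw [TensorProduct.smul_tmul', extCoord_tmul, extCoord_tmul, smul_comm]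
  | add x y hx hy => rw [smul_add, extCoord_add, hx, hy, extCoord_add, smul_add]

lemma extCoord_rTensor (T : S.L2 →ₗ[ℝ] S.L2) (x : S.KMod) (I : Finset (Fin d)) :
    S.extCoord (LinearMap.rTensor (ExtAlg d) T x) I = T (S.extCoord x I) := by
  induction x using TensorProduct.induction_on with
  | zero => simp
  | tmul ψ ω => rw [LinearMap.rTensor_tmul, extCoord_tmul, extCoord_tmul, map_smul]
  | add x y hx hy => rw [map_add, extCoord_add, hx, hy, extCoord_add, map_add]

lemma extCoord_act (x : S.KMod) (b : B) (I : Finset (Fin d)) :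
    S.extCoord (S.kModData.act x b) I = L2.mulRight b (S.extCoord x I) :=
  extCoord_rTensor _ _ _

lemma kMod_inner (x y : S.KMod) :
    S.kModData.inner x y = ∑ I, L2.inner (S.extCoord x I) (S.extCoord y I) := rfl

/-- In the envelope a positive element is dominated by any sum of positive elements containing it.
With `kMod_norm_le` this makes the module norm equivalent to the sum of the coordinate norms, so
completeness is checked coordinatewise. -/
lemma norm_extCoord_le (x : S.KMod) (I : Finset (Fin d)) : ‖S.extCoord x I‖ ≤ S.kModData.norm x := by
  rw [HilbertModuleData.norm]
  refine Real.le_sqrt_of_sq_le ?_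
  rw [L2.norm_sq, ← norm_emb, ← norm_emb (S.kModData.inner x x), kMod_inner, map_sum]
  exact CStarAlgebra.norm_le_norm_of_nonneg_of_le (L2.emb_inner_self_nonneg _)
    (Finset.single_le_sum (f := fun I => emb B (L2.inner (S.extCoord x I) (S.extCoord x I)))
      (fun I _ => L2.emb_inner_self_nonneg _) (Finset.mem_univ I))

lemma kMod_norm_le (x : S.KMod) : S.kModData.norm x ≤ ∑ I, ‖S.extCoord x I‖ := by
  rw [HilbertModuleData.norm]
  refine Real.sqrt_le_left (Finset.sum_nonneg fun _ _ => norm_nonneg _) |>.2 ?_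
  rw [kMod_inner]
  refine (norm_sum_le _ _).trans ?_
  simp_rw [← L2.norm_sq]
  exact Finset.sum_sq_le_sq_sum_of_nonneg fun _ _ => norm_nonneg _

variable (S) in
lemma isHilbertModule_kModData : S.kModData.IsHilbertModule 𝕜 where
  add_act x y b := map_add _ _ _
  act_add x b c := kMod_ext fun I => by
    simp [extCoord_act, L2.mulRight_add]
  act_mul x b c := kMod_ext fun I => by simp [extCoord_act, L2.mulRight_mul]
  smul_act k x b := kMod_ext fun I => by simp [extCoord_act, extCoord_smul]
  act_smul k x b := kMod_ext fun I => by
    simp [extCoord_act, extCoord_smul, L2.mulRight_smul]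
  inner_add x y z := by simp [kMod_inner, L2.inner_add_right, Finset.sum_add_distrib]
  inner_smul k x y := by simp [kMod_inner, extCoord_smul, L2.inner_smul_right, Finset.smul_sum]
  inner_act x y b := by simp [kMod_inner, extCoord_act, L2.inner_mulRight, Finset.sum_mul]
  star_inner x y := by simp [kMod_inner, L2.star_inner]
  inner_self_nonneg x := by
    refine exists_eq_star_mul_self ?_
    rw [kMod_inner, map_sum]
    exact Finset.sum_nonneg fun I _ => L2.emb_inner_self_nonneg _
  inner_self_eq_zero x hx := kMod_ext fun I => by
    have h := norm_extCoord_le x I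
    rw [HilbertModuleData.norm, hx, norm_zero, Real.sqrt_zero, norm_le_zero_iff] at h
    simpa using h
  complete u hu := by
    have h1 : ∀ I, CauchySeq fun n => S.extCoord (u n) I := fun I => by
      refine Metric.cauchySeq_iff.2 fun ε hε => ?_
      obtain ⟨N, hN⟩ := hu ε hε
      refine ⟨N, fun m hm n hn => ?_⟩
      rw [dist_eq_norm]
      have := norm_extCoord_le (u m - u n) I
      rw [map_sub, Finsupp.sub_apply] at this
      exact this.trans_lt (hN m hm n hn)
    choose c hc using fun I => cauchySeq_tendsto_of_complete (h1 I)
    refine ⟨S.extCoord.symm (Finsupp.equivFunOnFinite.symm c), fun ε hε => ?_⟩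
    have h2 : Filter.Tendsto (fun n => ∑ I, ‖S.extCoord (u n) I - c I‖) Filter.atTop (𝓝 0) := by
      rw [show (0 : ℝ) = ∑ I : Finset (Fin d), ‖c I - c I‖ by simp]
      exact tendsto_finsetSum _ fun I _ => ((hc I).sub_const _).norm
    obtain ⟨N, hN⟩ := Filter.eventually_atTop.1 (h2.eventually (gt_mem_nhds hε))
    refine ⟨N, fun n hn => lt_of_le_of_lt (kMod_norm_le _) ?_⟩
    simpa using hN n hn

end KMod

end TwistedSystem

/-! ### Exterior algebra and Clifford actions. -/

section ExteriorAlgebra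

variable {d : ℕ}

/-- The basis `e_I` of `⋀^* ℝᵈ`. -/
noncomputable abbrev extBasis (d : ℕ) : Module.Basis (Finset (Fin d)) ℝ (ExtAlg d) :=
  (Pi.basisFun ℝ (Fin d)).ExteriorAlgebra

/-- The generator `e_j` of `⋀^* ℝᵈ`. -/
noncomputable abbrev extGen (j : Fin d) : ExtAlg d := ExteriorAlgebra.ι ℝ (Pi.single j 1)

lemma extBasis_empty : extBasis d ∅ = 1 := by
  rw [ExteriorAlgebra.basis_apply_ofCard _ (n := 0) (by simp)]
  exact ExteriorAlgebra.ιMulti_zero_apply _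

/-- Prepending the smallest index keeps the list of indices increasing, so no sign appears. This is
the recursion behind all inductions on the minimum of `I`. -/
lemma extBasis_insert {a : Fin d} {I : Finset (Fin d)} (h : ∀ i ∈ I, a < i) :
    extBasis d (insert a I) = extGen a * extBasis d I := by
  have ha : a ∉ I := fun hI => (h a hI).false
  have hc : (insert a I).card = I.card + 1 := Finset.card_insert_of_notMem ha
  rw [ExteriorAlgebra.basis_apply_ofCard _ hc, ExteriorAlgebra.basis_apply_ofCard _ (s := I) rfl]
  have hmono : StrictMono (Fin.cons a (I.orderEmbOfFin rfl) : Fin (I.card + 1) → Fin d) := by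
    intro x y hxy
    cases y using Fin.cases with
    | zero => simp at hxy
    | succ y =>
      cases x using Fin.cases with
      | zero => simpa using h _ (Finset.orderEmbOfFin_mem _ _ _)
      | succ x => simpa using hxy
  have h1 : (Fin.cons a (I.orderEmbOfFin rfl) : Fin (I.card + 1) → Fin d) =
      (insert a I).orderEmbOfFin hc := by
    refine Finset.orderEmbOfFin_unique hc (fun x => ?_) hmono
    cases x using Fin.cases with
    | zero => simp
    | succ i => simp [Finset.orderEmbOfFin_mem]
  change ExteriorAlgebra.ιMulti ℝ (I.card + 1) (Pi.basisFun ℝ (Fin d) ∘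
      (insert a I).orderEmbOfFin hc) = _ * ExteriorAlgebra.ιMulti ℝ I.card
      (Pi.basisFun ℝ (Fin d) ∘ I.orderEmbOfFin rfl)
  rw [← h1, ExteriorAlgebra.ιMulti_succ_apply]
  congr 1
  simp

/-- The sign of `e_j ∧ e_I`. -/
def extSign (j : Fin d) (I : Finset (Fin d)) : ℝ := (-1) ^ (I.filter (· < j)).card

lemma extSign_insert_self (j : Fin d) (I : Finset (Fin d)) :
    extSign j (insert j I) = extSign j I := by
  rw [extSign, extSign, Finset.filter_insert, if_neg (lt_irrefl j)]

lemma extSign_insert_of_lt {a j : Fin d} {I : Finset (Fin d)} (ha : a ∉ I) (h : a < j) :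
    extSign j (insert a I) = -extSign j I := by
  rw [extSign, extSign, Finset.filter_insert, if_pos h, Finset.card_insert_of_notMem (by simp [ha]),
    pow_succ]
  ring

lemma extSign_of_le {j : Fin d} {I : Finset (Fin d)} (h : ∀ i ∈ I, j ≤ i) : extSign j I = 1 := by
  rw [extSign, Finset.filter_false_of_mem fun i hi => not_lt.2 (h i hi)]
  simp

lemma wedge_apply (v : Fin d → ℝ) (ω : ExtAlg d) : wedge v ω = ExteriorAlgebra.ι ℝ v * ω := rfl

lemma contract_ι_mul (u v : Fin d → ℝ) (ω : ExtAlg d) :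
    contract v (ExteriorAlgebra.ι ℝ u * ω) =
      (v ⬝ᵥ u) • ω - ExteriorAlgebra.ι ℝ u * contract v ω :=
  CliffordAlgebra.contractLeft_ι_mul _ _ _

lemma contract_one (v : Fin d → ℝ) : contract v (1 : ExtAlg d) = 0 :=
  CliffordAlgebra.contractLeft_one _ _

lemma ι_mul_ι_mul (u v : Fin d → ℝ) (ω : ExtAlg d) :
    ExteriorAlgebra.ι ℝ u * (ExteriorAlgebra.ι ℝ v * ω) =
      -(ExteriorAlgebra.ι ℝ v * (ExteriorAlgebra.ι ℝ u * ω)) := by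
  rw [← mul_assoc, ← mul_assoc, ← neg_mul]
  congr 1
  exact eq_neg_of_add_eq_zero_left (ExteriorAlgebra.ι_add_mul_swap u v)

/-- Induction on the minimum `a`: for `j < a` nothing is reordered, for `j = a` a square vanishes,
and for `j > a` anticommuting past `e_a` contributes one sign. -/
lemma wedge_extBasis (j : Fin d) (I : Finset (Fin d)) : wedge (Pi.single j 1) (extBasis d I) =
    if j ∈ I then 0 else extSign j I • extBasis d (insert j I) := by
  induction I using Finset.induction_on_min with
  | empty =>
    rw [if_neg (by simp), extSign_of_le (by simp), one_smul, extBasis_insert (by simp), wedge_apply]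
  | insert a I ha ih =>
    have haI : a ∉ I := fun hI => (ha a hI).false
    rw [wedge_apply, extBasis_insert ha]
    rcases lt_trichotomy j a with h | rfl | h
    · have h1 : ∀ i ∈ insert a I, j < i := by
        simp only [Finset.mem_insert, forall_eq_or_imp]
        exact ⟨h, fun i hi => h.trans (ha i hi)⟩
      rw [if_neg fun hj => (h1 j hj).false, extSign_of_le fun i hi => (h1 i hi).le, one_smul,
        extBasis_insert h1, extBasis_insert ha]
    · rw [if_pos (Finset.mem_insert_self _ _), ← mul_assoc, ExteriorAlgebra.ι_sq_zero, zero_mul]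
    · rw [ι_mul_ι_mul, ← wedge_apply (Pi.single j 1), ih]
      by_cases hj : j ∈ I
      · simp [hj]
      · rw [if_neg hj, if_neg (by simp [hj, h.ne']), mul_smul_comm, ← extBasis_insert (by
          simp only [Finset.mem_insert, forall_eq_or_imp]; exact ⟨h, ha⟩),
          extSign_insert_of_lt haI h, neg_smul, Finset.insert_comm]

/-- The same induction, with the antiderivation rule in place of anticommutation. The sign agrees
with that of `wedge_extBasis`, which is what makes the two operators adjoint. -/
lemma contract_extBasis (j : Fin d) (I : Finset (Fin d)) :
    contract (Pi.single j 1) (extBasis d I) =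
      if j ∈ I then extSign j I • extBasis d (I.erase j) else 0 := by
  induction I using Finset.induction_on_min with
  | empty => rw [if_neg (by simp), extBasis_empty, contract_one]
  | insert a I ha ih =>
    have haI : a ∉ I := fun hI => (ha a hI).false
    rw [extBasis_insert ha, contract_ι_mul, ih]
    rcases lt_trichotomy j a with h | rfl | h
    · have hj : j ∉ I := fun hI => (h.trans (ha j hI)).false
      simp [hj, h.ne, h.ne']
    · rw [if_neg haI, if_pos (Finset.mem_insert_self _ _), extSign_insert_self,
        extSign_of_le fun i hi => (ha i hi).le, Finset.erase_insert haI]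
      simp
    · by_cases hj : j ∈ I
      · rw [if_pos hj, if_pos (Finset.mem_insert_of_mem hj), mul_smul_comm,
          ← extBasis_insert fun i hi => ha i (Finset.mem_of_mem_erase hi),
          extSign_insert_of_lt haI h, Finset.erase_insert_of_ne h.ne]
        simp [h.ne']
      · simp [hj, h.ne, h.ne']

/-- The standard inner product of `⋀^* ℝᵈ`. -/
noncomputable def extInner : ExtAlg d →ₗ[ℝ] ExtAlg d →ₗ[ℝ] ℝ :=
  LinearMap.mk₂ ℝ (fun ω η => ∑ I, (extBasis d).repr ω I * (extBasis d).repr η I)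
    (fun _ _ _ => by simp [add_mul, Finset.sum_add_distrib])
    (fun _ _ _ => by simp [mul_assoc, Finset.mul_sum])
    (fun _ _ _ => by simp [mul_add, Finset.sum_add_distrib])
    (fun _ _ _ => by simp [mul_left_comm, Finset.mul_sum])

lemma extInner_apply (ω η : ExtAlg d) :
    extInner ω η = ∑ I, (extBasis d).repr ω I * (extBasis d).repr η I := rfl

lemma extInner_basis (I J : Finset (Fin d)) :
    extInner (extBasis d I) (extBasis d J) = if I = J then 1 else 0 := by
  rw [extInner_apply]
  simp [Finsupp.single_apply]

lemma extInner_comm (ω η : ExtAlg d) : extInner ω η = extInner η ω := by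
  simp [extInner_apply, mul_comm]

/-- `m'` is the adjoint of the endomorphism `m` of `⋀^* ℝᵈ`. -/
def IsExtAdjoint (m m' : Module.End ℝ (ExtAlg d)) : Prop :=
  ∀ ω η, extInner (m ω) η = extInner ω (m' η)

namespace IsExtAdjoint

variable {m n m' n' : Module.End ℝ (ExtAlg d)}

lemma of_basis (h : ∀ I J, extInner (m (extBasis d I)) (extBasis d J) =
    extInner (extBasis d I) (m' (extBasis d J))) : IsExtAdjoint m m' := by
  have : extInner ∘ₗ m = (extInner (d := d)).compl₂ m' :=
    (extBasis d).ext fun I => (extBasis d).ext fun J => h I J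
  exact fun ω η => congrFun (congrArg DFunLike.coe (congrFun (congrArg DFunLike.coe this) ω)) η

lemma symm (h : IsExtAdjoint m m') : IsExtAdjoint m' m := fun ω η => by
  rw [extInner_comm, ← h, extInner_comm]

lemma add (h : IsExtAdjoint m m') (k : IsExtAdjoint n n') : IsExtAdjoint (m + n) (m' + n') :=
  fun ω η => by simp [h ω η, k ω η]

lemma sub (h : IsExtAdjoint m m') (k : IsExtAdjoint n n') : IsExtAdjoint (m - n) (m' - n') :=
  fun ω η => by simp [h ω η, k ω η]

lemma mul (h : IsExtAdjoint m m') (k : IsExtAdjoint n n') : IsExtAdjoint (m * n) (n' * m') :=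
  fun ω η => by simp [h (n ω) η, k ω (m' η)]

end IsExtAdjoint

/-- For `v = e_j` both matrix coefficients at `(I, J)` equal the sign of `e_j ∧ e_I` if `J` is `I`
with `j` adjoined, and vanish otherwise; the general case is linear in `v`. -/
lemma isExtAdjoint_wedge (v : Fin d → ℝ) : IsExtAdjoint (wedge v) (contract v) := by
  have h1 : ∀ j : Fin d, IsExtAdjoint (wedge (Pi.single j 1)) (contract (Pi.single j 1)) := by
    refine fun j => .of_basis fun I J => ?_
    rw [wedge_extBasis, contract_extBasis]
    by_cases hI : j ∈ I <;> by_cases hJ : j ∈ J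
    · have : I ≠ J.erase j := fun h => by simp [h] at hI
      simp [hI, hJ, extInner_basis, this]
    · simp [hI, hJ]
    · by_cases h : insert j I = J
      · subst h
        simp [hI, extInner_basis, extSign_insert_self]
      · have : I ≠ J.erase j := fun h' => h (by rw [h', Finset.insert_erase hJ])
        simp [hI, hJ, extInner_basis, this, h]
    · have : insert j I ≠ J := fun h => hJ (by simp [← h])
      simp [hI, hJ, extInner_basis, this]
  have hv : v = ∑ j, v j • (Pi.single j 1 : Fin d → ℝ) := by
    simpa using ((Pi.basisFun ℝ (Fin d)).sum_repr v).symm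
  intro ω η
  rw [hv]
  simp [h1 _ ω η]

lemma isExtAdjoint_extGamma (j : Fin d) : IsExtAdjoint (extGamma j) (extGamma j) := by
  have h := (isExtAdjoint_wedge (Pi.single j 1)).add (isExtAdjoint_wedge (Pi.single j 1)).symm
  rw [add_comm (contract (Pi.single j 1))] at h
  exact h

lemma cliffordRep_ι (v : Fin d → ℝ) :
    cliffordRep (CliffordAlgebra.ι _ v) = wedge v - contract v :=
  CliffordAlgebra.lift_ι_apply _ _ _

/-- On a generator, the adjoint of `wedge - contract` is its negative, in accordance with `(ρ^j)^* =
-ρ^j`; products and sums follow. -/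
lemma isExtAdjoint_cliffordRep (c : Cl d) : IsExtAdjoint (cliffordRep c) (cliffordRep (star c)) := by
  induction c using CliffordAlgebra.induction with
  | algebraMap r =>
    rw [CliffordAlgebra.star_algebraMap, AlgHom.commutes]
    intro ω η
    simp [Algebra.algebraMap_eq_smul_one]
  | ι v =>
    rw [CliffordAlgebra.star_ι, map_neg, cliffordRep_ι, neg_sub]
    exact (isExtAdjoint_wedge v).sub (isExtAdjoint_wedge v).symm
  | mul a b ha hb => rw [star_mul, map_mul, map_mul]; exact ha.mul hb
  | add a b ha hb => rw [star_add, map_add, map_add]; exact ha.add hb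

lemma wedge_mul_wedge (u v : Fin d → ℝ) : wedge u * wedge v = -(wedge v * wedge u) :=
  LinearMap.ext fun ω => ι_mul_ι_mul u v ω

lemma contract_mul_contract (u v : Fin d → ℝ) :
    contract u * contract v = -(contract v * contract u) :=
  LinearMap.ext fun ω => CliffordAlgebra.contractLeft_comm _ _ ω

lemma contract_mul_wedge (u v : Fin d → ℝ) :
    contract u * wedge v = (u ⬝ᵥ v) • 1 - wedge v * contract u :=
  LinearMap.ext fun ω => contract_ι_mul v u ω

/-- Pure wedge and pure contraction terms anticommute away, and the two mixed pairs each contribute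
`⟨e_j, e_k⟩`. This relation gives `X² = |x|²`. -/
lemma extGamma_mul_add (j k : Fin d) : extGamma j * extGamma k + extGamma k * extGamma j =
    if j = k then 2 else 0 := by
  simp only [extGamma, add_mul, mul_add, contract_mul_wedge]
  rw [wedge_mul_wedge (Pi.single j 1), contract_mul_contract (Pi.single j 1)]
  rcases eq_or_ne j k with rfl | h
  · simp only [dotProduct_single, Pi.single_eq_same, mul_one, one_smul, if_true]
    rw [← one_add_one_eq_two]
    abel
  · simp only [dotProduct_single, Pi.single_eq_of_ne h, Pi.single_eq_of_ne h.symm, mul_one,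
      zero_smul, if_neg h]
    abel

/-- For a generator the two mixed wedge–contraction terms enter with opposite signs, so the pairings
cancel and `γ^j` anticommutes with `ρ(v)`. Hence the Clifford factor makes no contribution to the
graded commutator with `X` beyond the position commutators. -/
lemma extGamma_mul_cliffordRep (j : Fin d) (c : Cl d) :
    extGamma j * cliffordRep c = cliffordRep (CliffordAlgebra.involute c) * extGamma j := by
  induction c using CliffordAlgebra.induction with
  | algebraMap r => rw [AlgHom.commutes, AlgHom.commutes, AlgHom.commutes]; exact (Algebra.commutes (A := Module.End ℝ (ExtAlg d)) r _).symm
  | ι v =>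
    rw [CliffordAlgebra.involute_ι, map_neg, cliffordRep_ι, extGamma, neg_sub]
    simp only [add_mul, mul_add, mul_sub, sub_mul, contract_mul_wedge]
    rw [wedge_mul_wedge (Pi.single j 1), contract_mul_contract (Pi.single j 1),
      dotProduct_comm v]
    abel
  | mul a b ha hb => rw [map_mul, map_mul, map_mul, ← mul_assoc, ha, mul_assoc, hb, mul_assoc]
  | add a b ha hb => rw [map_add, map_add, map_add, mul_add, add_mul, ha, hb]

/-- The grading operator of `⋀^* ℝᵈ`. -/
noncomputable def extGrading (d : ℕ) : Module.End ℝ (ExtAlg d) :=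
  (CliffordAlgebra.involute (Q := (0 : QuadraticForm ℝ (Fin d → ℝ)))).toLinearMap

lemma extGrading_extGrading (ω : ExtAlg d) : extGrading d (extGrading d ω) = ω :=
  CliffordAlgebra.involute_involute ω

lemma extGrading_one : extGrading d 1 = 1 := map_one CliffordAlgebra.involute

lemma extGrading_ι_mul (v : Fin d → ℝ) (ω : ExtAlg d) :
    extGrading d (ExteriorAlgebra.ι ℝ v * ω) = -(ExteriorAlgebra.ι ℝ v * extGrading d ω) := by
  refine (map_mul CliffordAlgebra.involute _ _).trans ?_
  rw [← neg_mul]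
  congr 1
  exact CliffordAlgebra.involute_ι v

lemma extGrading_wedge (v : Fin d → ℝ) (ω : ExtAlg d) :
    extGrading d (wedge v ω) = -wedge v (extGrading d ω) := extGrading_ι_mul v ω

/-- Contraction obeys a product rule for a vector on the left, so the induction builds `ω` by left
multiplication. -/
lemma extGrading_contract (v : Fin d → ℝ) (ω : ExtAlg d) :
    extGrading d (contract v ω) = -contract v (extGrading d ω) := by
  induction ω using CliffordAlgebra.left_induction with
  | algebraMap r =>
    have h1 : contract v (algebraMap ℝ (ExtAlg d) r) = 0 :=
      CliffordAlgebra.contractLeft_algebraMap _ _ _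
    have h2 : extGrading d (algebraMap ℝ (ExtAlg d) r) = algebraMap ℝ (ExtAlg d) r :=
      AlgHom.commutes _ _
    rw [h2]
    exact (congrArg _ h1).trans (by rw [map_zero]; exact (neg_eq_zero.2 h1).symm)
  | add x y hx hy => rw [map_add, map_add, map_add, map_add, hx, hy, neg_add]
  | ι_mul x u hx =>
    have h1 := contract_ι_mul u v x
    have h2 := contract_ι_mul u v (extGrading d x)
    have h3 := extGrading_ι_mul u x
    have h4 := extGrading_ι_mul u (contract v x)
    refine (congrArg _ h1).trans ?_
    refine Eq.trans ?_ (congrArg (fun z => -contract v z) h3).symm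
    rw [map_sub, map_smul, h4, map_neg, h2, hx]
    simp

lemma extGrading_extGamma (j : Fin d) (ω : ExtAlg d) :
    extGrading d (extGamma j ω) = -extGamma j (extGrading d ω) := by
  simp only [extGamma, LinearMap.add_apply, map_add, extGrading_wedge, extGrading_contract, neg_add]

lemma extGrading_cliffordRep (c : Cl d) (ω : ExtAlg d) : extGrading d (cliffordRep c ω) =
    cliffordRep (CliffordAlgebra.involute c) (extGrading d ω) := by
  induction c using CliffordAlgebra.induction generalizing ω with
  | algebraMap r => rw [AlgHom.commutes, AlgHom.commutes]; simp [Algebra.algebraMap_eq_smul_one]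
  | ι v =>
    rw [CliffordAlgebra.involute_ι, map_neg, cliffordRep_ι]
    simp only [LinearMap.sub_apply, LinearMap.neg_apply, map_sub, extGrading_wedge,
      extGrading_contract]
    abel
  | mul a b ha hb => simp [ha, hb]
  | add a b ha hb => simp [ha, hb]

lemma extGrading_extBasis (I : Finset (Fin d)) :
    extGrading d (extBasis d I) = (-1 : ℝ) ^ I.card • extBasis d I := by
  induction I using Finset.induction_on_min with
  | empty => simp [extBasis_empty, extGrading_one]
  | insert a I ha ih =>
    rw [extBasis_insert ha, extGrading_ι_mul, ih,
      Finset.card_insert_of_notMem fun h => (ha a h).false, pow_succ]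
    simp

lemma isExtAdjoint_extGrading : IsExtAdjoint (extGrading d) (extGrading d) :=
  .of_basis fun I J => by
    rw [extGrading_extBasis, extGrading_extBasis]
    by_cases h : I = J
    · subst h; simp
    · simp [extInner_basis, h]

/-- The exterior algebra is the Clifford algebra of the zero form, and the two forms differ by the
square of the dot product. This is the hypothesis under which a change of form identifies the
underlying vector spaces. -/
lemma dotProductBilin_toQuadraticMap (d : ℕ) :
    LinearMap.BilinMap.toQuadraticMap (dotProductBilin ℝ ℝ) =
      (0 : QuadraticForm ℝ (Fin d → ℝ)) - QuadraticMap.weightedSumSquares ℝ fun _ => (-1 : ℝ) := by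
  ext v
  simp [QuadraticMap.weightedSumSquares_apply, dotProductBilin, dotProduct]

/-- The isomorphism of vector spaces `Cℓ_{0,d} ≃ ⋀^* ℝᵈ`. -/
noncomputable def clEquiv (d : ℕ) : Cl d ≃ₗ[ℝ] ExtAlg d :=
  CliffordAlgebra.changeFormEquiv (dotProductBilin_toQuadraticMap d)

/-- Both sides satisfy the same recursion under left multiplication by a vector. It follows that `1
∈ ⋀^* ℝᵈ` is cyclic and separating for `Cℓ_{0,d}`, the Clifford half of the faithfulness of the
representation. -/
lemma cliffordRep_one_eq (c : Cl d) : cliffordRep c 1 = clEquiv d c := by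
  induction c using CliffordAlgebra.left_induction with
  | algebraMap r =>
    rw [AlgHom.commutes]
    refine Eq.trans ?_ (CliffordAlgebra.changeForm_algebraMap
      (dotProductBilin_toQuadraticMap d) r).symm
    simp [Algebra.algebraMap_eq_smul_one]
  | add x y hx hy => simp [hx, hy]
  | ι_mul x v hx =>
    refine Eq.trans ?_ (CliffordAlgebra.changeForm_ι_mul
      (dotProductBilin_toQuadraticMap d) v x).symm
    rw [map_mul, Module.End.mul_apply, hx, cliffordRep_ι]
    rfl

end ExteriorAlgebra

/-! ### Self-adjointness and regularity from the bounded transform. -/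

namespace HilbertModuleData

variable {𝕜 : Type v} {B E : Type u} [RCLike 𝕜] [NonUnitalNormedRing B] [StarRing B] [CStarRing B]
  [CompleteSpace B] [NormedSpace ℝ B] [NormedSpace 𝕜 B] [RealCStar B]
  [AddCommGroup E] [Module 𝕜 E] {M : HilbertModuleData B E}

/-- An operator `D` whose graph is `{(x, y) | F x = R y}`, with commuting self-adjoint `F`, `R` such
that `F² + R² = 1`, is self-adjoint and regular. -/
lemma IsHilbertModule.isSelfAdjointRegular (hM : M.IsHilbertModule 𝕜) {D : E →ₗ.[𝕜] E}
    {F R : E →ₗ[𝕜] E} (hF : M.IsAdjoint F F) (hR : M.IsAdjoint R R) (hFR : ∀ x, F (R x) = R (F x))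
    (h1 : ∀ x, F (F x) + R (R x) = x) (hD : ∀ x y, (x, y) ∈ D.graph ↔ F x = R y)
    (hRd : ∀ x, ∀ ε > 0, ∃ y, M.norm (x - R y) < ε) : M.IsSelfAdjointRegular D where
  dense x ε hε := by
    obtain ⟨y, hy⟩ := hRd x ε hε
    exact ⟨R y, LinearPMap.mem_domain_of_mem_graph ((hD (R y) (F y)).2 (hFR y)), hy⟩
  selfAdjoint y z := by
    rw [hD]
    constructor
    · intro h x
      have hx : F x = R (D x) := (hD _ _).1 (D.mem_graph x)
      -- Every pair with `F y = R z` is of the form `(R w, F w)`, with `w = R y + F z`, because `R²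
      -- y + R F z = R² y + F² y = y`.
      have e1 : y = R (R y + F z) := by rw [map_add, ← hFR, ← h, add_comm, h1]
      have e2 : z = F (R y + F z) := by rw [map_add, hFR, h, add_comm, h1]
      rw [e1, ← hR, ← hx, hF, ← e2]
    · intro h
      refine sub_eq_zero.1 (hM.inner_self_eq_zero _ ?_)
      -- Pairs `(R x, F x)` lie in the graph; testing against them already makes `F y - R z`
      -- orthogonal to everything.
      have key : ∀ x, M.inner (F x) y = M.inner (R x) z := fun x => by
        have hg : (R x, F x) ∈ D.graph := (hD _ _).2 (hFR x)
        obtain ⟨w, hw1, hw2⟩ := LinearPMap.mem_graph_iff D |>.1 hg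
        have := h w
        simp only at hw1 hw2
        rwa [hw2, hw1] at this
      rw [hM.inner_sub, ← hF, key, ← hR, sub_self]
  regular z ε hε := by
    -- Since `R² + F² = 1`, these vectors solve the equation exactly, and the range of `1 + D²` is
    -- everything.
    refine ⟨R (R z), F (R z), F (F z), ?_, ?_, ?_⟩
    · rw [hD, hFR]
    · rw [hD, hFR, hFR]
    · rw [add_comm, h1, sub_self]
      simpa [norm, hM.inner_zero] using hε

/-- Formally `F = D R`, so `D² R² = F² = 1 - R²` and `R²` inverts `1 + D²`. The factorisation `R =
T' T` is what witnesses positivity. -/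
lemma isInvSqrt {D : E →ₗ.[𝕜] E} {F R : E →ₗ[𝕜] E} {T T' : E → E} (hT : M.IsAdjoint T T')
    (hRT : ∀ x, R x = T' (T x)) (hFR : ∀ x, F (R x) = R (F x))
    (h1 : ∀ x, F (F x) + R (R x) = x) (hD : ∀ x y, (x, y) ∈ D.graph ↔ F x = R y) :
    M.IsInvSqrt D R where
  pos := ⟨T, T', hT, hRT⟩
  right_inv x := ⟨F (R x), F (F x), by rw [hD, hFR], by rw [hD, hFR, hFR], by rw [add_comm, h1]⟩
  left_inv x y w hxy hyw := by
    rw [hD] at hxy hyw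
    rw [map_add, map_add, ← hyw, ← hFR, ← hxy, add_comm, h1]

end HilbertModuleData

/-! ### Multiplication operators and the position operators `X_j`. -/

namespace TwistedSystem

variable {𝕜 : Type v} {B : Type u} [RCLike 𝕜] [NonUnitalNormedRing B]
  [StarRing B] [CStarRing B] [CompleteSpace B] [NormedSpace ℝ B] [NormedSpace 𝕜 B]
  [IsScalarTower ℝ 𝕜 B] [IsScalarTower 𝕜 B B] [SMulCommClass 𝕜 B B] [StarModule 𝕜 B]
  [RealCStar B] {d : ℕ} {S : TwistedSystem 𝕜 B d}

open RealCStar UniformSpace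
open scoped BoundedContinuousFunction

namespace L2

lemma real_smul_comm (r : ℝ) (k : 𝕜) (b : B) : r • k • b = k • r • b := by
  rw [← algebraMap_smul 𝕜 r, ← algebraMap_smul 𝕜 r b, smul_comm]

variable (S) in
/-- Multiplication by a bounded continuous real function on `C_c(ℝᵈ, B)`. -/
noncomputable def mulCc (φ : (Fin d → ℝ) →ᵇ ℝ) : S.Cc →L[𝕜] S.Cc :=
  LinearMap.mkContinuous
    { toFun := Cc.mulFun φ
      map_add' := fun f g => by ext x; simp
      map_smul' := fun k f => by
        ext x
        exact real_smul_comm (φ x) k (f x) } ‖φ‖ fun f => by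
    refine Cc.norm_le_of_star_mul_self_le (norm_nonneg φ) 0 fun x => ?_
    change star (emb B (φ x • f x)) * emb B (φ x • f x) ≤ _
    rw [emb_smul, star_smul, smul_mul_smul_comm, star_trivial, sub_zero, ← pow_two]
    refine smul_le_smul_of_nonneg_right ?_ (star_mul_self_nonneg _)
    exact sq_le_sq' (by linarith [neg_abs_le (φ x), φ.norm_coe_le_norm x, Real.norm_eq_abs (φ x)])
      ((le_abs_self _).trans (φ.norm_coe_le_norm x))

lemma mulCc_apply (φ : (Fin d → ℝ) →ᵇ ℝ) (f : S.Cc) (x : Fin d → ℝ) :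
    mulCc S φ f x = φ x • f x := rfl

variable (S) in
/-- Multiplication by a bounded continuous real function on `L²(ℝᵈ, B)`. -/
noncomputable def mulOp (φ : (Fin d → ℝ) →ᵇ ℝ) : S.L2 →L[𝕜] S.L2 := (mulCc S φ).completion

@[simp] lemma mulOp_coe (φ : (Fin d → ℝ) →ᵇ ℝ) (f : S.Cc) :
    mulOp S φ (f : S.L2) = (mulCc S φ f : S.Cc) :=
  ContinuousLinearMap.completion_apply_coe _ _

lemma norm_mulOp_le (φ : (Fin d → ℝ) →ᵇ ℝ) (u : S.L2) : ‖mulOp S φ u‖ ≤ ‖φ‖ * ‖u‖ := by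
  induction u using Completion.induction_on with
  | hp => exact isClosed_le (by fun_prop) (by fun_prop)
  | ih f => 
    rw [mulOp_coe, Completion.norm_coe, Completion.norm_coe]
    exact (mulCc S φ).le_of_opNorm_le (LinearMap.mkContinuous_norm_le _ (norm_nonneg _) _) f

lemma mulOp_mul (φ χ : (Fin d → ℝ) →ᵇ ℝ) (u : S.L2) :
    mulOp S (φ * χ) u = mulOp S φ (mulOp S χ u) := by
  induction u using Completion.induction_on with
  | hp => exact isClosed_eq (by fun_prop) (by fun_prop)
  | ih f =>
    simp only [mulOp_coe]
    congr 1; ext x; simp [mulCc_apply, mul_smul]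

lemma mulOp_add (φ χ : (Fin d → ℝ) →ᵇ ℝ) (u : S.L2) :
    mulOp S (φ + χ) u = mulOp S φ u + mulOp S χ u := by
  induction u using Completion.induction_on with
  | hp => exact isClosed_eq (by fun_prop) (by fun_prop)
  | ih f =>
    simp only [mulOp_coe, ← Completion.coe_add]
    congr 1; ext x; simp [mulCc_apply, add_smul]

lemma mulOp_one (u : S.L2) : mulOp S 1 u = u := by
  induction u using Completion.induction_on with
  | hp => exact isClosed_eq (by fun_prop) (by fun_prop)
  | ih f =>
    simp only [mulOp_coe]
    congr 1; ext x; simp [mulCc_apply]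

lemma inner_mulOp (φ : (Fin d → ℝ) →ᵇ ℝ) (u v : S.L2) :
    L2.inner (mulOp S φ u) v = L2.inner u (mulOp S φ v) := by
  induction u, v using Completion.induction_on₂ with
  | hp =>
    exact isClosed_eq (continuous_inner (by fun_prop) (by fun_prop))
      (continuous_inner (by fun_prop) (by fun_prop))
  | ih f g =>
    simp only [mulOp_coe, inner_coe, Cc.inner]
    have := starModule_real 𝕜 B
    have := isScalarTower_real_self 𝕜 B
    have := smulCommClass_real_self 𝕜 B
    simp [mulCc_apply, smul_mul_assoc, mul_smul_comm]

lemma mulOp_comm (φ χ : (Fin d → ℝ) →ᵇ ℝ) (u : S.L2) :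
    mulOp S φ (mulOp S χ u) = mulOp S χ (mulOp S φ u) := by
  rw [← mulOp_mul, mul_comm, mulOp_mul]

end L2

section Functions

/-- A continuous function with compact support is bounded. -/
noncomputable def bcfOfCompactSupport (f : (Fin d → ℝ) → ℝ) (hf : Continuous f)
    (hc : HasCompactSupport f) : (Fin d → ℝ) →ᵇ ℝ :=
  BoundedContinuousFunction.ofNormedAddCommGroup f hf
    (Classical.choose (hf.bounded_above_of_compact_support hc))
    (Classical.choose_spec (hf.bounded_above_of_compact_support hc))

@[simp] lemma bcfOfCompactSupport_apply (f : (Fin d → ℝ) → ℝ) (hf : Continuous f)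
    (hc : HasCompactSupport f) (x : Fin d → ℝ) : bcfOfCompactSupport f hf hc x = f x := rfl

/-- A cutoff function which is `1` on the ball of radius `n`. -/
noncomputable def cutoff (d n : ℕ) : (Fin d → ℝ) →ᵇ ℝ :=
  BoundedContinuousFunction.ofNormedAddCommGroup (fun x => max 0 (min 1 (n + 1 - ‖x‖)))
    (by fun_prop) 1 fun x => by
      rw [Real.norm_of_nonneg (le_max_left _ _)]
      exact max_le zero_le_one (min_le_left _ _)

lemma cutoff_apply (n : ℕ) (x : Fin d → ℝ) : cutoff d n x = max 0 (min 1 (n + 1 - ‖x‖)) := rfl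

lemma norm_cutoff_le (d n : ℕ) : ‖cutoff d n‖ ≤ 1 :=
  BoundedContinuousFunction.norm_ofNormedAddCommGroup_le _ zero_le_one _

lemma cutoff_eq_one {n : ℕ} {x : Fin d → ℝ} (h : ‖x‖ ≤ n) : cutoff d n x = 1 := by
  rw [cutoff_apply, min_eq_left (by linarith), max_eq_right zero_le_one]

lemma cutoff_nonneg (n : ℕ) (x : Fin d → ℝ) : 0 ≤ cutoff d n x := le_max_left _ _

lemma cutoff_le_one (n : ℕ) (x : Fin d → ℝ) : cutoff d n x ≤ 1 :=
  max_le zero_le_one (min_le_left _ _)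

lemma hasCompactSupport_cutoff (n : ℕ) : HasCompactSupport (cutoff d n) := by
  refine HasCompactSupport.intro (isCompact_closedBall (0 : Fin d → ℝ) (n + 1)) fun x hx => ?_
  rw [Metric.mem_closedBall, dist_zero_right, not_le] at hx
  rw [cutoff_apply, max_eq_left]
  exact (min_le_right _ _).trans (by linarith)

/-- The function `(1 + |x|²)^{1/2}`. -/
noncomputable def japanese (x : Fin d → ℝ) : ℝ := √(1 + ∑ j, x j ^ 2)

lemma japanese_sq (x : Fin d → ℝ) : japanese x ^ 2 = 1 + ∑ j, x j ^ 2 :=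
  Real.sq_sqrt (by positivity)

lemma japanese_pos (x : Fin d → ℝ) : 0 < japanese x := Real.sqrt_pos.2 (by positivity)

lemma one_le_japanese (x : Fin d → ℝ) : 1 ≤ japanese x :=
  Real.one_le_sqrt.2 (by simp; positivity)

lemma abs_le_japanese (x : Fin d → ℝ) (j : Fin d) : |x j| ≤ japanese x := by
  refine Real.abs_le_sqrt ?_
  have := Finset.single_le_sum (f := fun j => x j ^ 2) (fun i _ => sq_nonneg _) (Finset.mem_univ j)
  linarith

lemma norm_le_japanese (x : Fin d → ℝ) : ‖x‖ ≤ japanese x :=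
  (pi_norm_le_iff_of_nonneg (japanese_pos x).le).2 fun j => abs_le_japanese x j

lemma continuous_japanese : Continuous (japanese : (Fin d → ℝ) → ℝ) := by
  unfold japanese; fun_prop

/-- The function `(1 + |x|²)^{-1/2}`. -/
noncomputable def resFun (d : ℕ) : (Fin d → ℝ) →ᵇ ℝ :=
  BoundedContinuousFunction.ofNormedAddCommGroup (fun x => (japanese x)⁻¹)
    (continuous_japanese.inv₀ fun x => (japanese_pos x).ne') 1 fun x => by
      rw [norm_inv, Real.norm_of_nonneg (japanese_pos x).le]
      exact inv_le_one_of_one_le₀ (one_le_japanese x)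

lemma resFun_apply (x : Fin d → ℝ) : resFun d x = (japanese x)⁻¹ := rfl

/-- The function `(1 + |x|²)^{-1/4}`. -/
noncomputable def sqrtResFun (d : ℕ) : (Fin d → ℝ) →ᵇ ℝ :=
  BoundedContinuousFunction.ofNormedAddCommGroup (fun x => √(japanese x)⁻¹)
    (continuous_japanese.inv₀ fun x => (japanese_pos x).ne').sqrt 1 fun x => by
      rw [Real.norm_of_nonneg (Real.sqrt_nonneg _)]
      exact Real.sqrt_le_one.2 (inv_le_one_of_one_le₀ (one_le_japanese x))

lemma sqrtResFun_mul_self (d : ℕ) : sqrtResFun d * sqrtResFun d = resFun d := by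
  ext x
  exact Real.mul_self_sqrt (inv_nonneg.2 (japanese_pos x).le)

/-- The function `x_j (1 + |x|²)^{-1/2}`. -/
noncomputable def coordResFun (j : Fin d) : (Fin d → ℝ) →ᵇ ℝ :=
  BoundedContinuousFunction.ofNormedAddCommGroup (fun x => x j * (japanese x)⁻¹)
    ((continuous_apply j).mul (continuous_japanese.inv₀ fun x => (japanese_pos x).ne')) 1 fun x => by
      rw [norm_mul, norm_inv, Real.norm_of_nonneg (japanese_pos x).le, Real.norm_eq_abs,
        ← div_eq_mul_inv, div_le_one (japanese_pos x)]
      exact abs_le_japanese x j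

lemma coordResFun_apply (j : Fin d) (x : Fin d → ℝ) : coordResFun j x = x j * (japanese x)⁻¹ := rfl

lemma sum_coordResFun_sq (d : ℕ) :
    ∑ j : Fin d, coordResFun j * coordResFun j + resFun d * resFun d = 1 := by
  ext x
  simp only [BoundedContinuousFunction.coe_add, BoundedContinuousFunction.coe_mul,
    BoundedContinuousFunction.coe_sum, Pi.add_apply, Finset.sum_apply, Pi.mul_apply,
    coordResFun_apply, resFun_apply, BoundedContinuousFunction.coe_one, Pi.one_apply]
  have h := japanese_sq x
  have h0 := (japanese_pos x).ne'
  have : ∀ j, x j * (japanese x)⁻¹ * (x j * (japanese x)⁻¹) = x j ^ 2 * ((japanese x) ^ 2)⁻¹ := 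
    fun j => by field_simp
  rw [Finset.sum_congr rfl fun j _ => this j, ← Finset.sum_mul, ← mul_inv, ← pow_two]
  field_simp
  linarith

/-- The function `χ_n (1 + |x|²)^{1/2}`. -/
noncomputable def cutoffInv (d n : ℕ) : (Fin d → ℝ) →ᵇ ℝ :=
  bcfOfCompactSupport (fun x => cutoff d n x * japanese x)
    ((cutoff d n).continuous.mul continuous_japanese) (hasCompactSupport_cutoff n).mul_right

lemma cutoffInv_mul_resFun (d n : ℕ) : cutoffInv d n * resFun d = cutoff d n := by
  ext x
  simp [cutoffInv, resFun_apply, (japanese_pos x).ne']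

/-- The function `χ_n x_j`. -/
noncomputable def cutoffCoord (n : ℕ) (j : Fin d) : (Fin d → ℝ) →ᵇ ℝ :=
  bcfOfCompactSupport (fun x => cutoff d n x * x j)
    ((cutoff d n).continuous.mul (continuous_apply j)) (hasCompactSupport_cutoff n).mul_right

lemma cutoffInv_mul_coordResFun (n : ℕ) (j : Fin d) :
    cutoffInv d n * coordResFun j = cutoffCoord n j := by
  ext x
  have := (japanese_pos x).ne'
  simp [cutoffInv, coordResFun_apply, cutoffCoord]
  field_simp

end Functions

namespace L2

/-- The cutoffs are contractions and eventually fix any given compactly supported function, so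
density gives strong convergence to the identity. It replaces dominated convergence throughout. -/
lemma tendsto_mulOp_cutoff (u : S.L2) :
    Filter.Tendsto (fun n => mulOp S (cutoff d n) u) Filter.atTop (𝓝 u) := by
  have hb : ∀ n (w : S.L2), ‖mulOp S (cutoff d n) w‖ ≤ ‖w‖ := fun n w =>
    (norm_mulOp_le _ _).trans (mul_le_of_le_one_left (norm_nonneg _) (norm_cutoff_le d n))
  rw [Metric.tendsto_atTop]
  intro ε hε
  obtain ⟨f, hf⟩ : ∃ f : S.Cc, dist u (f : S.L2) < ε / 2 := by
    obtain ⟨_, ⟨f, rfl⟩, h⟩ := Metric.mem_closure_iff.1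
      (Completion.denseRange_coe (α := S.Cc) u) (ε / 2) (half_pos hε)
    exact ⟨f, h⟩
  obtain ⟨r, hr⟩ := f.hasCompactSupport.isBounded.subset_closedBall 0
  obtain ⟨N, hN⟩ := exists_nat_ge r
  refine ⟨N, fun n hn => ?_⟩
  have h1 : mulOp S (cutoff d n) (f : S.L2) = f := by
    rw [mulOp_coe]
    congr 1; ext x
    rw [mulCc_apply]
    by_cases hx : x ∈ tsupport f
    · have := hr hx
      rw [Metric.mem_closedBall, dist_zero_right] at this
      rw [cutoff_eq_one (this.trans (hN.trans (by exact_mod_cast hn))), one_smul]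
    · rw [image_eq_zero_of_notMem_tsupport hx, smul_zero]
  calc dist (mulOp S (cutoff d n) u) u
      = ‖mulOp S (cutoff d n) (u - f) - (u - f)‖ := by
        rw [map_sub, h1, dist_eq_norm]; congr 1; abel
    _ ≤ ‖u - f‖ + ‖u - f‖ := (norm_sub_le _ _).trans (by gcongr; exact hb _ _)
    _ < ε := by rw [← dist_eq_norm]; linarith

lemma mulOp_resFun_eq_zero {u : S.L2} (h : mulOp S (resFun d) u = 0) : u = 0 := by
  refine tendsto_nhds_unique (tendsto_mulOp_cutoff u) ?_
  simp_rw [← cutoffInv_mul_resFun, mulOp_mul, h, map_zero]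
  exact tendsto_const_nhds

/-- The relation `x_j ⟨x⟩^{-1} u = ⟨x⟩^{-1} v`, with `⟨x⟩ = (1 + |x|²)^{1/2}`, is closed and holds
for `v = x_j u` with `u` in `C_c`. Conversely it shows, after multiplication by the bounded function
`χ_n ⟨x⟩`, that `χ_n v = χ_n x_j u`, and the pairs `(χ_n u, χ_n x_j u)` in the graph converge to
`(u, v)`. -/
lemma mem_positionGraph_iff {j : Fin d} {u v : S.L2} :
    (u, v) ∈ positionGraph S j ↔ mulOp S (coordResFun j) u = mulOp S (resFun d) v := by
  constructor
  · intro h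
    have hcl : IsClosed {p : S.L2 × S.L2 | mulOp S (coordResFun j) p.1 = mulOp S (resFun d) p.2} :=
      isClosed_eq (by fun_prop) (by fun_prop)
    refine closure_minimal ?_ hcl h
    rintro _ ⟨f, rfl⟩
    change mulOp S (coordResFun j) (f : S.L2) = mulOp S (resFun d) (Cc.coord j f : S.Cc)
    rw [mulOp_coe, mulOp_coe]
    congr 1; ext x
    simp [mulCc_apply, coordResFun_apply, resFun_apply, Cc.coord_apply, smul_smul, mul_comm]
  · intro h
    -- Both entries are bounded operators applied to `w`, so the claim passes from `C_c` to all of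
    -- `L²`.
    have h1 : ∀ n (w : S.L2), (mulOp S (cutoff d n) w, mulOp S (cutoffCoord n j) w) ∈
        positionGraph S j := fun n w => by
      induction w using Completion.induction_on with
      | hp =>
        exact (Submodule.isClosed_topologicalClosure _).preimage
          ((mulOp S (cutoff d n)).continuous.prodMk (mulOp S (cutoffCoord n j)).continuous)
      | ih f =>
        refine Submodule.le_topologicalClosure _ ⟨mulCc S (cutoff d n) f, ?_⟩
        refine Prod.ext ?_ ?_
        · exact (mulOp_coe _ _).symm
        · refine Eq.trans ?_ (mulOp_coe _ _).symm
          change ((Cc.coord j (mulCc S (cutoff d n) f) : S.Cc) : S.L2) = _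
          congr 1; ext x
          simp [mulCc_apply, Cc.coord_apply, cutoffCoord, smul_smul, mul_comm]
    have h2 : ∀ n, mulOp S (cutoffCoord n j) u = mulOp S (cutoff d n) v := fun n => by
      rw [← cutoffInv_mul_coordResFun, mulOp_mul, h, ← mulOp_mul, cutoffInv_mul_resFun]
    have h3 := (tendsto_mulOp_cutoff u).prodMk_nhds (tendsto_mulOp_cutoff v)
    refine (Submodule.isClosed_topologicalClosure _).mem_of_tendsto h3
      (Filter.Eventually.of_forall fun n => ?_)
    rw [← h2]
    exact h1 n u

/-- The closed graph defines an operator only if it is single-valued; this is the injectivity of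
multiplication by the nowhere vanishing function `(1 + |x|²)^{-1/2}`. -/
lemma mem_graph_position {j : Fin d} {u v : S.L2} :
    (u, v) ∈ (position S j).graph ↔ mulOp S (coordResFun j) u = mulOp S (resFun d) v := by
  rw [← mem_positionGraph_iff, position, Submodule.toLinearPMap_graph_eq]
  rintro ⟨u, v⟩ h (rfl : u = 0)
  rw [mem_positionGraph_iff, map_zero] at h
  exact mulOp_resFun_eq_zero h.symm

lemma position_apply_of_mem_graph {j : Fin d} {u v : S.L2} (h : (u, v) ∈ (position S j).graph)
    (hu : u ∈ (position S j).domain) : position S j ⟨u, hu⟩ = v :=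
  LinearPMap.mem_graph_snd_inj' _ ((position S j).mem_graph ⟨u, hu⟩) h rfl

end L2

end TwistedSystem

/-! ### Operators `T ⊗ m` on `L²(ℝᵈ, B) ⊗ ⋀^* ℝᵈ`. -/

namespace TwistedSystem

variable {𝕜 : Type v} {B : Type u} [RCLike 𝕜] [NonUnitalNormedRing B]
  [StarRing B] [CStarRing B] [CompleteSpace B] [NormedSpace ℝ B] [NormedSpace 𝕜 B]
  [IsScalarTower ℝ 𝕜 B] [IsScalarTower 𝕜 B B] [SMulCommClass 𝕜 B B] [StarModule 𝕜 B]
  [RealCStar B] {d : ℕ} {S : TwistedSystem 𝕜 B d}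

open RealCStar UniformSpace

section KOp

/-- The operator `T ⊗ m` on `L²(ℝᵈ, B) ⊗ ⋀^* ℝᵈ`. -/
noncomputable def kOp (T : S.L2 →L[𝕜] S.L2) (m : Module.End ℝ (ExtAlg d)) : S.KMod →ₗ[𝕜] S.KMod :=
  TensorProduct.AlgebraTensorModule.map T.toLinearMap m

@[simp] lemma kOp_tmul (T : S.L2 →L[𝕜] S.L2) (m : Module.End ℝ (ExtAlg d)) (ψ : S.L2)
    (ω : ExtAlg d) : kOp T m (ψ ⊗ₜ ω) = T ψ ⊗ₜ m ω := rfl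

lemma kMod_hom_ext {f g : S.KMod →ₗ[𝕜] S.KMod} (h : ∀ (ψ : S.L2) (ω : ExtAlg d),
    f (ψ ⊗ₜ ω) = g (ψ ⊗ₜ ω)) : f = g :=
  TensorProduct.AlgebraTensorModule.ext h

lemma kOp_add_left (T U : S.L2 →L[𝕜] S.L2) (m : Module.End ℝ (ExtAlg d)) :
    kOp (T + U) m = kOp T m + kOp U m :=
  kMod_hom_ext fun ψ ω => by simp [TensorProduct.add_tmul]

lemma kOp_add_right (T : S.L2 →L[𝕜] S.L2) (m n : Module.End ℝ (ExtAlg d)) :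
    kOp T (m + n) = kOp T m + kOp T n :=
  kMod_hom_ext fun ψ ω => by simp [TensorProduct.tmul_add]

lemma kOp_kOp (T U : S.L2 →L[𝕜] S.L2) (m n : Module.End ℝ (ExtAlg d)) (ξ : S.KMod) :
    kOp T m (kOp U n ξ) = kOp (T.comp U) (m * n) ξ := by
  have : kOp T m ∘ₗ kOp U n = kOp (T.comp U) (m * n) := kMod_hom_ext fun ψ ω => by simp
  exact congrFun (congrArg DFunLike.coe this) ξ

lemma kMod_inner_tmul (ψ φ : S.L2) (ω η : ExtAlg d) :
    S.kModData.inner (ψ ⊗ₜ ω) (φ ⊗ₜ η) = extInner ω η • L2.inner ψ φ := by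
  have := starModule_real 𝕜 B
  have h1 : ∀ (r : ℝ) (x y : S.L2), L2.inner x (r • y) = r • L2.inner x y := fun r x y => by
    rw [← algebraMap_smul 𝕜 r y, L2.inner_smul_right, algebraMap_smul]
  have h2 : ∀ (r : ℝ) (x y : S.L2), L2.inner (r • x) y = r • L2.inner x y := fun r x y => by
    rw [← L2.star_inner, h1, star_smul, L2.star_inner, star_trivial]
  rw [kMod_inner, extInner_apply, Finset.sum_smul]
  refine Finset.sum_congr rfl fun I _ => ?_
  rw [extCoord_tmul, extCoord_tmul, h1, h2, smul_smul, mul_comm]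

lemma isAdjoint_of_tmul {T T' : S.KMod → S.KMod} (hT : ∀ x y, T (x + y) = T x + T y)
    (hT' : ∀ x y, T' (x + y) = T' x + T' y)
    (h : ∀ (ψ φ : S.L2) (ω η : ExtAlg d), S.kModData.inner (T (ψ ⊗ₜ ω)) (φ ⊗ₜ η) =
      S.kModData.inner (ψ ⊗ₜ ω) (T' (φ ⊗ₜ η))) : S.kModData.IsAdjoint T T' := by
  have hM := isHilbertModule_kModData S
  have hT0 : T 0 = 0 := by simpa using hT 0 0
  have hT0' : T' 0 = 0 := by simpa using hT' 0 0
  have hz : ∀ x, S.kModData.inner 0 x = 0 := fun x => by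
    rw [← hM.star_inner, hM.inner_zero, star_zero]
  intro x y
  induction x using TensorProduct.induction_on with
  | zero => rw [hT0, hz, hz]
  | tmul ψ ω =>
    induction y using TensorProduct.induction_on with
    | zero => rw [hT0', hM.inner_zero, hM.inner_zero]
    | tmul φ η => exact h ψ φ ω η
    | add x y hx hy => rw [hT', hM.inner_add, hM.inner_add, hx, hy]
  | add x y hx hy => rw [hT, hM.add_inner, hM.add_inner, hx, hy]

lemma isAdjoint_kOp {T T' : S.L2 →L[𝕜] S.L2} {m m' : Module.End ℝ (ExtAlg d)}
    (hT : ∀ ψ φ, L2.inner (T ψ) φ = L2.inner ψ (T' φ)) (hm : IsExtAdjoint m m') :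
    S.kModData.IsAdjoint (kOp T m) (kOp T' m') :=
  isAdjoint_of_tmul (map_add _) (map_add _) fun ψ φ ω η => by
    rw [kOp_tmul, kOp_tmul, kMod_inner_tmul, kMod_inner_tmul, hT, hm]

lemma isAdjoint_add {T T' U U' : S.KMod → S.KMod} (hT : S.kModData.IsAdjoint T T')
    (hU : S.kModData.IsAdjoint U U') :
    S.kModData.IsAdjoint (fun x => T x + U x) (fun x => T' x + U' x) := fun x y => by
  have hM := isHilbertModule_kModData S
  rw [hM.add_inner, hM.inner_add, hT, hU]

lemma isAdjoint_sum {ι : Type*} (s : Finset ι) {T T' : ι → S.KMod →ₗ[𝕜] S.KMod}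
    (h : ∀ i, S.kModData.IsAdjoint (T i) (T' i)) :
    S.kModData.IsAdjoint (∑ i ∈ s, T i : S.KMod →ₗ[𝕜] S.KMod)
      (∑ i ∈ s, T' i : S.KMod →ₗ[𝕜] S.KMod) := by
  have hM := isHilbertModule_kModData S
  classical
  induction s using Finset.induction_on with
  | empty =>
    intro x y
    simp only [Finset.sum_empty, LinearMap.zero_apply]
    rw [hM.inner_zero, ← hM.star_inner, hM.inner_zero, star_zero]
  | insert i s hi ih =>
    rw [Finset.sum_insert hi, Finset.sum_insert hi]
    exact isAdjoint_add (h i) ih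

lemma extCoord_kOp_one (T : S.L2 →L[𝕜] S.L2) (ξ : S.KMod) (I : Finset (Fin d)) :
    S.extCoord (kOp T 1 ξ) I = T (S.extCoord ξ I) :=
  extCoord_rTensor (T.toLinearMap.restrictScalars ℝ) ξ I

end KOp

/-! ### The operator `X`, its resolvent and its bounded transform. -/

section Dirac

variable (S) in
/-- The operator `(1 + X²)^{-1/2}`. -/
noncomputable def diracRes : S.KMod →ₗ[𝕜] S.KMod := kOp (L2.mulOp S (resFun d)) 1

variable (S) in
/-- The operator `X (1 + X²)^{-1/2}`. -/
noncomputable def diracBdd : S.KMod →ₗ[𝕜] S.KMod :=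
  ∑ j, kOp (L2.mulOp S (coordResFun j)) (extGamma j)

lemma diracRes_tmul (ψ : S.L2) (ω : ExtAlg d) :
    diracRes S (ψ ⊗ₜ ω) = L2.mulOp S (resFun d) ψ ⊗ₜ ω := rfl

lemma diracBdd_tmul (ψ : S.L2) (ω : ExtAlg d) :
    diracBdd S (ψ ⊗ₜ ω) = ∑ j, L2.mulOp S (coordResFun j) ψ ⊗ₜ extGamma j ω := by
  simp [diracBdd]

variable (S) in
lemma isAdjoint_diracRes : S.kModData.IsAdjoint (diracRes S) (diracRes S) :=
  isAdjoint_kOp (L2.inner_mulOp _) fun _ _ => rfl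

variable (S) in
lemma isAdjoint_diracBdd : S.kModData.IsAdjoint (diracBdd S) (diracBdd S) :=
  isAdjoint_sum _ fun j => isAdjoint_kOp (L2.inner_mulOp _) (isExtAdjoint_extGamma j)

lemma diracBdd_diracRes (ξ : S.KMod) :
    diracBdd S (diracRes S ξ) = diracRes S (diracBdd S ξ) := by
  have : diracBdd S ∘ₗ diracRes S = diracRes S ∘ₗ diracBdd S := kMod_hom_ext fun ψ ω => by
    simp only [LinearMap.comp_apply, diracRes_tmul, diracBdd_tmul, map_sum]
    exact Finset.sum_congr rfl fun j _ => by rw [L2.mulOp_comm]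
  exact congrFun (congrArg DFunLike.coe this) ξ

/-- The Clifford relations reduce `F²` to multiplication by `∑ x_j² / (1 + |x|²)`, which adds up to
`1` with `1 / (1 + |x|²)`. -/
lemma diracBdd_sq_add (ξ : S.KMod) :
    diracBdd S (diracBdd S ξ) + diracRes S (diracRes S ξ) = ξ := by
  have h2 : ∀ (ψ : S.L2) (ω : ExtAlg d), diracBdd S (diracBdd S (ψ ⊗ₜ ω)) =
      ∑ j, L2.mulOp S (coordResFun j * coordResFun j) ψ ⊗ₜ[ℝ] ω := fun ψ ω => by
    have e1 : diracBdd S (diracBdd S (ψ ⊗ₜ ω)) = ∑ j, ∑ k,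
        L2.mulOp S (coordResFun j * coordResFun k) ψ ⊗ₜ[ℝ] (extGamma j * extGamma k) ω := by
      simp only [diracBdd_tmul, map_sum]
      rw [Finset.sum_comm]
      exact Finset.sum_congr rfl fun j _ => Finset.sum_congr rfl fun k _ => by
        rw [L2.mulOp_mul]; rfl
    -- The coefficient functions are symmetric in `j` and `k`, so adding this expansion to the
    -- previous one produces anticommutators of the `γ`'s, at the cost of a factor `2`.
    have e2 : diracBdd S (diracBdd S (ψ ⊗ₜ ω)) = ∑ j, ∑ k,
        L2.mulOp S (coordResFun j * coordResFun k) ψ ⊗ₜ[ℝ] (extGamma k * extGamma j) ω := by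
      rw [e1, Finset.sum_comm]
      exact Finset.sum_congr rfl fun j _ => Finset.sum_congr rfl fun k _ => by rw [mul_comm]
    have e3 : (2 : ℝ) • diracBdd S (diracBdd S (ψ ⊗ₜ ω)) =
        (2 : ℝ) • ∑ j, L2.mulOp S (coordResFun j * coordResFun j) ψ ⊗ₜ[ℝ] ω := by
      conv_lhs => rw [two_smul]; arg 1; rw [e1]
      conv_lhs => arg 2; rw [e2]
      rw [← Finset.sum_add_distrib, Finset.smul_sum]
      refine Finset.sum_congr rfl fun j _ => ?_
      rw [← Finset.sum_add_distrib, Finset.sum_eq_single j]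
      · rw [← TensorProduct.tmul_add, ← LinearMap.add_apply, extGamma_mul_add, if_pos rfl,
          ← TensorProduct.tmul_smul]
        congr 1
      · intro k _ hk
        rw [← TensorProduct.tmul_add, ← LinearMap.add_apply, extGamma_mul_add, if_neg hk.symm]
        simp
      · simp
    exact smul_right_injective _ (two_ne_zero (α := ℝ)) e3
  have : diracBdd S ∘ₗ diracBdd S + diracRes S ∘ₗ diracRes S = LinearMap.id :=
    kMod_hom_ext fun ψ ω => by
      simp only [LinearMap.add_apply, LinearMap.comp_apply, h2, diracRes_tmul, LinearMap.id_apply]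
      rw [← TensorProduct.sum_tmul, ← TensorProduct.add_tmul, ← L2.mulOp_mul]
      have h3 : ∀ s : Finset (Fin d), ∑ j ∈ s, L2.mulOp S (coordResFun j * coordResFun j) ψ =
          L2.mulOp S (∑ j ∈ s, coordResFun j * coordResFun j) ψ := fun s => by
        classical
        induction s using Finset.induction_on with
        | empty =>
          have h0 : L2.mulOp S 0 ψ = 0 := by simpa using L2.mulOp_add (S := S) 0 0 ψ
          rw [Finset.sum_empty, Finset.sum_empty, h0]
        | insert i s hi ih => rw [Finset.sum_insert hi, Finset.sum_insert hi, L2.mulOp_add, ih]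
      rw [h3, ← L2.mulOp_add, sum_coordResFun_sq, L2.mulOp_one]
  exact congrFun (congrArg DFunLike.coe this) ξ

lemma diracRes_eq_zero {ξ : S.KMod} (h : diracRes S ξ = 0) : ξ = 0 := by
  refine kMod_ext fun I => ?_
  have h1 := extCoord_kOp_one (L2.mulOp S (resFun d)) ξ I
  rw [← diracRes, h, map_zero, Finsupp.zero_apply] at h1
  rw [map_zero, Finsupp.zero_apply]
  exact L2.mulOp_resFun_eq_zero h1.symm

/-- The graph is a purely algebraic span, yet it is already closed: a solution of `F ξ = R η` equals
`(R ζ, F ζ)` for `ζ = R ξ + F η`, and for an elementary tensor `ζ` such a pair is a generator of the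
span. -/
lemma mem_graph_diracX {ξ η : S.KMod} :
    (ξ, η) ∈ (S.diracX).graph ↔ diracBdd S ξ = diracRes S η := by
  set G := Submodule.span 𝕜 {p : S.KMod × S.KMod | ∃ (ψ : S.L2)
    (hψ : ∀ j, ψ ∈ (L2.position S j).domain) (ω : ExtAlg d),
      p = (ψ ⊗ₜ ω, ∑ j, L2.position S j ⟨ψ, hψ j⟩ ⊗ₜ extGamma j ω)} with hG
  have h1 : ∀ p ∈ G, diracBdd S p.1 = diracRes S p.2 := by
    intro p hp
    induction hp using Submodule.span_induction with
    | mem p hp =>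
      obtain ⟨ψ, hψ, ω, rfl⟩ := hp
      simp only [diracBdd_tmul, map_sum, diracRes_tmul]
      exact Finset.sum_congr rfl fun j _ => by
        rw [L2.mem_graph_position.1 ((L2.position S j).mem_graph ⟨ψ, hψ j⟩)]
    | zero => simp
    | add p q _ _ hp hq => simp [hp, hq]
    | smul k p _ hp => simp [hp]
  have h2 : ∀ ζ, (diracRes S ζ, diracBdd S ζ) ∈ G := by
    intro ζ
    induction ζ using TensorProduct.induction_on with
    | zero => rw [map_zero, map_zero]; exact G.zero_mem
    | tmul ψ ω =>
      have h3 : ∀ j, (L2.mulOp S (resFun d) ψ, L2.mulOp S (coordResFun j) ψ) ∈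
          (L2.position S j).graph := fun j => by rw [L2.mem_graph_position, L2.mulOp_comm]
      refine Submodule.subset_span ⟨L2.mulOp S (resFun d) ψ,
        fun j => LinearPMap.mem_domain_of_mem_graph (h3 j), ω, ?_⟩
      rw [diracRes_tmul, diracBdd_tmul]
      congr 1
      exact Finset.sum_congr rfl fun j _ => by rw [L2.position_apply_of_mem_graph (h3 j)]
    | add x y hx hy => rw [map_add, map_add]; exact G.add_mem hx hy
  -- The span is the graph of the operator only once it is known to be single-valued, which is the
  -- injectivity of `R`.
  have h3 : S.diracX.graph = G := by
    refine Submodule.toLinearPMap_graph_eq G ?_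
    rintro ⟨x, y⟩ h (rfl : x = 0)
    have h4 := h1 _ h
    rw [map_zero] at h4
    exact diracRes_eq_zero h4.symm
  rw [h3]
  refine ⟨h1 _, fun h => ?_⟩
  have e1 : ξ = diracRes S (diracRes S ξ + diracBdd S η) := by
    rw [map_add, ← diracBdd_diracRes, ← h, add_comm, diracBdd_sq_add]
  have e2 : η = diracBdd S (diracRes S ξ + diracBdd S η) := by
    rw [map_add, diracBdd_diracRes, h, add_comm, diracBdd_sq_add]
  rw [show (ξ, η) = (diracRes S (diracRes S ξ + diracBdd S η),
    diracBdd S (diracRes S ξ + diracBdd S η)) from Prod.ext e1 e2]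
  exact h2 _

variable (S) in
lemma diracX_isSelfAdjointRegular : S.kModData.IsSelfAdjointRegular S.diracX := by
  refine (isHilbertModule_kModData S).isSelfAdjointRegular (isAdjoint_diracBdd S)
    (isAdjoint_diracRes S) diracBdd_diracRes diracBdd_sq_add (fun _ _ => mem_graph_diracX) ?_
  intro ξ ε hε
  have h2 : Filter.Tendsto (fun n => ∑ I, ‖S.extCoord ξ I - L2.mulOp S (cutoff d n)
      (S.extCoord ξ I)‖) Filter.atTop (𝓝 0) := by
    have h3 : ∀ u : S.L2, Filter.Tendsto (fun n => ‖u - L2.mulOp S (cutoff d n) u‖)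
        Filter.atTop (𝓝 0) := fun u => by
      have := ((L2.tendsto_mulOp_cutoff u).const_sub u).norm
      rwa [sub_self, norm_zero] at this
    have := tendsto_finsetSum (Finset.univ : Finset (Finset (Fin d)))
      fun I _ => h3 (S.extCoord ξ I)
    rwa [Finset.sum_const_zero] at this
  obtain ⟨N, hN⟩ := (h2.eventually (gt_mem_nhds hε)).exists
  -- The operator `R` sends this vector to `χ_N ξ`, which shows that the range of `R` is dense.
  refine ⟨kOp (L2.mulOp S (cutoffInv d N)) 1 ξ, lt_of_le_of_lt (kMod_norm_le _) ?_⟩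
  have h3 : ∀ I, S.extCoord (ξ - diracRes S (kOp (L2.mulOp S (cutoffInv d N)) 1 ξ)) I =
      S.extCoord ξ I - L2.mulOp S (cutoff d N) (S.extCoord ξ I) := fun I => by
    rw [map_sub, Finsupp.sub_apply, diracRes, extCoord_kOp_one, extCoord_kOp_one, ← L2.mulOp_mul,
      mul_comm, cutoffInv_mul_resFun]
  rw [Finset.sum_congr rfl fun I _ => congrArg norm (h3 I)]
  exact hN

variable (S) in
-- Positivity of `(1 + X²)^{-1/2}` is exhibited by its square root, multiplication by `(1 +
-- |x|²)^{-1/4}`.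
lemma diracX_isInvSqrt : S.kModData.IsInvSqrt S.diracX (diracRes S) := by
  have h1 : IsExtAdjoint (1 : Module.End ℝ (ExtAlg d)) 1 := fun _ _ => rfl
  refine HilbertModuleData.isInvSqrt (isAdjoint_kOp (T := L2.mulOp S (sqrtResFun d))
    (L2.inner_mulOp _) h1) (fun ξ => ?_) diracBdd_diracRes diracBdd_sq_add
    fun _ _ => mem_graph_diracX
  have : (L2.mulOp S (sqrtResFun d)).comp (L2.mulOp S (sqrtResFun d)) = L2.mulOp S (resFun d) := by
    ext1 u
    rw [← sqrtResFun_mul_self, L2.mulOp_mul]; rfl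
  rw [kOp_kOp, this, mul_one]
  rfl

variable (S) in
lemma kModGrading_tmul (ψ : S.L2) (ω : ExtAlg d) :
    S.kModGrading (ψ ⊗ₜ ω) = ψ ⊗ₜ extGrading d ω := rfl

lemma kModGrading_kModGrading (ξ : S.KMod) : S.kModGrading (S.kModGrading ξ) = ξ := by
  induction ξ using TensorProduct.induction_on with
  | zero => simp
  | tmul ψ ω => rw [kModGrading_tmul, kModGrading_tmul, extGrading_extGrading]
  | add x y hx hy => rw [map_add, map_add, hx, hy]

lemma kModGrading_act (ξ : S.KMod) (b : B) :
    S.kModGrading (S.kModData.act ξ b) = S.kModData.act (S.kModGrading ξ) b := by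
  have hM := isHilbertModule_kModData S
  induction ξ using TensorProduct.induction_on with
  | zero =>
    have : S.kModData.act 0 b = 0 := by simpa using hM.add_act 0 0 b
    rw [this, map_zero, this]
  | tmul ψ ω => rfl
  | add x y hx hy => rw [hM.add_act, map_add, hx, hy, map_add, hM.add_act]

lemma inner_kModGrading (ξ η : S.KMod) :
    S.kModData.inner (S.kModGrading ξ) (S.kModGrading η) = S.kModData.inner ξ η := by
  have h : S.kModData.IsAdjoint S.kModGrading S.kModGrading :=
    isAdjoint_of_tmul (map_add _) (map_add _) fun ψ φ ω η => by
      rw [kModGrading_tmul, kModGrading_tmul, kMod_inner_tmul, kMod_inner_tmul,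
        isExtAdjoint_extGrading]
  rw [h, kModGrading_kModGrading]

lemma diracX_odd {ξ η : S.KMod} (h : (ξ, η) ∈ S.diracX.graph) :
    (S.kModGrading ξ, -S.kModGrading η) ∈ S.diracX.graph := by
  rw [mem_graph_diracX] at h ⊢
  have h1 : ∀ ξ, diracBdd S (S.kModGrading ξ) = -S.kModGrading (diracBdd S ξ) := fun ξ => by
    induction ξ using TensorProduct.induction_on with
    | zero => simp
    | tmul ψ ω =>
      rw [kModGrading_tmul, diracBdd_tmul, diracBdd_tmul, map_sum, ← Finset.sum_neg_distrib]
      exact Finset.sum_congr rfl fun j _ => by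
        rw [kModGrading_tmul, extGrading_extGamma, TensorProduct.tmul_neg, neg_neg]
    | add x y hx hy => rw [map_add, map_add, hx, hy, map_add, map_add, neg_add]
  have h2 : ∀ ξ, diracRes S (S.kModGrading ξ) = S.kModGrading (diracRes S ξ) := fun ξ => by
    induction ξ using TensorProduct.induction_on with
    | zero => simp
    | tmul ψ ω => rfl
    | add x y hx hy => rw [map_add, map_add, hx, hy, map_add, map_add]
  rw [h1, h, map_neg, h2]

end Dirac

end TwistedSystem

/-! ### The kernel of the twisted convolution. -/

namespace TwistedSystem

variable {𝕜 : Type v} {B : Type u} [RCLike 𝕜] [NonUnitalNormedRing B]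
  [StarRing B] [CStarRing B] [CompleteSpace B] [NormedSpace ℝ B] [NormedSpace 𝕜 B]
  [IsScalarTower ℝ 𝕜 B] [IsScalarTower 𝕜 B B] [SMulCommClass 𝕜 B B] [StarModule 𝕜 B]
  [RealCStar B] {d : ℕ} {S : TwistedSystem 𝕜 B d}

open RealCStar UniformSpace

namespace Cc

section Kernel

variable [S.IsNormalized]

/-- The kernel of the twisted convolution: `(f ∗ g)(x) = ∫ κ_f(x, y) g(x - y) dy`. -/
noncomputable def kernel (f : S.Cc) (x y : Fin d → ℝ) : B :=
  (S.θ (-x) y : 𝓜(𝕜, B)).fst (S.α (y - x) (f y))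

lemma convIntegrand_eq_kernel (f g : S.Cc) (x y : Fin d → ℝ) :
    convIntegrand f g x y = kernel f x y * g (x - y) := by
  rw [convIntegrand_eq, fst_mul, kernel]

lemma continuous_kernel (f : S.Cc) : Continuous (Function.uncurry (kernel f)) :=
  S.continuous_θ_fst_apply (by fun_prop) (by fun_prop)
    (S.continuous_α_apply (by fun_prop) (f.continuous.comp continuous_snd))

lemma continuous_kernel_comp (f : S.Cc) {X : Type*} [TopologicalSpace X] {s t : X → Fin d → ℝ}
    (hs : Continuous s) (ht : Continuous t) : Continuous fun p => kernel f (s p) (t p) :=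
  (continuous_kernel f).comp (hs.prodMk ht)

/-- The action is isometric and the twist is unitary. Independence of `x` is the source of the
`L¹`-bound for convolution operators. -/
lemma norm_kernel (f : S.Cc) (x y : Fin d → ℝ) : ‖kernel f x y‖ = ‖f y‖ := by
  rw [kernel, norm_θ_fst, StarAlgEquiv.norm_apply_eq]

lemma kernel_eq_zero {f : S.Cc} {y : Fin d → ℝ} (h : f y = 0) (x : Fin d → ℝ) :
    kernel f x y = 0 := by
  rw [← norm_eq_zero, norm_kernel, h, norm_zero]

lemma kernel_add (f g : S.Cc) (x y : Fin d → ℝ) :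
    kernel (f + g) x y = kernel f x y + kernel g x y := by
  simp [kernel]

lemma kernel_smul (k : 𝕜) (f : S.Cc) (x y : Fin d → ℝ) :
    kernel (k • f) x y = k • kernel f x y := by
  simp [kernel]

lemma kernel_real_smul (k : ℝ) (f : S.Cc) (x y : Fin d → ℝ) :
    kernel (k • f) x y = k • kernel f x y := by
  rw [← algebraMap_smul 𝕜 k f, kernel_smul, algebraMap_smul]

lemma kernel_coord (i : Fin d) (f : S.Cc) (x y : Fin d → ℝ) :
    kernel (coord i f) x y = y i • kernel f x y := by
  rw [← algebraMap_smul 𝕜 (y i), kernel, coord_apply, ← algebraMap_smul 𝕜 (y i) (f y), map_smul,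
    map_smul, kernel]

/-- The pointwise identity behind associativity holds with an arbitrary right factor `c`, which can
be cancelled. Kernels take values in `B`, so this formula and `star_kernel` survive any embedding of
`B` in a larger algebra. -/
lemma kernel_mul (f g : S.Cc) (x y : Fin d → ℝ) :
    kernel (f * g) x y = ∫ z, kernel f x z * kernel g (x - z) (y - z) := by
  have hT := ((S.θ (-x) y : 𝓜(𝕜, B)).fst.comp
    (StarAlgEquiv.toCLM (S.α (y - x)))).integral_comp_comm (integrable_convIntegrand f g y)
  rw [kernel, mul_apply']
  refine hT.symm.trans (integral_congr_ae (Filter.Eventually.of_forall fun z => ?_))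
  refine mul_left_ext fun c => ?_
  have h := S.assoc_aux x y z (f z) (g (y - z)) c
  simp only [ContinuousLinearMap.comp_apply, StarAlgEquiv.toCLM_apply, convIntegrand_eq]
  rw [← fst_mul, h, kernel, kernel, mul_assoc, ← fst_mul, ← fst_mul, neg_sub,
    show y - z - (x - z) = y - x by abel]

/-- Under the normalisation `star (θ(-x, y)) = θ(y - x, -y)`, which is the twist in the kernel of
`f^*` at `(x - y, -y)`. It makes convolution by `f^*` the adjoint of convolution by `f`. -/
lemma star_kernel (f : S.Cc) (x y : Fin d → ℝ) :
    star (kernel f x y) = kernel (star f) (x - y) (-y) := by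
  refine mul_left_ext fun c => ?_
  have h1 := (star (S.θ (-x) y : 𝓜(𝕜, B))).central (star (S.α (y - x) (f y))) c
  rw [DoubleCentralizer.star_snd, star_star, S.star_θ, show -x + y = y - x by abel] at h1
  rw [kernel, h1, kernel, star_apply, neg_neg, neg_sub, ← fst_mul,
    show -y - (x - y) = -x by abel, S.α_α_mul, S.star_θ, show -x + y = y - x by abel]
  have h2 := S.θ_fst_θ_fst (y - x) (-y)
  rw [show y - x + -y = -x by abel, neg_neg] at h2
  rw [h2, map_star]

end Kernel

/-! ### Convolution operators on functions with values in an algebra `C` containing `B`; of the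
system `S'` only its function space `C_c(ℝᵈ, C)` enters. -/

section Conv

variable {𝕂 : Type w} {C : Type u} [RCLike 𝕂] [NonUnitalNormedRing C]
  [StarRing C] [CStarRing C] [CompleteSpace C] [NormedSpace ℝ C] [NormedSpace 𝕂 C]
  [IsScalarTower ℝ 𝕂 C] [IsScalarTower 𝕂 C C] [SMulCommClass 𝕂 C C] [StarModule 𝕂 C]
  [RealCStar C] {S' : TwistedSystem 𝕂 C d} [S.IsNormalized] {j : B →⋆ₙ+* C} (hj : Isometry j)

include hj in
lemma norm_map_of_isometry (b : B) : ‖j b‖ = ‖b‖ := by simpa using hj.dist_eq b 0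

lemma continuous_convIntegrandMap (hj : Isometry j) (f : S.Cc) (ψ : S'.Cc) :
    Continuous fun p : (Fin d → ℝ) × (Fin d → ℝ) => j (kernel f p.1 p.2) * ψ (p.1 - p.2) :=
  (hj.continuous.comp (continuous_kernel f)).mul (ψ.continuous.comp (by fun_prop))

lemma integrable_convIntegrandMap (hj : Isometry j) (f : S.Cc) (ψ : S'.Cc) (x : Fin d → ℝ) :
    Integrable fun y => j (kernel f x y) * ψ (x - y) :=
  ((continuous_convIntegrandMap hj f ψ).comp
    (Continuous.prodMk_right x)).integrable_of_hasCompactSupport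
    (f.hasCompactSupport.mono fun y hy hf => hy (by simp [kernel_eq_zero hf]))

/-- The convolution operator `(Λ_f ψ)(x) = ∫ κ_f(x, y) ψ(x - y) dy` on `C_c(ℝᵈ, C)`, where `B` is
embedded in `C`. -/
noncomputable def convMap (hj : Isometry j) (f : S.Cc) (ψ : S'.Cc) : S'.Cc where
  toFun x := ∫ y, j (kernel f x y) * ψ (x - y)
  continuous_toFun := by
    have : (fun x => ∫ y, j (kernel f x y) * ψ (x - y)) =
        fun x => ∫ y in tsupport f, j (kernel f x y) * ψ (x - y) := funext fun x =>
      (setIntegral_eq_integral_of_forall_compl_eq_zero fun y hy => by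
        simp [kernel_eq_zero (image_eq_zero_of_notMem_tsupport hy)]).symm
    rw [this]
    exact continuous_parametric_integral_of_continuous (continuous_convIntegrandMap hj f ψ)
      f.hasCompactSupport
  hasCompactSupport' := by
    refine HasCompactSupport.intro (IsCompact.add f.hasCompactSupport ψ.hasCompactSupport)
      fun x hx => ?_
    rw [integral_eq_zero_of_ae]
    refine Filter.Eventually.of_forall fun y => ?_
    by_cases hy : y ∈ tsupport f
    · have : ψ (x - y) = 0 := image_eq_zero_of_notMem_tsupport fun h =>
        hx ⟨y, hy, x - y, h, by simp⟩
      simp [this]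
    · simp [kernel_eq_zero (image_eq_zero_of_notMem_tsupport hy)]

lemma convMap_apply (f : S.Cc) (ψ : S'.Cc) (x : Fin d → ℝ) :
    convMap hj f ψ x = ∫ y, j (kernel f x y) * ψ (x - y) := rfl

lemma convMap_add_left (f g : S.Cc) (ψ : S'.Cc) :
    convMap hj (f + g) ψ = convMap hj f ψ + convMap hj g ψ := by
  ext x
  rw [add_apply, convMap_apply, convMap_apply, convMap_apply, ← integral_add
    (integrable_convIntegrandMap hj f ψ x) (integrable_convIntegrandMap hj g ψ x)]
  simp [kernel_add, add_mul]

lemma convMap_add_right (f : S.Cc) (ψ χ : S'.Cc) :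
    convMap hj f (ψ + χ) = convMap hj f ψ + convMap hj f χ := by
  ext x
  rw [add_apply, convMap_apply, convMap_apply, convMap_apply, ← integral_add
    (integrable_convIntegrandMap hj f ψ x) (integrable_convIntegrandMap hj f χ x)]
  simp [mul_add]

lemma convMap_smul_right (k : 𝕂) (f : S.Cc) (ψ : S'.Cc) :
    convMap hj f (k • ψ) = k • convMap hj f ψ := by
  ext x
  rw [smul_apply, convMap_apply, convMap_apply, ← integral_smul]
  simp [mul_smul_comm]

lemma convMap_real_smul_left (k : ℝ) (f : S.Cc) (ψ : S'.Cc) :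
    convMap hj (k • f) ψ = k • convMap hj f ψ := by
  have := isScalarTower_real_self 𝕂 C
  ext x
  rw [real_smul_apply, convMap_apply, convMap_apply, ← integral_smul]
  have h : ∀ b, j (k • b) = k • j b := fun b => map_real_smul j hj.continuous k b
  simp [kernel_real_smul, h, smul_mul_assoc]

/-- Composition of kernels and Fubini, after a translation of the inner variable. -/
lemma convMap_mul (f g : S.Cc) (ψ : S'.Cc) :
    convMap hj (f * g) ψ = convMap hj f (convMap hj g ψ) := by
  ext x
  let J : B →L[ℝ] C := AddMonoidHom.toRealLinearMap
    { toFun := j, map_zero' := map_zero j, map_add' := map_add j } hj.continuous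
  have := isScalarTower_real_self 𝕂 C
  have := smulCommClass_real_self 𝕂 C
  have hc : Continuous fun p : (Fin d → ℝ) × (Fin d → ℝ) =>
      kernel f x p.2 * kernel g (x - p.2) (p.1 - p.2) :=
    (continuous_kernel_comp f continuous_const continuous_snd).mul
      (continuous_kernel_comp g (by fun_prop) (by fun_prop))
  have hL : ∀ y, j (kernel (f * g) x y) * ψ (x - y) =
      ∫ z, j (kernel f x z) * (j (kernel g (x - z) (y - z)) * ψ (x - y)) := fun y => by
    have hint : Integrable fun z => kernel f x z * kernel g (x - z) (y - z) :=
      (hc.comp (Continuous.prodMk_right y)).integrable_of_hasCompactSupport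
        (f.hasCompactSupport.mono fun z hz hf => hz (by simp [kernel_eq_zero hf]))
    have hT := (((ContinuousLinearMap.mul ℝ C).flip (ψ (x - y))).comp J).integral_comp_comm hint
    rw [kernel_mul]
    refine hT.symm.trans (integral_congr_ae (Filter.Eventually.of_forall fun z => ?_))
    change j (kernel f x z * kernel g (x - z) (y - z)) * ψ (x - y) = _
    rw [map_mul, mul_assoc]
  have hR : ∀ z, j (kernel f x z) * convMap hj g ψ (x - z) =
      ∫ y, j (kernel f x z) * (j (kernel g (x - z) (y - z)) * ψ (x - y)) := fun z => by
    have hT := (ContinuousLinearMap.mul ℝ C (j (kernel f x z))).integral_comp_comm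
      (integrable_convIntegrandMap hj g ψ (x - z))
    rw [convMap_apply]
    refine hT.symm.trans ?_
    rw [← integral_sub_right_eq_self _ z]
    refine integral_congr_ae (Filter.Eventually.of_forall fun y => ?_)
    simp only [ContinuousLinearMap.mul_apply']
    rw [show x - z - (y - z) = x - y by abel]
  rw [convMap_apply, convMap_apply]
  simp_rw [hL, hR]
  refine integral_integral_swap_of_hasCompactSupport ?_ ?_
  · exact (hj.continuous.comp (continuous_kernel_comp f continuous_const continuous_snd)).mul
      ((hj.continuous.comp (continuous_kernel_comp g (by fun_prop) (by fun_prop))).mul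
        (ψ.continuous.comp (by fun_prop)))
  · refine HasCompactSupport.intro ((IsCompact.add f.hasCompactSupport g.hasCompactSupport).prod
      f.hasCompactSupport) fun p hp => ?_
    by_cases h2 : p.2 ∈ tsupport f
    · have : g (p.1 - p.2) = 0 := image_eq_zero_of_notMem_tsupport fun h1 =>
        hp ⟨⟨p.2, h2, p.1 - p.2, h1, by simp⟩, h2⟩
      simp [Function.uncurry, kernel_eq_zero this]
    · simp [Function.uncurry, kernel_eq_zero (image_eq_zero_of_notMem_tsupport h2)]

lemma inner_convMap (f : S.Cc) (ψ χ : S'.Cc) :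
    inner (convMap hj f ψ) χ = inner ψ (convMap hj (star f) χ) := by
  have := isScalarTower_real_self 𝕂 C
  have := smulCommClass_real_self 𝕂 C
  have := starModule_real 𝕂 C
  have hL : ∀ x, star (convMap hj f ψ x) * χ x =
      ∫ y, star (ψ (x - y)) * (j (kernel (star f) (x - y) (-y)) * χ x) := fun x => by
    have hT := (((ContinuousLinearMap.mul ℝ C).flip (χ x)).comp
      ((starL' ℝ : C ≃L[ℝ] C) : C →L[ℝ] C)).integral_comp_comm
        (integrable_convIntegrandMap hj f ψ x)
    rw [convMap_apply]
    refine hT.symm.trans (integral_congr_ae (Filter.Eventually.of_forall fun y => ?_))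
    change star (j (kernel f x y) * ψ (x - y)) * χ x = _
    rw [star_mul, ← map_star j, star_kernel, mul_assoc]
  have hR : ∀ x, star (ψ x) * convMap hj (star f) χ x =
      ∫ y, star (ψ x) * (j (kernel (star f) x y) * χ (x - y)) := fun x => by
    have hT := (ContinuousLinearMap.mul ℝ C (star (ψ x))).integral_comp_comm
      (integrable_convIntegrandMap hj (star f) χ x)
    exact hT.symm
  rw [inner, inner]
  simp_rw [hL, hR]
  have hc : Continuous (Function.uncurry fun x y : Fin d → ℝ =>
      star (ψ (x - y)) * (j (kernel (star f) (x - y) (-y)) * χ x)) :=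
    (ψ.continuous.comp (by fun_prop)).star.mul ((hj.continuous.comp
      (continuous_kernel_comp (star f) (by fun_prop) (by fun_prop))).mul
        (χ.continuous.comp (by fun_prop)))
  have hc' : Continuous (Function.uncurry fun x y : Fin d → ℝ =>
      star (ψ x) * (j (kernel (star f) x y) * χ (x - y))) :=
    (ψ.continuous.comp (by fun_prop)).star.mul ((hj.continuous.comp
      (continuous_kernel_comp (star f) (by fun_prop) (by fun_prop))).mul
        (χ.continuous.comp (by fun_prop)))
  rw [integral_integral_swap_of_hasCompactSupport hc]
  · rw [integral_integral_swap_of_hasCompactSupport hc']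
    -- The kernel of `f^*` appears at `(x - y, -y)`; replacing `y` by `-y` and then translating `x`
    -- by `y` brings it to `(x, y)`.
    · rw [← integral_neg_eq_self]
      refine integral_congr_ae (Filter.Eventually.of_forall fun y => ?_)
      simp only [sub_neg_eq_add, neg_neg]
      rw [← integral_sub_right_eq_self _ y]
      simp
    · refine HasCompactSupport.intro (ψ.hasCompactSupport.prod
        (star f).hasCompactSupport) fun p hp => ?_
      by_cases h2 : p.1 ∈ tsupport ψ
      · have : (star f) p.2 = 0 := image_eq_zero_of_notMem_tsupport fun h1 => hp ⟨h2, h1⟩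
        simp [Function.uncurry, kernel_eq_zero this]
      · simp [Function.uncurry, image_eq_zero_of_notMem_tsupport h2]
  · refine HasCompactSupport.intro (χ.hasCompactSupport.prod
      (star f).hasCompactSupport.isCompact.neg) fun p hp => ?_
    by_cases h2 : p.1 ∈ tsupport χ
    · have : (star f) (-p.2) = 0 := image_eq_zero_of_notMem_tsupport fun h1 => hp ⟨h2, h1⟩
      simp [Function.uncurry, kernel_eq_zero this]
    · simp [Function.uncurry, image_eq_zero_of_notMem_tsupport h2]

/-- The function `x ↦ κ_f(x, y) ψ(x - y)`. -/
noncomputable def convSlice (hj : Isometry j) (f : S.Cc) (ψ : S'.Cc) (y : Fin d → ℝ) : S'.Cc where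
  toFun x := j (kernel f x y) * ψ (x - y)
  continuous_toFun := (continuous_convIntegrandMap hj f ψ).comp (Continuous.prodMk_left y)
  hasCompactSupport' := by
    have h : HasCompactSupport fun x => ψ (x - y) :=
      ψ.hasCompactSupport.comp_homeomorph (Homeomorph.subRight y)
    exact h.mono fun x hx h' => hx (by simp [h'])

/-- Pointwise `(κ ψ)^* (κ ψ) ≤ ‖κ‖² ψ^* ψ` in the envelope, and `‖κ_f(x, y)‖ = ‖f(y)‖` does not
depend on `x`. -/
lemma norm_convSlice_le (f : S.Cc) (ψ : S'.Cc) (y : Fin d → ℝ) :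
    ‖convSlice hj f ψ y‖ ≤ ‖f y‖ * ‖ψ‖ := by
  refine norm_le_of_star_mul_self_le (_root_.norm_nonneg _) y fun x => ?_
  change star (emb C (j (kernel f x y) * ψ (x - y))) * emb C (j (kernel f x y) * ψ (x - y)) ≤ _
  set a := emb C (j (kernel f x y)) with ha
  have e : star (emb C (j (kernel f x y) * ψ (x - y))) * emb C (j (kernel f x y) * ψ (x - y)) =
      star (emb C (ψ (x - y))) * (star a * a) * emb C (ψ (x - y)) := by
    rw [map_mul, star_mul, ha]; noncomm_ring
  have hn : ‖star a * a‖ = ‖f y‖ ^ 2 := by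
    rw [CStarRing.norm_star_mul_self, ha, norm_emb, norm_map_of_isometry hj, norm_kernel, pow_two]
  rw [e, ← hn]
  exact CStarAlgebra.star_left_conjugate_le_norm_smul (.star_mul_self a)

/-- Minkowski's inequality in weak form: for `χ = Λ_f ψ`, Fubini writes `(χ | χ)` as the integral
over `y` of `(χ | slice_y)`. Cauchy–Schwarz bounds it by `‖χ‖ ∫ ‖f‖ ‖ψ‖`, and one factor `‖χ‖`
cancels. -/
lemma norm_convMap_le (f : S.Cc) (ψ : S'.Cc) :
    ‖convMap hj f ψ‖ ≤ (∫ x, ‖f x‖) * ‖ψ‖ := by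
  have := isScalarTower_real_self 𝕂 C
  have := smulCommClass_real_self 𝕂 C
  set χ := convMap hj f ψ with hχ
  have h1 : inner χ χ = ∫ y, inner χ (convSlice hj f ψ y) := by
    have hR : ∀ x, star (χ x) * χ x = ∫ y, star (χ x) * (j (kernel f x y) * ψ (x - y)) := 
      fun x => ((ContinuousLinearMap.mul ℝ C (star (χ x))).integral_comp_comm
        (integrable_convIntegrandMap hj f ψ x)).symm
    rw [inner]
    simp_rw [hR]
    refine integral_integral_swap_of_hasCompactSupport ?_ ?_
    · exact (χ.continuous.comp (by fun_prop)).star.mul (continuous_convIntegrandMap hj f ψ)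
    · refine HasCompactSupport.intro (χ.hasCompactSupport.prod f.hasCompactSupport) fun p hp => ?_
      by_cases h2 : p.1 ∈ tsupport χ
      · have : f p.2 = 0 := image_eq_zero_of_notMem_tsupport fun h1 => hp ⟨h2, h1⟩
        simp [Function.uncurry, kernel_eq_zero this]
      · simp [Function.uncurry, image_eq_zero_of_notMem_tsupport h2]
  have hfi : Integrable fun y => ‖f y‖ :=
    (f.continuous.integrable_of_hasCompactSupport f.hasCompactSupport).norm
  have h2 : ‖inner χ χ‖ ≤ ‖χ‖ * ((∫ x, ‖f x‖) * ‖ψ‖) := by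
    rw [h1]
    refine (norm_integral_le_of_norm_le ((hfi.mul_const ‖ψ‖).const_mul ‖χ‖)
      (Filter.Eventually.of_forall fun y => (norm_inner_le _ _).trans ?_)).trans_eq ?_
    · gcongr; exact norm_convSlice_le hj f ψ y
    · rw [integral_const_mul, integral_mul_const]
  rw [← norm_sq, pow_two] at h2
  rcases (_root_.norm_nonneg χ).eq_or_lt with h | h
  · rw [← h]
    exact mul_nonneg (integral_nonneg fun x => _root_.norm_nonneg _) (_root_.norm_nonneg _)
  · exact le_of_mul_le_mul_left h2 h

/-- Split `x_i = y_i + (x - y)_i` under the integral. This is why convolution by `f` has bounded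
commutator with `X_i`. -/
lemma coord_convMap (i : Fin d) (f : S.Cc) (ψ : S'.Cc) : coord i (convMap hj f ψ) =
    convMap hj (coord i f) ψ + convMap hj f (coord i ψ) := by
  have := isScalarTower_real_self 𝕂 C
  have := smulCommClass_real_self 𝕂 C
  have h : ∀ (k : ℝ) b, j (k • b) = k • j b := fun k b => map_real_smul j hj.continuous k b
  ext x
  rw [add_apply, coord_apply, convMap_apply, convMap_apply, convMap_apply, ← integral_add
    (integrable_convIntegrandMap hj _ ψ x) (integrable_convIntegrandMap hj f _ x), ← integral_smul]
  refine integral_congr_ae (Filter.Eventually.of_forall fun y => ?_)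
  simp only [kernel_coord, h, coord_apply, smul_mul_assoc, mul_smul_comm, ← add_smul]
  simp

/-- The map `C_c(ℝᵈ, B) → C_c(ℝᵈ, C)` induced by an embedding `B → C`. -/
noncomputable def mapCc (S' : TwistedSystem 𝕂 C d) (hj : Isometry j) (ψ : S.Cc) : S'.Cc where
  toFun x := j (ψ x)
  continuous_toFun := hj.continuous.comp ψ.continuous
  hasCompactSupport' := ψ.hasCompactSupport.mono fun x hx h => hx (by simp [h])

omit [S.IsNormalized] in
lemma mapCc_apply (ψ : S.Cc) (x : Fin d → ℝ) : mapCc S' hj ψ x = j (ψ x) := rfl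

omit [S.IsNormalized] in
lemma inner_mapCc (ψ χ : S.Cc) : inner (mapCc S' hj ψ) (mapCc S' hj χ) = j (inner ψ χ) := by
  let J : B →L[ℝ] C := AddMonoidHom.toRealLinearMap
    { toFun := j, map_zero' := map_zero j, map_add' := map_add j } hj.continuous
  refine Eq.trans ?_ (J.integral_comp_comm (integrable_inner ψ χ))
  refine integral_congr_ae (Filter.Eventually.of_forall fun x => ?_)
  change star (j (ψ x)) * j (χ x) = j (star (ψ x) * χ x)
  rw [map_mul, map_star]

omit [S.IsNormalized] in
lemma norm_mapCc (ψ : S.Cc) : ‖mapCc S' hj ψ‖ = ‖ψ‖ := by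
  rw [norm_def, norm_def, inner_mapCc, norm_map_of_isometry hj]

lemma convMap_mapCc (f ψ : S.Cc) : convMap hj f (mapCc S' hj ψ) = mapCc S' hj (f * ψ) := by
  let J : B →L[ℝ] C := AddMonoidHom.toRealLinearMap
    { toFun := j, map_zero' := map_zero j, map_add' := map_add j } hj.continuous
  ext x
  refine Eq.trans ?_ (J.integral_comp_comm (integrable_convIntegrand f ψ x))
  refine integral_congr_ae (Filter.Eventually.of_forall fun y => ?_)
  change j (kernel f x y) * j (ψ (x - y)) = j (convIntegrand f ψ x y)
  rw [convIntegrand_eq_kernel, map_mul]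

lemma isometry_starRingHom_id : Isometry (NonUnitalStarRingHom.id B) := isometry_id

lemma convMap_id (f ψ : S.Cc) : convMap (S' := S) isometry_starRingHom_id f ψ = f * ψ := by
  ext x
  rw [convMap_apply, mul_apply']
  simp_rw [convIntegrand_eq_kernel]
  rfl

/-- Evaluating `f ∗ (φ c)` at the origin shows that `κ_f(0, ·)` vanishes against all test functions,
and `‖κ_f(0, y)‖ = ‖f(y)‖`. -/
lemma eq_zero_of_forall_mul_eq_zero {f : S.Cc} (h : ∀ ψ : S.Cc, f * ψ = 0) : f = 0 := by
  have := smulCommClass_real_self 𝕜 B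
  have := isScalarTower_real_self 𝕜 B
  ext y
  have h1 : (fun z => kernel f 0 (-z)) = 0 := by
    refine eq_zero_of_forall_integral_smul
      (continuous_kernel_comp f continuous_const continuous_neg) fun φ hφ hφc => ?_
    refine mul_left_ext fun c => ?_
    have h2 := congrArg (fun u : S.Cc => u 0) (h (single S φ hφ hφc c))
    simp only [mul_apply', convIntegrand_eq_kernel, zero_apply, single_apply] at h2
    rw [← integral_neg_eq_self] at h2
    have hint : Integrable fun z => φ z • kernel f 0 (-z) :=
      (hφ.smul (continuous_kernel_comp f continuous_const
        continuous_neg)).integrable_of_hasCompactSupport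
          (hφc.mono fun x hx h => hx (by simp [h]))
    have e := ((ContinuousLinearMap.mul ℝ B).flip c).integral_comp_comm hint
    rw [zero_mul]
    refine e.symm.trans (Eq.trans ?_ h2)
    refine integral_congr_ae (Filter.Eventually.of_forall fun z => ?_)
    simp [mul_smul_comm]
  have h2 := congrFun h1 (-y)
  simp only [neg_neg, Pi.zero_apply] at h2
  rw [zero_apply, ← norm_eq_zero, ← norm_kernel f 0, h2, norm_zero]

end Conv

end Cc

end TwistedSystem

/-! ### Norm bounds, convolution on `L²`, and the graded commutator with `X`. -/

namespace TwistedSystem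

variable {𝕜 : Type v} {B : Type u} [RCLike 𝕜] [NonUnitalNormedRing B]
  [StarRing B] [CStarRing B] [CompleteSpace B] [NormedSpace ℝ B] [NormedSpace 𝕜 B]
  [IsScalarTower ℝ 𝕜 B] [IsScalarTower 𝕜 B B] [SMulCommClass 𝕜 B B] [StarModule 𝕜 B]
  [RealCStar B] {d : ℕ} {S : TwistedSystem 𝕜 B d}

open RealCStar UniformSpace

lemma extCoord_kOp (T : S.L2 →L[𝕜] S.L2) (m : Module.End ℝ (ExtAlg d)) (ξ : S.KMod)
    (I : Finset (Fin d)) : S.extCoord (kOp T m ξ) I =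
      ∑ J, (extBasis d).repr (m (extBasis d J)) I • T (S.extCoord ξ J) := by
  induction ξ using TensorProduct.induction_on with
  | zero => simp
  | tmul ψ ω =>
    rw [kOp_tmul, extCoord_tmul]
    conv_lhs => rw [← (extBasis d).sum_repr ω]
    simp only [map_sum, map_smul, Finsupp.coe_finsetSum, Finset.sum_apply, Finsupp.smul_apply,
      Finset.sum_smul, extCoord_tmul]
    refine Finset.sum_congr rfl fun J _ => ?_
    have := ((T : S.L2 →ₗ[𝕜] S.L2).restrictScalars ℝ).map_smul ((extBasis d).repr ω J) ψ
    rw [smul_eq_mul, mul_comm, mul_smul]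
    exact congrArg _ this.symm
  | add x y hx hy =>
    rw [map_add, extCoord_add, hx, hy, ← Finset.sum_add_distrib]
    simp

/-- The constant is the sum of the absolute values of the matrix entries of `m`. That it does not
depend on `T` matters for norm limits in `T` and for the removal of `K` by taking powers. -/
lemma exists_norm_kOp_le (m : Module.End ℝ (ExtAlg d)) : ∃ K : ℝ, 0 ≤ K ∧
    ∀ (T : S.L2 →L[𝕜] S.L2) (ξ : S.KMod),
      S.kModData.norm (kOp T m ξ) ≤ K * ‖T‖ * S.kModData.norm ξ := by
  refine ⟨∑ I, ∑ J, |(extBasis d).repr (m (extBasis d J)) I|, by positivity, fun T ξ => ?_⟩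
  refine (kMod_norm_le _).trans ?_
  rw [Finset.sum_mul, Finset.sum_mul]
  refine Finset.sum_le_sum fun I _ => ?_
  rw [extCoord_kOp, Finset.sum_mul, Finset.sum_mul]
  refine (norm_sum_le _ _).trans (Finset.sum_le_sum fun J _ => ?_)
  rw [norm_smul, Real.norm_eq_abs, mul_assoc]
  refine mul_le_mul_of_nonneg_left ((T.le_opNorm _).trans ?_) (abs_nonneg _)
  exact mul_le_mul_of_nonneg_left (norm_extCoord_le ξ J) (norm_nonneg _)

section MapL2

variable {𝕂 : Type w} {C : Type u} [RCLike 𝕂] [NonUnitalNormedRing C]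
  [StarRing C] [CStarRing C] [CompleteSpace C] [NormedSpace ℝ C] [NormedSpace 𝕂 C]
  [IsScalarTower ℝ 𝕂 C] [IsScalarTower 𝕂 C C] [SMulCommClass 𝕂 C C] [StarModule 𝕂 C]
  [RealCStar C] {S' : TwistedSystem 𝕂 C d} {j : B →⋆ₙ+* C} (hj : Isometry j)

namespace L2

variable (S') in
/-- The embedding of `L²(ℝᵈ, B)` in `L²(ℝᵈ, C)`. -/
noncomputable def mapL2 (hj : Isometry j) : S.L2 →L[ℝ] S'.L2 :=
  ContinuousLinearMap.completion (LinearMap.mkContinuous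
    { toFun := Cc.mapCc S' hj
      map_add' := fun ψ χ => by ext x; simp [Cc.mapCc_apply]
      map_smul' := fun k ψ => by
        ext x
        exact map_real_smul j hj.continuous k (ψ x) } 1
    (fun ψ => by rw [one_mul]; exact (Cc.norm_mapCc hj ψ).le))

@[simp] lemma mapL2_coe (ψ : S.Cc) : mapL2 S' hj (ψ : S.L2) = (Cc.mapCc S' hj ψ : S'.Cc) :=
  ContinuousLinearMap.completion_apply_coe _ _

lemma inner_mapL2 (u v : S.L2) :
    L2.inner (mapL2 S' hj u) (mapL2 S' hj v) = j (L2.inner u v) := by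
  induction u, v using Completion.induction_on₂ with
  | hp =>
    exact isClosed_eq (continuous_inner (by fun_prop) (by fun_prop))
      (hj.continuous.comp (continuous_inner (by fun_prop) (by fun_prop)))
  | ih ψ χ => simp [Cc.inner_mapCc]

end L2

end MapL2

section ConvOp

variable {𝕂 : Type w} {C : Type u} [RCLike 𝕂] [NonUnitalNormedRing C]
  [StarRing C] [CStarRing C] [CompleteSpace C] [NormedSpace ℝ C] [NormedSpace 𝕂 C]
  [IsScalarTower ℝ 𝕂 C] [IsScalarTower 𝕂 C C] [SMulCommClass 𝕂 C C] [StarModule 𝕂 C]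
  [RealCStar C] {S' : TwistedSystem 𝕂 C d} [S.IsNormalized] {j : B →⋆ₙ+* C} (hj : Isometry j)

namespace L2

variable (S') in
/-- The convolution operator on `L²(ℝᵈ, C)`, where `B` is embedded in `C`. -/
noncomputable def convOp (hj : Isometry j) (f : S.Cc) : S'.L2 →L[𝕂] S'.L2 :=
  ContinuousLinearMap.completion (LinearMap.mkContinuous
    { toFun := Cc.convMap hj f
      map_add' := Cc.convMap_add_right hj f
      map_smul' := fun k ψ => Cc.convMap_smul_right hj k f ψ } (∫ x, ‖f x‖)
    (Cc.norm_convMap_le hj f))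

@[simp] lemma convOp_coe (f : S.Cc) (ψ : S'.Cc) :
    convOp S' hj f (ψ : S'.L2) = (Cc.convMap hj f ψ : S'.Cc) :=
  ContinuousLinearMap.completion_apply_coe _ _

lemma norm_convOp_le (f : S.Cc) : ‖convOp S' hj f‖ ≤ ∫ x, ‖f x‖ := by
  refine ContinuousLinearMap.opNorm_le_bound _ (integral_nonneg fun x => norm_nonneg _) fun u => ?_
  induction u using Completion.induction_on with
  | hp => exact isClosed_le (by fun_prop) (by fun_prop)
  | ih ψ => rw [convOp_coe, Completion.norm_coe, Completion.norm_coe]; exact Cc.norm_convMap_le hj f ψ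

lemma convOp_mul (f g : S.Cc) :
    convOp S' hj (f * g) = (convOp S' hj f).comp (convOp S' hj g) := by
  ext u
  induction u using Completion.induction_on with
  | hp => exact isClosed_eq (by fun_prop) (by fun_prop)
  | ih ψ => simp [Cc.convMap_mul]

lemma convOp_add (f g : S.Cc) : convOp S' hj (f + g) = convOp S' hj f + convOp S' hj g := by
  ext u
  induction u using Completion.induction_on with
  | hp => exact isClosed_eq (by fun_prop) (by fun_prop)
  | ih ψ =>
    rw [add_apply, convOp_coe, convOp_coe, convOp_coe, Cc.convMap_add_left,
      Completion.coe_add]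

lemma convOp_real_smul (k : ℝ) (f : S.Cc) (u : S'.L2) :
    convOp S' hj (k • f) u = k • convOp S' hj f u := by
  induction u using Completion.induction_on with
  | hp => exact isClosed_eq (by fun_prop) ((convOp S' hj f).continuous.const_smul k)
  | ih ψ => rw [convOp_coe, convOp_coe, Cc.convMap_real_smul_left, Completion.coe_smul]

lemma inner_convOp (f : S.Cc) (u v : S'.L2) :
    L2.inner (convOp S' hj f u) v = L2.inner u (convOp S' hj (star f) v) := by
  induction u, v using Completion.induction_on₂ with
  | hp =>
    exact isClosed_eq (continuous_inner (by fun_prop) (by fun_prop))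
      (continuous_inner (by fun_prop) (by fun_prop))
  | ih ψ χ => simp [Cc.inner_convMap]

variable (S) in
/-- The operator `ψ ↦ f ∗ ψ` on `L²(ℝᵈ, B)`. -/
noncomputable abbrev leftOp (f : S.Cc) : S.L2 →L[𝕜] S.L2 := convOp S Cc.isometry_starRingHom_id f

lemma leftOp_coe (f ψ : S.Cc) : leftOp S f (ψ : S.L2) = ((f * ψ : S.Cc) : S.L2) := by
  rw [leftOp, convOp_coe, Cc.convMap_id]

/-- The condition on `(u, v)` is closed, because convolution operators are bounded and the graph is
closed; on `C_c` it is the Leibniz rule. -/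
lemma leftOp_position {i : Fin d} {u v : S.L2} (f : S.Cc) (h : (u, v) ∈ (position S i).graph) :
    (leftOp S f u, leftOp S (Cc.coord i f) u + leftOp S f v) ∈ (position S i).graph := by
  rw [mem_graph_position, ← mem_positionGraph_iff] at h ⊢
  have hcl : IsClosed {p : S.L2 × S.L2 |
      (leftOp S f p.1, leftOp S (Cc.coord i f) p.1 + leftOp S f p.2) ∈ positionGraph S i} :=
    (Submodule.isClosed_topologicalClosure _).preimage (by fun_prop)
  refine closure_minimal ?_ hcl h
  rintro _ ⟨ψ, rfl⟩
  refine Submodule.le_topologicalClosure _ ⟨f * ψ, Prod.ext ?_ ?_⟩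
  · exact (leftOp_coe f ψ).symm
  · refine Eq.trans ?_ (congrArg₂ (· + ·) (leftOp_coe (Cc.coord i f) ψ).symm
      (leftOp_coe f (Cc.coord i ψ)).symm)
    have h1 := Cc.coord_convMap (S' := S) Cc.isometry_starRingHom_id i f ψ
    rw [Cc.convMap_id, Cc.convMap_id, Cc.convMap_id] at h1
    change ((Cc.coord i (f * ψ) : S.Cc) : S.L2) = _
    rw [h1, Completion.coe_add]

lemma convOp_mapL2 (f : S.Cc) (u : S.L2) :
    convOp S' hj f (mapL2 S' hj u) = mapL2 S' hj (leftOp S f u) := by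
  induction u using Completion.induction_on with
  | hp => exact isClosed_eq (by fun_prop) (by fun_prop)
  | ih ψ => rw [leftOp_coe, mapL2_coe, convOp_coe, Cc.convMap_mapCc, mapL2_coe]

end L2

/-! ### The representation of `C_c(ℝᵈ, B) ⊗ Cℓ_{0,d}` -/

lemma kOp_real_smul_right (T : S'.L2 →L[𝕂] S'.L2) (r : ℝ) (m : Module.End ℝ (ExtAlg d))
    (ξ : S'.KMod) : kOp T (r • m) ξ = r • kOp T m ξ := by
  induction ξ using TensorProduct.induction_on with
  | zero => simp
  | tmul ψ ω => simp
  | add x y hx hy => rw [map_add, map_add, hx, hy, smul_add]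

lemma kOp_convOp_real_smul (f : S.Cc) (r : ℝ) (m : Module.End ℝ (ExtAlg d)) (ξ : S'.KMod) :
    kOp (L2.convOp S' hj (r • f)) m ξ = r • kOp (L2.convOp S' hj f) m ξ := by
  induction ξ using TensorProduct.induction_on with
  | zero => simp
  | tmul ψ ω => rw [kOp_tmul, kOp_tmul, L2.convOp_real_smul, TensorProduct.smul_tmul']
  | add x y hx hy => rw [map_add, map_add, hx, hy, smul_add]

variable (S') in
/-- The representation `f ⊗ c ↦ Λ_f ⊗ c` of `C_c(ℝᵈ, B) ⊗ Cℓ_{0,d}` on `L²(ℝᵈ, C) ⊗ ⋀^* ℝᵈ`. -/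
noncomputable def kRep (hj : Isometry j) : S.CcCl →ₗ[ℝ] S'.KMod →ₗ[𝕂] S'.KMod :=
  TensorProduct.lift (LinearMap.mk₂ ℝ
    (fun (f : S.Cc) (c : Cl d) => kOp (L2.convOp S' hj f) (cliffordRep c))
    (fun f g c => by rw [L2.convOp_add, kOp_add_left])
    (fun r f c => LinearMap.ext fun ξ => kOp_convOp_real_smul hj f r _ ξ)
    (fun f c c' => by rw [map_add, kOp_add_right])
    (fun r f c => LinearMap.ext fun ξ => by rw [map_smul]; exact kOp_real_smul_right _ r _ ξ))

@[simp] lemma kRep_tmul (f : S.Cc) (c : Cl d) :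
    kRep S' hj (f ⊗ₜ c) = kOp (L2.convOp S' hj f) (cliffordRep c) := rfl

lemma kRep_mul (a b : S.CcCl) (ξ : S'.KMod) :
    kRep S' hj (a * b) ξ = kRep S' hj a (kRep S' hj b ξ) := by
  induction a using TensorProduct.induction_on with
  | zero => simp
  | tmul f c =>
    induction b using TensorProduct.induction_on with
    | zero => simp
    | tmul g c' =>
      rw [Algebra.TensorProduct.tmul_mul_tmul, kRep_tmul, kRep_tmul, kRep_tmul, kOp_kOp,
        L2.convOp_mul, map_mul]
    | add x y hx hy => rw [mul_add, map_add, map_add, LinearMap.add_apply, LinearMap.add_apply,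
        map_add, hx, hy]
  | add x y hx hy => rw [add_mul, map_add, map_add, LinearMap.add_apply, LinearMap.add_apply, hx, hy]

lemma isAdjoint_kRep (a : S.CcCl) :
    S'.kModData.IsAdjoint (kRep S' hj a) (kRep S' hj (star a)) := by
  induction a using TensorProduct.induction_on with
  | zero =>
    rw [star_zero, map_zero]
    have hM := isHilbertModule_kModData S'
    intro x y
    rw [LinearMap.zero_apply, LinearMap.zero_apply, hM.inner_zero, ← hM.star_inner, hM.inner_zero,
      star_zero]
  | tmul f c =>
    rw [TensorProduct.star_tmul, kRep_tmul, kRep_tmul]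
    exact isAdjoint_kOp (L2.inner_convOp hj f) (isExtAdjoint_cliffordRep c)
  | add x y hx hy => rw [star_add, map_add, map_add]; exact isAdjoint_add hx hy

lemma exists_norm_kRep_le (a : S.CcCl) : ∃ K : ℝ, 0 ≤ K ∧ ∀ ξ : S'.KMod,
    S'.kModData.norm (kRep S' hj a ξ) ≤ K * S'.kModData.norm ξ := by
  have hM := isHilbertModule_kModData S'
  induction a using TensorProduct.induction_on with
  | zero =>
    refine ⟨0, le_rfl, fun ξ => ?_⟩
    rw [map_zero, LinearMap.zero_apply, zero_mul, HilbertModuleData.norm, hM.inner_zero, norm_zero,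
      Real.sqrt_zero]
  | tmul f c =>
    obtain ⟨K, hK, h⟩ := exists_norm_kOp_le (S := S') (cliffordRep c)
    exact ⟨K * ‖L2.convOp S' hj f‖, by positivity, fun ξ => by rw [kRep_tmul]; exact h _ ξ⟩
  | add x y hx hy =>
    obtain ⟨K, hK, h⟩ := hx
    obtain ⟨K', hK', h'⟩ := hy
    refine ⟨K + K', by positivity, fun ξ => ?_⟩
    rw [map_add, LinearMap.add_apply, add_mul]
    exact (hM.norm_add_le _ _).trans (add_le_add (h ξ) (h' ξ))

variable (S) in
/-- The representation of `C_c(ℝᵈ, B) ⊗ Cℓ_{0,d}` on `L²(ℝᵈ, B) ⊗ ⋀^* ℝᵈ`. -/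
noncomputable abbrev kRepSelf : S.CcCl →ₗ[ℝ] S.KMod →ₗ[𝕜] S.KMod :=
  kRep S Cc.isometry_starRingHom_id

lemma ccClGrading_tmul (f : S.Cc) (c : Cl d) :
    S.ccClGrading (f ⊗ₜ c) = f ⊗ₜ CliffordAlgebra.involute c := rfl

lemma kModGrading_kRep (a : S.CcCl) (ξ : S.KMod) :
    S.kModGrading (kRepSelf S a ξ) = kRepSelf S (S.ccClGrading a) (S.kModGrading ξ) := by
  induction a using TensorProduct.induction_on with
  | zero => simp
  | tmul f c =>
    induction ξ using TensorProduct.induction_on with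
    | zero => simp
    | tmul ψ ω =>
      rw [kRep_tmul, kOp_tmul, kModGrading_tmul, kModGrading_tmul, ccClGrading_tmul, kRep_tmul,
        kOp_tmul, extGrading_cliffordRep]
    | add x y hx hy => rw [map_add, map_add, hx, hy, map_add, map_add]
  | add x y hx hy => rw [map_add, LinearMap.add_apply, map_add, hx, hy, map_add, map_add,
      LinearMap.add_apply]

lemma kMod_isAdjointable_add {T U : S.KMod → S.KMod} (hT : S.kModData.IsAdjointable T)
    (hU : S.kModData.IsAdjointable U) : S.kModData.IsAdjointable fun x => T x + U x := by
  obtain ⟨T', hT⟩ := hT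
  obtain ⟨U', hU⟩ := hU
  exact ⟨_, isAdjoint_add hT hU⟩

/-- For `a = f ⊗ c` the Leibniz rule gives `∑ (x_i f) ⊗ γ^i c` plus `∑ f X_i ⊗ γ^i c`. The second
sum is `π(gA a) X`, as `γ^i c` equals `c γ^i` with `c` replaced by its grade involution. -/
lemma exists_commutator (a : S.CcCl) : ∃ T, S.kModData.IsAdjointable T ∧
    ∀ x y, (x, y) ∈ S.diracX.graph →
      (kRepSelf S a x, T x + kRepSelf S (S.ccClGrading a) y) ∈ S.diracX.graph := by
  have hM := isHilbertModule_kModData S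
  induction a using TensorProduct.induction_on with
  | zero =>
    refine ⟨fun _ => 0, ⟨fun _ => 0, fun x y => ?_⟩, fun x y h => ?_⟩
    · rw [hM.inner_zero, ← hM.star_inner, hM.inner_zero, star_zero]
    · simp only [map_zero, LinearMap.zero_apply, add_zero]
      exact S.diracX.graph.zero_mem
  | tmul f c =>
    set T : S.KMod →ₗ[𝕜] S.KMod :=
      ∑ i, kOp (L2.leftOp S (Cc.coord i f)) (extGamma i * cliffordRep c) with hT
    refine ⟨T, ⟨_, isAdjoint_sum _ fun i => isAdjoint_kOp (L2.inner_convOp _ (Cc.coord i f))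
      ((isExtAdjoint_extGamma i).mul (isExtAdjoint_cliffordRep c))⟩, ?_⟩
    have key : ∀ p ∈ S.diracX.graph,
        (kRepSelf S (f ⊗ₜ c) p.1, T p.1 + kRepSelf S (S.ccClGrading (f ⊗ₜ c)) p.2) ∈
          S.diracX.graph := by
      intro p hp
      have hp' := mem_graph_diracX.1 (show (p.1, p.2) ∈ S.diracX.graph from hp)
      have e1 : p.1 = diracRes S (diracRes S p.1 + diracBdd S p.2) := by
        rw [map_add, ← diracBdd_diracRes, ← hp', add_comm, diracBdd_sq_add]
      have e2 : p.2 = diracBdd S (diracRes S p.1 + diracBdd S p.2) := by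
        rw [map_add, diracBdd_diracRes, hp', add_comm, diracBdd_sq_add]
      -- The graph is parametrised linearly by an unrestricted `ζ`, so induction on tensors becomes
      -- available.
      obtain ⟨ζ, hζ1, hζ2⟩ : ∃ ζ, p.1 = diracRes S ζ ∧ p.2 = diracBdd S ζ := ⟨_, e1, e2⟩
      rw [hζ1, hζ2]
      clear hζ1 hζ2 e1 e2 hp' hp p
      rw [ccClGrading_tmul, kRep_tmul, kRep_tmul]
      induction ζ using TensorProduct.induction_on with
      | zero => simp only [map_zero, add_zero]; exact S.diracX.graph.zero_mem
      | tmul ψ ω =>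
        rw [diracRes_tmul, diracBdd_tmul, kOp_tmul, map_sum, hT, LinearMap.sum_apply,
          ← Finset.sum_add_distrib]
        have h3 : ∀ i, (L2.mulOp S (resFun d) ψ, L2.mulOp S (coordResFun i) ψ) ∈
            (L2.position S i).graph := fun i => by rw [L2.mem_graph_position, L2.mulOp_comm]
        have h4 := fun i => L2.mem_graph_position.1 (L2.leftOp_position f (h3 i))
        rw [mem_graph_diracX, diracBdd_tmul, map_sum]
        refine Finset.sum_congr rfl fun i _ => ?_
        have h5 := congrFun (congrArg DFunLike.coe (extGamma_mul_cliffordRep i c)) ω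
        simp only [Module.End.mul_apply] at h5
        rw [kOp_tmul, kOp_tmul, ← h5, Module.End.mul_apply, ← TensorProduct.add_tmul, diracRes_tmul,
          h4]
      | add x y hx hy =>
        have := S.diracX.graph.add_mem hx hy
        simp only [Prod.mk_add_mk] at this
        simp only [map_add]
        convert this using 2
        abel
    exact fun x y h => key (x, y) h
  | add a b ha hb =>
    obtain ⟨T, hT, h⟩ := ha
    obtain ⟨U, hU, h'⟩ := hb
    refine ⟨fun x => T x + U x, kMod_isAdjointable_add hT hU, fun x y hxy => ?_⟩
    have := S.diracX.graph.add_mem (h x y hxy) (h' x y hxy)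
    simp only [Prod.mk_add_mk] at this
    simp only [map_add, LinearMap.add_apply]
    convert this using 2
    abel

end ConvOp

end TwistedSystem

/-! ### Approximation of continuous kernels by finite sums of products. -/

namespace RealCStar

/-- Uniform continuity lets `K` be replaced by its values at the centres of a fine partition of
unity. Rank-one operators require these values to be products, and an approximate right unit
supplies the second factor up to `ε / 2`. -/
lemma exists_tensor_approx {B : Type u} [NonUnitalNormedRing B] [StarRing B] [CStarRing B]
    [CompleteSpace B] [NormedSpace ℝ B] [RealCStar B] [IsScalarTower ℝ B B] [SMulCommClass ℝ B B]
    {X : Type w} [MetricSpace X] [ProperSpace X] (z : X) (R : ℝ)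
    {K : X → X → B} (hK : Continuous (Function.uncurry K))
    (hR : ∀ x y, K x y ≠ 0 → dist x z ≤ R ∧ dist y z ≤ R) {ε : ℝ} (hε : 0 < ε) :
    ∃ (ι : Type w) (_ : Fintype ι) (p : ι → C(X, ℝ)) (b c : ι → ι → B),
      (∀ i, HasCompactSupport (p i)) ∧ (∀ i x, p i x ≠ 0 → dist x z ≤ R + 1) ∧
      ∀ x y, ‖K x y - ∑ i, ∑ k, (p i x * p k y) • (b i k * c i k)‖ ≤ ε := by
  have hT : IsCompact (Metric.closedBall z R) := isCompact_closedBall z R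
  have huc := ((isCompact_closedBall z (R + 1)).prod
    (isCompact_closedBall z (R + 1))).uniformContinuousOn_of_continuous hK.continuousOn
  rw [Metric.uniformContinuousOn_iff] at huc
  obtain ⟨δ, hδ, huc⟩ := huc (ε / 2) (by positivity)
  -- Radius at most `1` keeps the supports of the partition in the ball of radius `R + 1`, where `δ`
  -- was chosen.
  have hr : 0 < min δ 1 := by positivity
  obtain ⟨t, htR, htf, htc⟩ := hT.finite_cover_balls hr
  have := htf.fintype
  obtain ⟨p, hp, hpc⟩ := PartitionOfUnity.exists_isSubordinate_of_locallyFinite_t2space hT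
    (fun i : t => Metric.ball (i : X) (min δ 1)) (fun i => Metric.isOpen_ball)
    (locallyFinite_of_finite _) (by simpa [Set.iUnion_subtype] using htc)
  have hball : ∀ i x, p i x ≠ 0 → dist x i < min δ 1 := fun i x h =>
    hp i (subset_tsupport _ h)
  have htz : ∀ i : t, dist (i : X) z ≤ R := fun i => htR i.2
  have hxz : ∀ i x, p i x ≠ 0 → dist x z ≤ R + 1 := fun i x h => by
    have h1 := (hball i x h).trans_le (min_le_right _ _)
    linarith [dist_triangle x (i : X) z, htz i]
  have hsum : ∀ x, ∑ i, p i x ≤ 1 := fun x => by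
    rw [← finsum_eq_sum_of_fintype]; exact p.sum_le_one x
  have hsum1 : ∀ x, dist x z ≤ R → ∑ i, p i x = 1 := fun x hx => by
    rw [← finsum_eq_sum_of_fintype]; exact p.sum_eq_one hx
  have hp0 : ∀ i x, 0 ≤ p i x := p.nonneg
  choose c hc using fun i k : t => exists_norm_sub_mul_le (K (i : X) k) (half_pos hε)
  refine ⟨t, this, p, fun i k => K i k, c, hpc, hxz, fun x y => ?_⟩
  have e1 : K x y = ∑ i, ∑ k, (p i x * p k y) • K x y := by
    by_cases h : K x y = 0
    · simp [h]
    · obtain ⟨hx, hy⟩ := hR x y h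
      simp only [← Finset.sum_smul, ← Finset.mul_sum, ← Finset.sum_mul]
      rw [hsum1 x hx, hsum1 y hy, mul_one, one_smul]
  have e2 : ∀ i k, ‖(p i x * p k y) • (K x y - K i k * c i k)‖ ≤ (p i x * p k y) * ε := by
    intro i k
    rw [norm_smul, Real.norm_of_nonneg (mul_nonneg (hp0 i x) (hp0 k y))]
    by_cases hi : p i x = 0
    · simp [hi]
    by_cases hk : p k y = 0
    · simp [hk]
    refine mul_le_mul_of_nonneg_left ?_ (mul_nonneg (hp0 i x) (hp0 k y))
    have h1 := huc (x, y) ⟨hxz i x hi, hxz k y hk⟩ ((i : X), (k : X))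
      ⟨(htz i).trans (by linarith), (htz k).trans (by linarith)⟩
      (max_lt ((hball i x hi).trans_le (min_le_left _ _)) ((hball k y hk).trans_le (min_le_left _ _)))
    rw [dist_eq_norm] at h1
    change ‖K x y - K i k‖ < ε / 2 at h1
    calc ‖K x y - K i k * c i k‖ = ‖(K x y - K i k) + (K i k - K i k * c i k)‖ := by
          rw [sub_add_sub_cancel]
      _ ≤ ε / 2 + ε / 2 := (norm_add_le _ _).trans (add_le_add h1.le (hc i k))
      _ = ε := add_halves ε
  calc _ = ‖∑ i, ∑ k, (p i x * p k y) • (K x y - K i k * c i k)‖ := by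
        conv_lhs => rw [e1]
        simp only [smul_sub, Finset.sum_sub_distrib]
    _ ≤ ∑ i, ∑ k, (p i x * p k y) * ε :=
        (norm_sum_le _ _).trans (Finset.sum_le_sum fun i _ =>
          (norm_sum_le _ _).trans (Finset.sum_le_sum fun k _ => e2 i k))
    _ = ((∑ i, p i x) * ∑ k, p k y) * ε := by
        rw [Finset.sum_mul_sum, Finset.sum_mul]
        simp only [Finset.sum_mul]
    _ ≤ (1 * 1) * ε := by
        refine mul_le_mul_of_nonneg_right ?_ hε.le
        exact mul_le_mul (hsum x) (hsum y) (Finset.sum_nonneg fun k _ => hp0 k y) zero_le_one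
    _ = ε := by ring

end RealCStar

/-! ### Compactness of convolution composed with a decaying multiplication. -/

namespace TwistedSystem

variable {𝕜 : Type v} {B : Type u} [RCLike 𝕜] [NonUnitalNormedRing B]
  [StarRing B] [CStarRing B] [CompleteSpace B] [NormedSpace ℝ B] [NormedSpace 𝕜 B]
  [IsScalarTower ℝ 𝕜 B] [IsScalarTower 𝕜 B B] [SMulCommClass 𝕜 B B] [StarModule 𝕜 B]
  [RealCStar B] {d : ℕ} {S : TwistedSystem 𝕜 B d}

open RealCStar UniformSpace
open scoped BoundedContinuousFunction

namespace Cc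

lemma norm_le_of_norm_apply_le (w : S.Cc) {c R : ℝ} (hc : 0 ≤ c) (h : ∀ x, ‖w x‖ ≤ c)
    (hR : ∀ x, w x ≠ 0 → ‖x‖ ≤ R) :
    ‖w‖ ≤ c * √(volume.real (Metric.closedBall (0 : Fin d → ℝ) R)) := by
  rw [norm_def]
  refine (Real.sqrt_le_left (by positivity)).2 ?_
  rw [mul_pow, Real.sq_sqrt measureReal_nonneg]
  have e : inner w w = ∫ x in Metric.closedBall (0 : Fin d → ℝ) R, star (w x) * w x :=
    (setIntegral_eq_integral_of_forall_compl_eq_zero fun x hx => by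
      have : w x = 0 := by
        by_contra hne
        exact hx (mem_closedBall_zero_iff.2 (hR x hne))
      simp [this]).symm
  rw [e]
  refine norm_setIntegral_le_of_norm_le_const measure_closedBall_lt_top fun x _ => ?_
  rw [CStarRing.norm_star_mul_self, ← pow_two]
  exact pow_le_pow_left₀ (norm_nonneg _) (h x) 2

/-- A Hilbert–Schmidt estimate. -/
lemma norm_le_of_kernel {D : (Fin d → ℝ) → (Fin d → ℝ) → B} (hD : ∀ x, Continuous (D x)) {c R : ℝ}
    (hc : 0 ≤ c) (h : ∀ x y, ‖D x y‖ ≤ c) (hR : ∀ x y, D x y ≠ 0 → ‖x‖ ≤ R ∧ ‖y‖ ≤ R)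
    (w ψ : S.Cc) (hw : ∀ x, w x = ∫ y, D x y * ψ y) :
    ‖w‖ ≤ c * volume.real (Metric.closedBall (0 : Fin d → ℝ) R) * ‖ψ‖ := by
  set V := volume.real (Metric.closedBall (0 : Fin d → ℝ) R) with hV
  have h1 : ∀ x, ‖w x‖ ≤ c * √V * ‖ψ‖ := fun x => by
    -- The adjoint of a row of the kernel is a vector `v` with `w(x) = (v | ψ)`, so Cauchy–Schwarz
    -- bounds `w` pointwise.
    let v : S.Cc :=
      { toFun := fun y => star (D x y)
        continuous_toFun := (hD x).star
        hasCompactSupport' := HasCompactSupport.intro (isCompact_closedBall (0 : Fin d → ℝ) R)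
          fun y hy => by
            by_contra hne
            exact hy (mem_closedBall_zero_iff.2 (hR x y (star_ne_zero.1 hne)).2) }
    have hv : w x = inner v ψ := by
      rw [hw, inner]
      refine integral_congr_ae (Filter.Eventually.of_forall fun y => ?_)
      change _ = star (star (D x y)) * ψ y
      rw [star_star]
    rw [hv]
    refine (norm_inner_le _ _).trans (mul_le_mul_of_nonneg_right ?_ (norm_nonneg _))
    refine norm_le_of_norm_apply_le v hc (fun y => ?_) fun y hy => (hR x y (star_ne_zero.1 hy)).2
    change ‖star (D x y)‖ ≤ c
    rw [norm_star]
    exact h x y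
  have h2 := norm_le_of_norm_apply_le w (by positivity) h1 (R := R) fun x hx => by
    rw [hw] at hx
    obtain ⟨y, hy⟩ : ∃ y, D x y ≠ 0 := by
      by_contra! hne
      simp [hne] at hx
    exact (hR x y hy).1
  refine h2.trans_eq ?_
  rw [← hV]
  calc c * √V * ‖ψ‖ * √V = c * (√V * √V) * ‖ψ‖ := by ring
    _ = _ := by rw [Real.mul_self_sqrt measureReal_nonneg]

end Cc

namespace L2

lemma norm_mulRight_le (b : B) (x : S.L2) : ‖L2.mulRight b x‖ ≤ ‖b‖ * ‖x‖ := by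
  refine (pow_le_pow_iff_left₀ (norm_nonneg _) (by positivity) two_ne_zero).1 ?_
  rw [norm_sq, inner_mulRight, ← star_inner, inner_mulRight, star_mul, star_inner, mul_pow, norm_sq x]
  refine (norm_mul_le _ _).trans ?_
  calc _ ≤ ‖star b‖ * ‖L2.inner x x‖ * ‖b‖ := by gcongr; exact norm_mul_le _ _
    _ = _ := by rw [norm_star]; ring

lemma norm_mulRight_inner_le (e f u : S.L2) :
    ‖L2.mulRight (L2.inner f u) e‖ ≤ ‖f‖ * ‖e‖ * ‖u‖ :=
  (norm_mulRight_le _ _).trans <|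
    (mul_le_mul_of_nonneg_right (norm_inner_le f u) (norm_nonneg e)).trans_eq (by ring)

/-- The operator `u ↦ e · (f | u)_B` on `L²(ℝᵈ, B)`. -/
noncomputable def rankOne (e f : S.L2) : S.L2 →L[𝕜] S.L2 :=
  LinearMap.mkContinuous (σ := RingHom.id 𝕜)
    { toFun := fun u => L2.mulRight (L2.inner f u) e
      map_add' := fun u v => (congrArg (fun b => L2.mulRight b e) (inner_add_right f u v)).trans
        (mulRight_add _ _ e)
      map_smul' := fun k u => (congrArg (fun b => L2.mulRight b e) (inner_smul_right k f u)).trans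
        (mulRight_smul k _ e) } (‖f‖ * ‖e‖) (norm_mulRight_inner_le e f)

lemma rankOne_apply (e f u : S.L2) : rankOne e f u = L2.mulRight (L2.inner f u) e := rfl

variable (S) in
/-- The compact endomorphisms of `L²(ℝᵈ, B)`. -/
noncomputable def compacts : AddSubmonoid (S.L2 →L[𝕜] S.L2) :=
  (AddSubmonoid.closure (Set.range fun p : S.L2 × S.L2 => rankOne p.1 p.2)).topologicalClosure

variable [S.IsNormalized]

/-- The operator has the kernel `χ(y) κ_f(x, x - y)`, continuous and compactly supported in both
variables. Product approximations of this kernel are finite sums of rank-one operators, and the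
Hilbert–Schmidt estimate controls the difference. -/
lemma leftOp_comp_mulOp_mem_compacts_of_hasCompactSupport (f : S.Cc) (χ : (Fin d → ℝ) →ᵇ ℝ)
    (hχ : HasCompactSupport χ) : (leftOp S f).comp (mulOp S χ) ∈ compacts S := by
  have := isScalarTower_real_self 𝕜 B
  have := smulCommClass_real_self 𝕜 B
  set K : (Fin d → ℝ) → (Fin d → ℝ) → B := fun x y => χ y • Cc.kernel f x (x - y) with hK
  have hKc : Continuous (Function.uncurry K) :=
    (χ.continuous.comp continuous_snd).smul (Cc.continuous_kernel_comp f (by fun_prop) (by fun_prop))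
  obtain ⟨R, hR⟩ : ∃ R, ∀ x y, K x y ≠ 0 → ‖x‖ ≤ R ∧ ‖y‖ ≤ R := by
    obtain ⟨R1, h1⟩ := f.hasCompactSupport.isBounded.subset_closedBall 0
    obtain ⟨R2, h2⟩ := hχ.isBounded.subset_closedBall 0
    refine ⟨max R2 (R1 + R2), fun x y h => ?_⟩
    have hy : ‖y‖ ≤ R2 := mem_closedBall_zero_iff.1 <| h2 <| subset_tsupport _ fun h0 =>
      h (by rw [hK]; simp [h0])
    have hxy : ‖x - y‖ ≤ R1 := mem_closedBall_zero_iff.1 <| h1 <| subset_tsupport _ fun h0 =>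
      h (by rw [hK]; simp [Cc.kernel_eq_zero h0])
    exact ⟨le_max_of_le_right (by linarith [norm_le_norm_sub_add x y]), le_max_of_le_left hy⟩
  set V := volume.real (Metric.closedBall (0 : Fin d → ℝ) (R + 1)) with hV
  refine Metric.mem_closure_iff.2 fun ε hε => ?_
  -- The estimate multiplies the uniform error by the volume `V`, giving at most `ε / 2`; `V + 1`
  -- avoids division by zero.
  have hδ : 0 < ε / (2 * (V + 1)) := by
    have : 0 ≤ V := measureReal_nonneg
    positivity
  obtain ⟨ι, _, p, b, c, hpc, hpR, hb⟩ := exists_tensor_approx (0 : Fin d → ℝ) R hKc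
    (fun x y h => by simpa using hR x y h) hδ
  -- The kernel `p_i(x) p_k(y) b c` belongs to the rank-one operator with vectors `p_i b` and `p_k
  -- c^*`.
  refine ⟨∑ i, ∑ k, rankOne ((Cc.single S (p i) (p i).continuous (hpc i) (b i k) : S.Cc) : S.L2)
    ((Cc.single S (p k) (p k).continuous (hpc k) (star (c i k)) : S.Cc) : S.L2), ?_, ?_⟩
  · exact sum_mem fun i _ => sum_mem fun k _ => AddSubmonoid.subset_closure ⟨(_, _), rfl⟩
  set F := ∑ i, ∑ k, rankOne ((Cc.single S (p i) (p i).continuous (hpc i) (b i k) : S.Cc) : S.L2)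
    ((Cc.single S (p k) (p k).continuous (hpc k) (star (c i k)) : S.Cc) : S.L2) with hF
  rw [dist_eq_norm]
  refine lt_of_le_of_lt (b := ε / 2) ?_ (by linarith)
  refine ContinuousLinearMap.opNorm_le_bound _ (by positivity) fun u => ?_
  induction u using Completion.induction_on with
  | hp => exact isClosed_le (by fun_prop) (by fun_prop)
  | ih ψ =>
    set w : S.Cc := f * mulCc S χ ψ - ∑ i, ∑ k, Cc.mulRight
      (Cc.inner (Cc.single S (p k) (p k).continuous (hpc k) (star (c i k))) ψ)
      (Cc.single S (p i) (p i).continuous (hpc i) (b i k)) with hw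
    have e1 : ((leftOp S f).comp (mulOp S χ) - F) (ψ : S.L2) = (w : S.L2) := by
      rw [sub_apply, ContinuousLinearMap.comp_apply, mulOp_coe, leftOp_coe, hw, Completion.coe_sub, hF]
      congr 1
      simp only [sum_apply, rankOne_apply, inner_coe, mulRight_coe]
      rw [← Completion.coe_toComplL (𝕜 := 𝕜)]
      simp only [map_sum]
    rw [e1, Completion.norm_coe, Completion.norm_coe]
    set D : (Fin d → ℝ) → (Fin d → ℝ) → B := fun x y =>
      K x y - ∑ i, ∑ k, (p i x * p k y) • (b i k * c i k) with hD
    have hi : ∀ (g : (Fin d → ℝ) → B), Continuous g → Integrable fun y => g y * ψ y := fun g hg =>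
      (hg.mul ψ.continuous).integrable_of_hasCompactSupport
        (ψ.hasCompactSupport.mono fun y hy h => hy (by simp [h]))
    have hwD : ∀ x, w x = ∫ y, D x y * ψ y := fun x => by
      have h1 : (f * mulCc S χ ψ) x = ∫ y, K x y * ψ y := by
        rw [Cc.mul_apply', ← integral_sub_left_eq_self _ volume x]
        refine integral_congr_ae (Filter.Eventually.of_forall fun y => ?_)
        simp only [Cc.convIntegrand_eq_kernel, sub_sub_cancel, mulCc_apply, hK]
        rw [mul_smul_comm, smul_mul_assoc]
      have h2 : ∀ i k, (Cc.mulRight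
          (Cc.inner (Cc.single S (p k) (p k).continuous (hpc k) (star (c i k))) ψ)
          (Cc.single S (p i) (p i).continuous (hpc i) (b i k)) : S.Cc) x =
          ∫ y, ((p i x * p k y) • (b i k * c i k)) * ψ y := fun i k => by
        rw [Cc.mulRight_apply, Cc.inner, Cc.single_apply,
          ← integral_const_mul_of_integrable (Cc.integrable_inner _ _)]
        refine integral_congr_ae (Filter.Eventually.of_forall fun y => ?_)
        have := starModule_real 𝕜 B
        simp only [Cc.single_apply, star_smul, star_trivial, star_star, smul_mul_assoc,
          mul_smul_comm, mul_assoc, mul_smul]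
        exact smul_comm _ _ _
      have h3 : ∀ (s t : S.Cc), (s - t) x = s x - t x := fun _ _ => rfl
      have h4 : ∀ (q : ι → S.Cc), (∑ i, q i) x = ∑ i, q i x := fun q =>
        map_sum (⟨⟨fun s : S.Cc => s x, rfl⟩, fun _ _ => rfl⟩ : S.Cc →+ B) q _
      rw [hw, h3, h1, h4]
      simp only [h4, h2, hD, sub_mul, Finset.sum_mul]
      have hik : ∀ i k, Integrable fun y => ((p i x * p k y) • (b i k * c i k)) * ψ y := fun i k =>
        hi _ (by fun_prop)
      have hKx : Continuous (K x) := hKc.comp (Continuous.prodMk_right x)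
      rw [integral_sub (hi (K x) hKx)
        (integrable_finsetSum _ fun i _ => integrable_finsetSum _ fun k _ => hik i k),
        integral_finsetSum _ fun i _ => integrable_finsetSum _ fun k _ => hik i k]
      congr 1
      exact Finset.sum_congr rfl fun i _ => (integral_finsetSum _ fun k _ => hik i k).symm
    refine (Cc.norm_le_of_kernel (fun x => ?_) hδ.le hb (R := R + 1) ?_ w ψ hwD).trans ?_
    · exact (hKc.comp (Continuous.prodMk_right x)).sub (by fun_prop)
    · intro x y h
      by_cases hKxy : K x y = 0
      · rw [hKxy, zero_sub, neg_ne_zero] at h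
        obtain ⟨i, -, h⟩ := Finset.exists_ne_zero_of_sum_ne_zero h
        obtain ⟨k, -, h⟩ := Finset.exists_ne_zero_of_sum_ne_zero h
        have h5 : p i x ≠ 0 := fun h0 => h (by simp [h0])
        have h6 : p k y ≠ 0 := fun h0 => h (by simp [h0])
        exact ⟨by simpa using hpR i x h5, by simpa using hpR k y h6⟩
      · have := hR x y hKxy
        exact ⟨this.1.trans (by linarith), this.2.trans (by linarith)⟩
    · refine mul_le_mul_of_nonneg_right ?_ (norm_nonneg _)
      rw [← hV]
      have hV0 : 0 ≤ V := measureReal_nonneg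
      rw [div_mul_eq_mul_div, div_le_div_iff₀ (by positivity) two_pos]
      nlinarith

/-- The function `(1 + |x|²)^{-1/2}` tends to `0` at infinity, so its cutoffs converge to it
uniformly and the compactly supported case passes to the norm limit. -/
lemma leftOp_comp_mulOp_resFun_mem_compacts (f : S.Cc) :
    (leftOp S f).comp (mulOp S (resFun d)) ∈ compacts S := by
  refine (isClosed_closure : IsClosed (compacts S : Set (S.L2 →L[𝕜] S.L2))).mem_of_tendsto
    (f := fun n : ℕ => (leftOp S f).comp (mulOp S (resFun d * cutoff d n))) (b := Filter.atTop) ?_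
    (Filter.Eventually.of_forall fun n => ?_)
  · rw [tendsto_iff_norm_sub_tendsto_zero]
    -- Where `‖x‖ > n`, the bounds `(1 + |x|²)^{1/2} ≥ 1` and `≥ ‖x‖` add up to twice it being at
    -- least `n + 1`; whence `2 / (n + 1)`.
    have h0 : Filter.Tendsto (fun n : ℕ => ‖leftOp S f‖ * (1 / ((n : ℝ) + 1) * 2)) Filter.atTop
        (𝓝 0) := by
      simpa using (tendsto_one_div_add_atTop_nhds_zero_nat.mul_const (2 : ℝ)).const_mul ‖leftOp S f‖
    refine squeeze_zero (fun _ => norm_nonneg _) (fun n => ?_) h0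
    rw [← ContinuousLinearMap.comp_sub]
    refine (ContinuousLinearMap.opNorm_comp_le _ _).trans
      (mul_le_mul_of_nonneg_left ?_ (norm_nonneg _))
    refine ContinuousLinearMap.opNorm_le_bound _ (by positivity) fun u => ?_
    have e : (mulOp S (resFun d * cutoff d n) - mulOp S (resFun d)) u =
        -mulOp S (resFun d - resFun d * cutoff d n) u := by
      have := mulOp_add (S := S) (resFun d - resFun d * cutoff d n) (resFun d * cutoff d n) u
      rw [sub_add_cancel] at this
      rw [sub_apply, this]
      abel
    rw [e, norm_neg]
    refine (norm_mulOp_le _ _).trans (mul_le_mul_of_nonneg_right ?_ (norm_nonneg _))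
    refine (BoundedContinuousFunction.norm_le (by positivity)).2 fun x => ?_
    change |resFun d x - resFun d x * cutoff d n x| ≤ _
    have hj := one_le_japanese x
    have hj' := norm_le_japanese x
    rcases le_or_gt ‖x‖ n with hx | hx
    · rw [cutoff_eq_one hx, mul_one, sub_self, abs_zero]
      positivity
    · have h1 : resFun d x - resFun d x * cutoff d n x = (japanese x)⁻¹ * (1 - cutoff d n x) := by
        rw [resFun_apply]; ring
      have h2 : 0 ≤ 1 - cutoff d n x := sub_nonneg.2 (cutoff_le_one n x)
      have h3 : 1 - cutoff d n x ≤ 1 := by linarith [cutoff_nonneg n x]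
      rw [h1, abs_of_nonneg (by positivity)]
      calc (japanese x)⁻¹ * (1 - cutoff d n x) ≤ (japanese x)⁻¹ * 1 := by gcongr
        _ ≤ _ := by
          rw [mul_one, one_div, inv_mul_eq_div, inv_le_comm₀ (by positivity) (by positivity), inv_div,
            div_le_iff₀ two_pos]
          linarith
  · refine leftOp_comp_mulOp_mem_compacts_of_hasCompactSupport f _ ?_
    exact (hasCompactSupport_cutoff n).mono fun x hx h => hx (by simp [h])

end L2

end TwistedSystem

/-! ### Norm limits of finite sums of rank-one operators. -/

namespace HilbertModuleData

variable {𝕜 : Type v} {B E : Type u} [RCLike 𝕜] [NonUnitalNormedRing B] [StarRing B] [CStarRing B]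
  [CompleteSpace B] [NormedSpace ℝ B] [NormedSpace 𝕜 B] [RealCStar B]
  [AddCommGroup E] [Module 𝕜 E] {M : HilbertModuleData B E}

variable (M) in
/-- `T` is a norm limit of finite sums of the operators `x ↦ e · (f | x)_B`. -/
def IsApproximable (T : E → E) : Prop :=
  ∀ ε > 0, ∃ (n : ℕ) (e f : Fin n → E), ∀ x,
    M.norm (T x - ∑ i, M.act (e i) (M.inner (f i) x)) ≤ ε * M.norm x

namespace IsHilbertModule

variable (hM : M.IsHilbertModule 𝕜)
include hM

lemma norm_zero : M.norm 0 = 0 := by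
  rw [HilbertModuleData.norm, hM.inner_zero, _root_.norm_zero, Real.sqrt_zero]

lemma isApproximable_of_eq_sum {ι : Type*} [Fintype ι] {T : E → E} (e f : ι → E)
    (h : ∀ x, T x = ∑ i, M.act (e i) (M.inner (f i) x)) : M.IsApproximable T := by
  intro ε hε
  let σ := (Fintype.equivFin ι).symm
  refine ⟨Fintype.card ι, e ∘ σ, f ∘ σ, fun x => ?_⟩
  have h1 : ∑ i, M.act ((e ∘ σ) i) (M.inner ((f ∘ σ) i) x) = T x := by
    rw [h]
    exact Equiv.sum_comp σ fun i => M.act (e i) (M.inner (f i) x)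
  rw [h1, sub_self, hM.norm_zero]
  exact mul_nonneg hε.le (norm_nonneg x)

lemma isApproximable_add {T U : E → E} (hT : M.IsApproximable T) (hU : M.IsApproximable U) :
    M.IsApproximable fun x => T x + U x := by
  intro ε hε
  obtain ⟨n, e, f, h⟩ := hT (ε / 2) (half_pos hε)
  obtain ⟨m, e', f', h'⟩ := hU (ε / 2) (half_pos hε)
  refine ⟨n + m, Fin.append e e', Fin.append f f', fun x => ?_⟩
  rw [Fin.sum_univ_add]
  simp only [Fin.append_left, Fin.append_right]
  rw [add_sub_add_comm]
  refine (hM.norm_add_le _ _).trans ((add_le_add (h x) (h' x)).trans_eq ?_)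
  ring

lemma isApproximable_of_forall {T : E → E} (h : ∀ ε > 0, ∃ U, M.IsApproximable U ∧
    ∀ x, M.norm (T x - U x) ≤ ε * M.norm x) : M.IsApproximable T := by
  intro ε hε
  obtain ⟨U, hU, hTU⟩ := h (ε / 2) (half_pos hε)
  obtain ⟨n, e, f, h'⟩ := hU (ε / 2) (half_pos hε)
  refine ⟨n, e, f, fun x => ?_⟩
  rw [← sub_add_sub_cancel (T x) (U x)]
  refine (hM.norm_add_le _ _).trans ((add_le_add (hTU x) (h' x)).trans_eq ?_)
  ring

end IsHilbertModule

lemma IsAdjoint.comp {T T' U U' : E → E} (hT : M.IsAdjoint T T') (hU : M.IsAdjoint U U') :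
    M.IsAdjoint (fun x => T (U x)) (fun x => U' (T' x)) := fun x y => by rw [hT, hU]

end HilbertModuleData

/-! ### Compactness of `π(a) (1 + X²)^{-1/2}`. -/

namespace TwistedSystem

variable {𝕜 : Type v} {B : Type u} [RCLike 𝕜] [NonUnitalNormedRing B]
  [StarRing B] [CStarRing B] [CompleteSpace B] [NormedSpace ℝ B] [NormedSpace 𝕜 B]
  [IsScalarTower ℝ 𝕜 B] [IsScalarTower 𝕜 B B] [SMulCommClass 𝕜 B B] [StarModule 𝕜 B]
  [RealCStar B] {d : ℕ} {S : TwistedSystem 𝕜 B d}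

open RealCStar UniformSpace

/-- Expanding the exterior factor in the orthonormal basis `e_J` makes `m` a finite sum of rank-one
maps `e_J ↦ m e_J`. -/
lemma kOp_rankOne (e f : S.L2) (m : Module.End ℝ (ExtAlg d)) (ξ : S.KMod) :
    kOp (L2.rankOne e f) m ξ = ∑ J, S.kModData.act (e ⊗ₜ m (extBasis d J))
      (S.kModData.inner (f ⊗ₜ extBasis d J) ξ) := by
  have hM := isHilbertModule_kModData S
  induction ξ using TensorProduct.induction_on with
  | zero =>
    have h0 : ∀ x : S.KMod, S.kModData.act x 0 = 0 := fun x => by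
      have := hM.act_add x 0 0
      rwa [add_zero, left_eq_add] at this
    simp only [map_zero, hM.inner_zero, h0, Finset.sum_const_zero]
  | tmul ψ ω =>
    have h1 : ∀ J, S.kModData.act (e ⊗ₜ m (extBasis d J))
        (S.kModData.inner (f ⊗ₜ extBasis d J) (ψ ⊗ₜ ω)) =
        L2.rankOne e f ψ ⊗ₜ ((extBasis d).repr ω J • m (extBasis d J)) := fun J => by
      have h2 : extInner (extBasis d J) ω = (extBasis d).repr ω J := by
        simp [extInner_apply, Module.Basis.repr_self, Finsupp.single_apply]
      rw [kMod_inner_tmul, h2, ← algebraMap_smul 𝕜 _ (L2.inner f ψ), hM.act_smul, algebraMap_smul,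
        TensorProduct.tmul_smul]
      rfl
    simp only [h1]
    rw [kOp_tmul, ← TensorProduct.tmul_sum]
    congr 1
    conv_lhs => rw [← (extBasis d).sum_repr ω]
    simp only [map_sum, map_smul]
  | add x y hx hy =>
    rw [map_add, hx, hy, ← Finset.sum_add_distrib]
    simp only [hM.inner_add, hM.act_add]

/-- The bound on `T ⊗ m` is a fixed multiple of `‖T‖`, so approximations of `T` tensor to
approximations of `T ⊗ m`. -/
lemma isApproximable_kOp {T : S.L2 →L[𝕜] S.L2} (hT : T ∈ L2.compacts S)
    (m : Module.End ℝ (ExtAlg d)) : S.kModData.IsApproximable (kOp T m) := by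
  have hM := isHilbertModule_kModData S
  have h1 : ∀ U ∈ AddSubmonoid.closure (Set.range fun p : S.L2 × S.L2 => L2.rankOne p.1 p.2),
      S.kModData.IsApproximable (kOp U m) := by
    intro U hU
    induction hU using AddSubmonoid.closure_induction with
    | mem U hU =>
      obtain ⟨⟨e, f⟩, rfl⟩ := hU
      exact hM.isApproximable_of_eq_sum _ _ (kOp_rankOne e f m)
    | zero =>
      refine hM.isApproximable_of_eq_sum (ι := Fin 0) (fun _ => 0) (fun _ => 0) fun ξ => ?_
      rw [Finset.univ_eq_empty, Finset.sum_empty]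
      have := kOp_add_left (0 : S.L2 →L[𝕜] S.L2) 0 m
      rw [add_zero, left_eq_add] at this
      rw [this, LinearMap.zero_apply]
    | add U U' _ _ h h' =>
      rw [kOp_add_left]
      exact hM.isApproximable_add h h'
  obtain ⟨K, hK, hKm⟩ := exists_norm_kOp_le (S := S) m
  refine hM.isApproximable_of_forall fun ε hε => ?_
  obtain ⟨U, hU, hTU⟩ := Metric.mem_closure_iff.1 hT (ε / (K + 1)) (by positivity)
  refine ⟨kOp U m, h1 U hU, fun ξ => ?_⟩
  have h2 : kOp T m ξ - kOp U m ξ = kOp (T - U) m ξ := by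
    have := kOp_add_left (T - U) U m
    rw [sub_add_cancel] at this
    rw [this, LinearMap.add_apply, add_sub_cancel_right]
  rw [h2]
  refine (hKm _ ξ).trans (mul_le_mul_of_nonneg_right ?_ (HilbertModuleData.norm_nonneg _))
  rw [← dist_eq_norm]
  calc K * dist T U ≤ (K + 1) * (ε / (K + 1)) := by
        gcongr
        linarith
    _ = ε := by field_simp

variable [S.IsNormalized]

lemma isCompactOp_kRep_diracRes (a : S.CcCl) :
    S.kModData.IsCompactOp fun ξ => kRepSelf S a (diracRes S ξ) := by
  have hM := isHilbertModule_kModData S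
  refine ⟨⟨_, (isAdjoint_kRep _ a).comp (isAdjoint_diracRes S)⟩, ?_⟩
  change S.kModData.IsApproximable _
  induction a using TensorProduct.induction_on with
  | zero =>
    refine hM.isApproximable_of_eq_sum (ι := Fin 0) (fun _ => 0) (fun _ => 0) fun ξ => ?_
    rw [Finset.univ_eq_empty, Finset.sum_empty, map_zero, LinearMap.zero_apply]
  | tmul f c =>
    simp only [kRep_tmul, diracRes, kOp_kOp]
    exact isApproximable_kOp (L2.leftOp_comp_mulOp_resFun_mem_compacts f) _
  | add x y hx hy =>
    simp only [map_add, LinearMap.add_apply]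
    exact hM.isApproximable_add hx hy

end TwistedSystem

/-! ### The `C⋆`-algebra of adjointable operators on a Hilbert module. -/

namespace HilbertModuleData.IsHilbertModule

section Space

variable {𝕜 : Type v} {B E : Type u} [RCLike 𝕜] [NonUnitalNormedRing B] [StarRing B] [CStarRing B]
  [CompleteSpace B] [NormedSpace ℝ B] [NormedSpace 𝕜 B] [StarModule 𝕜 B] [RealCStar B]
  [AddCommGroup E] [Module 𝕜 E] {M : HilbertModuleData B E} (hM : M.IsHilbertModule 𝕜)

include hM in
lemma smul_inner (k : 𝕜) (x y : E) : M.inner (k • x) y = star k • M.inner x y := by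
  rw [← hM.star_inner, hM.inner_smul, star_smul, hM.star_inner]

include hM in
lemma norm_smul (k : 𝕜) (x : E) : M.norm (k • x) = ‖k‖ * M.norm x := by
  rw [HilbertModuleData.norm, hM.inner_smul, hM.smul_inner, _root_.norm_smul, _root_.norm_smul,
    norm_star, ← mul_assoc, ← pow_two, Real.sqrt_mul (by positivity), Real.sqrt_sq (_root_.norm_nonneg _)]
  rfl

/-- The Hilbert module `E` as a Banach space. -/
def Space (_ : M.IsHilbertModule 𝕜) : Type u := E

instance : AddCommGroup hM.Space := inferInstanceAs (AddCommGroup E)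
instance : Module 𝕜 hM.Space := inferInstanceAs (Module 𝕜 E)
noncomputable instance : Norm hM.Space := ⟨M.norm⟩

lemma space_core : NormedSpace.Core 𝕜 hM.Space where
  norm_nonneg x := HilbertModuleData.norm_nonneg (M := M) x
  norm_smul k x := hM.norm_smul k x
  norm_triangle x y := hM.norm_add_le x y
  norm_eq_zero_iff x := ⟨fun h => hM.norm_eq_zero h, by rintro rfl; exact hM.norm_zero⟩

noncomputable instance : NormedAddCommGroup hM.Space := NormedAddCommGroup.ofCore hM.space_core
noncomputable instance : NormedSpace 𝕜 hM.Space := NormedSpace.ofCore hM.space_core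

instance : CompleteSpace hM.Space := by
  refine Metric.complete_of_cauchySeq_tendsto fun u hu => ?_
  have h := hM.complete u fun ε hε => by
    obtain ⟨N, hN⟩ := Metric.cauchySeq_iff.1 hu ε hε
    exact ⟨N, fun m hm n hn => (dist_eq_norm (u m) (u n)).symm.trans_lt (hN m hm n hn)⟩
  obtain ⟨x, hx⟩ := h
  refine ⟨x, Metric.tendsto_atTop.2 fun ε hε => ?_⟩
  obtain ⟨N, hN⟩ := hx ε hε
  exact ⟨N, fun n hn => (dist_eq_norm (u n) x).trans_lt (hN n hn)⟩

/-- The inner product with a fixed first argument, as a continuous map. -/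
noncomputable def innerCLM (x : hM.Space) : hM.Space →L[𝕜] B :=
  LinearMap.mkContinuous
    { toFun := fun y => M.inner x y
      map_add' := hM.inner_add x
      map_smul' := fun k y => hM.inner_smul k x y } ‖x‖ fun y => hM.norm_inner_le x y

lemma continuous_inner_right (x : hM.Space) : Continuous fun y : hM.Space => M.inner x y :=
  (hM.innerCLM x).continuous

lemma continuous_inner_left (y : hM.Space) : Continuous fun x : hM.Space => M.inner x y := by
  have h : (fun x : hM.Space => M.inner x y) = fun x => star (M.inner y x) :=
    funext fun x => (hM.star_inner y x).symm
  rw [h]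
  exact (hM.continuous_inner_right y).star

end Space

section Adjointable

variable {C E : Type u} [NonUnitalCStarAlgebra C] [AddCommGroup E] [Module ℂ E]
  {M : HilbertModuleData C E} (hM : M.IsHilbertModule ℂ)

include hM in
lemma isAdjoint_symm {T T' : E → E} (h : M.IsAdjoint T T') : M.IsAdjoint T' T := fun x y => by
  rw [← hM.star_inner, ← h, hM.star_inner]

include hM in
lemma isAdjoint_unique {T T₁ T₂ : E → E} (h₁ : M.IsAdjoint T T₁) (h₂ : M.IsAdjoint T T₂) (y : E) :
    T₁ y = T₂ y := by
  rw [← sub_eq_zero]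
  refine hM.inner_self_eq_zero _ ?_
  rw [hM.inner_sub, ← h₁, ← h₂, sub_self]

/-- The algebra of adjointable operators on a Hilbert module over a complex `C⋆`-algebra. -/
noncomputable def adjointables : Subalgebra ℂ (hM.Space →L[ℂ] hM.Space) where
  carrier := {T | ∃ T' : hM.Space →L[ℂ] hM.Space, M.IsAdjoint T T'}
  mul_mem' := by
    rintro T U ⟨T', hT⟩ ⟨U', hU⟩
    exact ⟨U' * T', fun x y => (hT (U x) y).trans (hU x (T' y))⟩
  add_mem' := by
    rintro T U ⟨T', hT⟩ ⟨U', hU⟩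
    refine ⟨T' + U', fun x y => ?_⟩
    have h1 : (T + U) x = T x + U x := rfl
    have h2 : (T' + U') y = T' y + U' y := rfl
    rw [h1, h2]
    exact (hM.add_inner _ _ _).trans
      ((congrArg₂ (· + ·) (hT x y) (hU x y)).trans (hM.inner_add _ _ _).symm)
  algebraMap_mem' k := by
    refine ⟨algebraMap ℂ _ (star k), fun x y => ?_⟩
    exact (hM.smul_inner k x y).trans (hM.inner_smul (star k) x y).symm

/-- The `C⋆`-algebra of adjointable operators. -/
def Adj : Type u := hM.adjointables

namespace Adj

noncomputable instance : NormedRing hM.Adj := inferInstanceAs (NormedRing hM.adjointables)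
noncomputable instance : NormedAlgebra ℂ hM.Adj :=
  inferInstanceAs (NormedAlgebra ℂ hM.adjointables)

variable {hM}

/-- The operator underlying an adjointable operator. -/
def toCLM (T : hM.Adj) : hM.Space →L[ℂ] hM.Space := Subtype.val T

lemma ext {T U : hM.Adj} (h : ∀ x, T.toCLM x = U.toCLM x) : T = U :=
  Subtype.ext (ContinuousLinearMap.ext h)

lemma toCLM_mul (T U : hM.Adj) (x : hM.Space) : (T * U).toCLM x = T.toCLM (U.toCLM x) := rfl
lemma toCLM_add (T U : hM.Adj) (x : hM.Space) : (T + U).toCLM x = T.toCLM x + U.toCLM x := rfl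
lemma toCLM_smul (k : ℂ) (T : hM.Adj) (x : hM.Space) : (k • T).toCLM x = k • T.toCLM x := rfl

/-- An adjointable operator from a pair of adjoint bounded operators. -/
def mk (T T' : hM.Space →L[ℂ] hM.Space) (h : M.IsAdjoint T T') : hM.Adj := ⟨T, T', h⟩

noncomputable instance : Star hM.Adj :=
  ⟨fun T => ⟨Classical.choose T.2, T.toCLM, hM.isAdjoint_symm (Classical.choose_spec T.2)⟩⟩

lemma isAdjoint_star (T : hM.Adj) : M.IsAdjoint T.toCLM (star T).toCLM := Classical.choose_spec T.2

/-- The involution is a chosen adjoint; adjoints are unique, so exhibiting one identifies it, and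
the ⋆-ring axioms reduce to this. -/
lemma star_eq_of_isAdjoint {T U : hM.Adj} (h : M.IsAdjoint T.toCLM U.toCLM) : star T = U :=
  ext fun y => hM.isAdjoint_unique (isAdjoint_star T) h y

noncomputable instance : StarRing hM.Adj where
  star_involutive T := star_eq_of_isAdjoint (hM.isAdjoint_symm (isAdjoint_star T))
  star_mul T U := star_eq_of_isAdjoint fun x y => by
    refine (isAdjoint_star T (U.toCLM x) y).trans ?_
    exact isAdjoint_star U x ((star T).toCLM y)
  star_add T U := star_eq_of_isAdjoint fun x y => by
    refine (hM.add_inner _ _ _).trans ?_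
    refine (congrArg₂ (· + ·) (isAdjoint_star T x y) (isAdjoint_star U x y)).trans ?_
    exact (hM.inner_add _ _ _).symm

instance : StarModule ℂ hM.Adj := ⟨fun k T => star_eq_of_isAdjoint fun x y => by
  refine (hM.smul_inner k _ _).trans ?_
  exact (congrArg (star k • ·) (isAdjoint_star T x y)).trans (hM.inner_smul (star k) x _).symm⟩

/-- `‖T x‖² = ‖(x | T^* T x)‖ ≤ ‖T^* T‖ ‖x‖²` by Cauchy–Schwarz. -/
instance : CStarRing hM.Adj where
  norm_mul_self_le T := by
    have h : ‖T‖ ≤ √‖star T * T‖ := by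
      refine T.toCLM.opNorm_le_bound (Real.sqrt_nonneg _) fun x => ?_
      refine (pow_le_pow_iff_left₀ (_root_.norm_nonneg _) (by positivity) two_ne_zero).1 ?_
      rw [mul_pow, Real.sq_sqrt (_root_.norm_nonneg _)]
      have h1 : ‖T.toCLM x‖ ^ 2 = ‖M.inner x ((star T * T).toCLM x)‖ :=
        (HilbertModuleData.norm_sq (M := M) (T.toCLM x)).trans
          (congrArg _ (isAdjoint_star T x (T.toCLM x)))
      rw [h1]
      refine (hM.norm_inner_le x _).trans ?_
      calc ‖x‖ * ‖(star T * T).toCLM x‖ ≤ ‖x‖ * (‖star T * T‖ * ‖x‖) :=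
            mul_le_mul_of_nonneg_left ((star T * T).toCLM.le_opNorm x) (_root_.norm_nonneg _)
        _ = _ := by ring
    calc ‖T‖ * ‖T‖ ≤ √‖star T * T‖ * √‖star T * T‖ := by gcongr
      _ = _ := Real.mul_self_sqrt (_root_.norm_nonneg _)

/-- The involution is isometric, so the adjoints of a Cauchy sequence are Cauchy too, and the
adjoint relation passes to the limits. -/
instance : CompleteSpace hM.Adj := by
  refine Metric.complete_of_cauchySeq_tendsto fun u hu => ?_
  have hv : CauchySeq fun n => star (u n) := by
    refine Metric.cauchySeq_iff.2 fun ε hε => ?_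
    obtain ⟨N, hN⟩ := Metric.cauchySeq_iff.1 hu ε hε
    refine ⟨N, fun m hm n hn => ?_⟩
    rw [dist_eq_norm, ← star_sub, norm_star, ← dist_eq_norm]
    exact hN m hm n hn
  have hiso : Isometry (toCLM : hM.Adj → _) := isometry_subtype_coe
  obtain ⟨T, hT⟩ := cauchySeq_tendsto_of_complete (hiso.uniformContinuous.comp_cauchySeq hu)
  obtain ⟨T', hT'⟩ := cauchySeq_tendsto_of_complete (hiso.uniformContinuous.comp_cauchySeq hv)
  have hadj : ∀ x y : hM.Space, M.inner (T x) y = M.inner x (T' y) := fun x y => by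
    have h1 : Filter.Tendsto (fun n => (u n).toCLM x) Filter.atTop (𝓝 (T x)) :=
      ((ContinuousLinearMap.apply ℂ hM.Space x).continuous.tendsto T).comp hT
    have h2 : Filter.Tendsto (fun n => (star (u n)).toCLM y) Filter.atTop (𝓝 (T' y)) :=
      ((ContinuousLinearMap.apply ℂ hM.Space y).continuous.tendsto T').comp hT'
    replace h1 := ((hM.continuous_inner_left y).tendsto (T x)).comp h1
    replace h2 := ((hM.continuous_inner_right x).tendsto (T' y)).comp h2
    refine tendsto_nhds_unique h1 (h2.congr fun n => (isAdjoint_star (u n) x y).symm)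
  exact ⟨mk T T' hadj, hiso.isEmbedding.tendsto_nhds_iff.2 hT⟩

noncomputable instance : CStarAlgebra hM.Adj where

end Adj

end Adjointable

end HilbertModuleData.IsHilbertModule

/-- The trivial twisted dynamical system. -/
noncomputable def trivialSystem (C : Type u) [NonUnitalCStarAlgebra C] (d : ℕ) :
    TwistedSystem ℂ C d where
  α _ := StarAlgEquiv.refl ℂ C
  θ _ _ := 1
  continuous_α _ := continuous_const
  continuous_θ_fst _ := continuous_const
  continuous_θ_snd _ := continuous_const
  cocycle x y z := by
    have : StarAlgEquiv.multiplierMap (StarAlgEquiv.refl ℂ C)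
        ((1 : unitary 𝓜(ℂ, C)) : 𝓜(ℂ, C)) = 1 := by
      ext b <;> rfl
    rw [this]
    simp
  θ_zero_right _ := rfl
  θ_zero_left _ := rfl
  twist x y b := by
    change (b : 𝓜(ℂ, C)) = 1 * (b : 𝓜(ℂ, C)) * star 1
    simp

/-- If `a > b > 0`, the powers of `a / b` are unbounded. Thus a multiplicative constant disappears
when the bound holds for all powers `2^n`. -/
lemma le_of_forall_pow_two_pow_le {a b K : ℝ} (hb : 0 ≤ b)
    (h : ∀ n : ℕ, a ^ 2 ^ n ≤ K * b ^ 2 ^ n) : a ≤ b := by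
  by_contra! hlt
  rcases hb.eq_or_lt with rfl | hb
  · have := h 0
    simp at this
    linarith
  have h1 : 1 < a / b := (one_lt_div hb).2 hlt
  obtain ⟨n, hn⟩ := pow_unbounded_of_one_lt K h1
  have h2 : (a / b) ^ n ≤ (a / b) ^ 2 ^ n := pow_le_pow_right₀ h1.le Nat.lt_two_pow_self.le
  have h3 := h n
  rw [← div_le_iff₀ (by positivity), ← div_pow] at h3
  linarith

/-! ### The regular representation by adjointable operators over a complex algebra. -/

namespace TwistedSystem

variable {𝕜 : Type v} {B : Type u} [RCLike 𝕜] [NonUnitalNormedRing B]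
  [StarRing B] [CStarRing B] [CompleteSpace B] [NormedSpace ℝ B] [NormedSpace 𝕜 B]
  [IsScalarTower ℝ 𝕜 B] [IsScalarTower 𝕜 B B] [SMulCommClass 𝕜 B B] [StarModule 𝕜 B]
  [RealCStar B] {d : ℕ} {S : TwistedSystem 𝕜 B d}

open RealCStar UniformSpace

section KRepAdj

variable {C : Type u} [NonUnitalCStarAlgebra C] {S' : TwistedSystem ℂ C d} [S.IsNormalized]
  {j : B →⋆ₙ+* C} (hj : Isometry j)

variable (S') in
/-- The operators of the representation `kRep`, as bounded operators. -/
noncomputable def kRepCLM (hj : Isometry j) (a : S.CcCl) :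
    (isHilbertModule_kModData S').Space →L[ℂ] (isHilbertModule_kModData S').Space :=
  let T : (isHilbertModule_kModData S').Space →ₗ[ℂ] (isHilbertModule_kModData S').Space :=
    kRep S' hj a
  T.mkContinuousOfExistsBound ((exists_norm_kRep_le hj a).imp fun _ h => h.2)

variable (S') in
/-- The operators of the representation `kRep`, as adjointable operators. -/
noncomputable def kRepAdjFun (hj : Isometry j) (a : S.CcCl) : (isHilbertModule_kModData S').Adj :=
  HilbertModuleData.IsHilbertModule.Adj.mk (kRepCLM S' hj a) (kRepCLM S' hj (star a))
    (isAdjoint_kRep hj a)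

lemma toCLM_kRepAdjFun (a : S.CcCl) (ξ : (isHilbertModule_kModData S').Space) :
    (kRepAdjFun S' hj a).toCLM ξ = kRep S' hj a ξ := rfl

lemma kRepAdjFun_star (a : S.CcCl) : kRepAdjFun S' hj (star a) = star (kRepAdjFun S' hj a) := by
  refine (HilbertModuleData.IsHilbertModule.Adj.star_eq_of_isAdjoint ?_).symm
  exact isAdjoint_kRep hj a

lemma kRepAdjFun_mul (a b : S.CcCl) :
    kRepAdjFun S' hj (a * b) = kRepAdjFun S' hj a * kRepAdjFun S' hj b := by
  refine HilbertModuleData.IsHilbertModule.Adj.ext fun ξ => ?_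
  rw [HilbertModuleData.IsHilbertModule.Adj.toCLM_mul,
    toCLM_kRepAdjFun, toCLM_kRepAdjFun, toCLM_kRepAdjFun]
  exact kRep_mul hj a b ξ

lemma kRepAdjFun_add (a b : S.CcCl) :
    kRepAdjFun S' hj (a + b) = kRepAdjFun S' hj a + kRepAdjFun S' hj b := by
  refine HilbertModuleData.IsHilbertModule.Adj.ext fun ξ => ?_
  rw [HilbertModuleData.IsHilbertModule.Adj.toCLM_add,
    toCLM_kRepAdjFun, toCLM_kRepAdjFun, toCLM_kRepAdjFun, map_add]
  rfl

lemma kRepAdjFun_smul (r : ℝ) (a : S.CcCl) :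
    kRepAdjFun S' hj (r • a) = r • kRepAdjFun S' hj a := by
  refine HilbertModuleData.IsHilbertModule.Adj.ext fun ξ => ?_
  refine Eq.trans ?_
    (HilbertModuleData.IsHilbertModule.Adj.toCLM_smul (r : ℂ) _ ξ).symm
  rw [toCLM_kRepAdjFun, toCLM_kRepAdjFun, map_smul]
  exact (algebraMap_smul ℂ r (kRep S' hj a ξ)).symm

variable (S') in
/-- The representation `kRep`, with values in the `C⋆`-algebra of adjointable operators. -/
noncomputable def kRepAdj (hj : Isometry j) : S.CcCl →⋆ₙₐ[ℝ] (isHilbertModule_kModData S').Adj where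
  toFun := kRepAdjFun S' hj
  map_smul' := kRepAdjFun_smul hj
  map_zero' := by simpa using kRepAdjFun_smul hj 0 0
  map_add' := kRepAdjFun_add hj
  map_mul' := kRepAdjFun_mul hj
  map_star' := kRepAdjFun_star hj

lemma toCLM_kRepAdj (a : S.CcCl) (ξ : (isHilbertModule_kModData S').Space) :
    (kRepAdj S' hj a).toCLM ξ = kRep S' hj a ξ := rfl

omit [S.IsNormalized] in
lemma kOp_one_pow (T : S'.L2 →L[ℂ] S'.L2) {U : (isHilbertModule_kModData S').Adj}
    (hU : ∀ ξ : S'.KMod, U.toCLM ξ = kOp T 1 ξ) (n : ℕ) (ξ : S'.KMod) :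
    (U ^ n).toCLM ξ = kOp (T ^ n) 1 ξ := by
  induction n generalizing ξ with
  | zero =>
    rw [pow_zero, pow_zero]
    exact (congrArg (fun f : S'.KMod →ₗ[ℂ] S'.KMod => f ξ)
      (kMod_hom_ext (f := LinearMap.id) (g := kOp 1 1) fun _ _ => rfl))
  | succ n ih =>
    rw [pow_succ, pow_succ]
    refine (HilbertModuleData.IsHilbertModule.Adj.toCLM_mul (U ^ n) U ξ).trans ?_
    rw [hU, ih, kOp_kOp, mul_one]
    rfl

omit [S.IsNormalized] in
-- Coordinates only give `‖T ⊗ 1‖ ≤ K ‖T‖`. For self-adjoint `U` one has `‖U^{2^n}‖ = ‖U‖^{2^n}`,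
-- and applying the bound to all these powers removes `K`.
lemma norm_le_of_toCLM_eq_kOp_one {T : S'.L2 →L[ℂ] S'.L2} {U : (isHilbertModule_kModData S').Adj}
    (hU : ∀ ξ : S'.KMod, U.toCLM ξ = kOp T 1 ξ) (hsa : IsSelfAdjoint U) : ‖U‖ ≤ ‖T‖ := by
  obtain ⟨K, hK, h⟩ := exists_norm_kOp_le (S := S') 1
  refine le_of_forall_pow_two_pow_le (K := K) (norm_nonneg _) fun n => ?_
  have h1 : ‖U ^ 2 ^ n‖ = ‖U‖ ^ 2 ^ n := congrArg NNReal.toReal (hsa.nnnorm_pow_two_pow n)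
  rw [← h1]
  refine (U ^ 2 ^ n).toCLM.opNorm_le_bound (by positivity) fun ξ => ?_
  have h2 : ‖(U ^ 2 ^ n).toCLM ξ‖ ≤ K * ‖T ^ 2 ^ n‖ * ‖ξ‖ :=
    (congrArg S'.kModData.norm (kOp_one_pow T hU (2 ^ n) ξ)).trans_le (h (T ^ 2 ^ n) ξ)
  refine h2.trans ?_
  gcongr
  exact norm_pow_le' _ (by positivity)

lemma integral_norm_star (f : S.Cc) : ∫ x, ‖star f x‖ = ∫ x, ‖f x‖ := by
  rw [← integral_neg_eq_self]
  refine integral_congr_ae (Filter.Eventually.of_forall fun x => ?_)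
  change ‖(star f) (-x)‖ = ‖f x‖
  rw [Cc.star_apply, StarAlgEquiv.norm_apply_eq, norm_star, neg_neg]

/-- The `C⋆`-identity passes to the self-adjoint element `f^* ∗ f`, where the sharp bound applies.
The constant must be exactly `1`, for this is what admits the regular representation in the
definition of `fullNorm`. -/
lemma norm_kRepAdj_tmul_one_le (f : S.Cc) : ‖kRepAdj S' hj (f ⊗ₜ 1)‖ ≤ ∫ x, ‖f x‖ := by
  have h0 : 0 ≤ ∫ x, ‖f x‖ := integral_nonneg fun x => norm_nonneg _
  refine (pow_le_pow_iff_left₀ (norm_nonneg _) h0 two_ne_zero).1 ?_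
  rw [pow_two, ← CStarRing.norm_star_mul_self]
  have h1 : star (kRepAdj S' hj (f ⊗ₜ 1)) * kRepAdj S' hj (f ⊗ₜ 1) =
      kRepAdj S' hj ((star f * f) ⊗ₜ 1) := by
    rw [← map_star, ← map_mul, TensorProduct.star_tmul, Algebra.TensorProduct.tmul_mul_tmul,
      star_one, mul_one]
  have hsa := IsSelfAdjoint.star_mul_self (kRepAdj S' hj (f ⊗ₜ (1 : Cl d)))
  rw [h1] at hsa ⊢
  refine (norm_le_of_toCLM_eq_kOp_one (T := L2.convOp S' hj (star f * f)) (fun ξ => ?_) hsa).trans ?_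
  · refine (toCLM_kRepAdj hj _ ξ).trans ?_
    rw [kRep_tmul, map_one]
  · rw [L2.convOp_mul, pow_two]
    refine (ContinuousLinearMap.opNorm_comp_le _ _).trans ?_
    refine mul_le_mul ((L2.norm_convOp_le hj _).trans_eq (integral_norm_star f))
      (L2.norm_convOp_le hj f) (norm_nonneg _) h0

end KRepAdj

/-! ### The embedding of `L²(ℝᵈ, B) ⊗ ⋀^* ℝᵈ` in `L²(ℝᵈ, C) ⊗ ⋀^* ℝᵈ` -/

section MapK

variable {𝕂 : Type w} {C : Type u} [RCLike 𝕂] [NonUnitalNormedRing C]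
  [StarRing C] [CStarRing C] [CompleteSpace C] [NormedSpace ℝ C] [NormedSpace 𝕂 C]
  [IsScalarTower ℝ 𝕂 C] [IsScalarTower 𝕂 C C] [SMulCommClass 𝕂 C C] [StarModule 𝕂 C]
  [RealCStar C] {S' : TwistedSystem 𝕂 C d} [S.IsNormalized] {j : B →⋆ₙ+* C} (hj : Isometry j)

variable (S') in
/-- The embedding of `L²(ℝᵈ, B) ⊗ ⋀^* ℝᵈ` in `L²(ℝᵈ, C) ⊗ ⋀^* ℝᵈ`. -/
noncomputable def mapK (hj : Isometry j) : S.KMod →ₗ[ℝ] S'.KMod :=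
  LinearMap.rTensor (ExtAlg d) (L2.mapL2 (S := S) S' hj : S.L2 →ₗ[ℝ] S'.L2)

omit [S.IsNormalized] in
lemma mapK_tmul (ψ : S.L2) (ω : ExtAlg d) :
    mapK S' hj (ψ ⊗ₜ ω) = L2.mapL2 S' hj ψ ⊗ₜ[ℝ] ω := rfl

omit [S.IsNormalized] in
lemma extCoord_mapK (ξ : S.KMod) (I : Finset (Fin d)) :
    S'.extCoord (mapK S' hj ξ) I = L2.mapL2 S' hj (S.extCoord ξ I) := by
  induction ξ using TensorProduct.induction_on with
  | zero => simp
  | tmul ψ ω =>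
    rw [extCoord_tmul, map_smul]
    exact extCoord_tmul (S := S') (L2.mapL2 S' hj ψ) ω I
  | add x y hx hy => rw [map_add, extCoord_add, extCoord_add, hx, hy, map_add]

omit [S.IsNormalized] in
lemma inner_mapK (ξ η : S.KMod) : S'.kModData.inner (mapK S' hj ξ) (mapK S' hj η) =
    j (S.kModData.inner ξ η) := by
  rw [kMod_inner, kMod_inner, map_sum]
  exact Finset.sum_congr rfl fun I _ => by rw [extCoord_mapK, extCoord_mapK, L2.inner_mapL2]

omit [S.IsNormalized] in
lemma norm_mapK (ξ : S.KMod) : S'.kModData.norm (mapK S' hj ξ) = S.kModData.norm ξ := by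
  rw [HilbertModuleData.norm, inner_mapK, Cc.norm_map_of_isometry hj]
  rfl

lemma kRep_mapK (a : S.CcCl) (ξ : S.KMod) :
    kRep S' hj a (mapK S' hj ξ) = mapK S' hj (kRepSelf S a ξ) := by
  induction a using TensorProduct.induction_on with
  | zero => simp
  | tmul f c =>
    induction ξ using TensorProduct.induction_on with
    | zero => simp
    | tmul ψ ω =>
      rw [kRep_tmul, kRep_tmul, kOp_tmul]
      rw [mapK_tmul, mapK_tmul, kOp_tmul, L2.convOp_mapL2]
    | add x y hx hy => rw [map_add, map_add, hx, hy, map_add, map_add]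
  | add x y hx hy => rw [map_add, LinearMap.add_apply, hx, hy, map_add, LinearMap.add_apply, map_add]

end MapK

variable [S.IsNormalized]

lemma exists_eq_sum_tmul (b : Module.Basis (Finset (Fin d)) ℝ (Cl d)) (a : S.CcCl) :
    ∃ f : Finset (Fin d) → S.Cc, a = ∑ I, f I ⊗ₜ b I := by
  induction a using TensorProduct.induction_on with
  | zero => exact ⟨0, by simp⟩
  | tmul f c =>
    refine ⟨fun I => b.repr c I • f, ?_⟩
    conv_lhs => rw [← b.sum_repr c, TensorProduct.tmul_sum]
    exact Finset.sum_congr rfl fun I _ => (TensorProduct.smul_tmul _ _ _).symm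
  | add x y hx hy =>
    obtain ⟨f, rfl⟩ := hx
    obtain ⟨g, rfl⟩ := hy
    exact ⟨f + g, by simp only [Pi.add_apply, TensorProduct.add_tmul, Finset.sum_add_distrib]⟩

/-- With the basis of `Cℓ_{0,d}` that corresponds to the `e_I`, the `e_I`-coordinate of `a (ψ ⊗ 1)`
is `f_I ∗ ψ`, and convolution operators are faithful on `C_c`. -/
lemma eq_zero_of_forall_kRepSelf_eq_zero {a : S.CcCl} (h : ∀ ξ, kRepSelf S a ξ = 0) : a = 0 := by
  obtain ⟨f, rfl⟩ := exists_eq_sum_tmul ((extBasis d).map (clEquiv d).symm) a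
  refine Finset.sum_eq_zero fun I _ => ?_
  have hI : f I = 0 := by
    refine Cc.eq_zero_of_forall_mul_eq_zero fun ψ => Cc.eq_zero_of_norm_eq_zero ?_
    have h1 := h ((ψ : S.L2) ⊗ₜ 1)
    have h2 : kRepSelf S (∑ J, f J ⊗ₜ ((extBasis d).map (clEquiv d).symm) J) ((ψ : S.L2) ⊗ₜ 1) =
        ∑ J, ((f J * ψ : S.Cc) : S.L2) ⊗ₜ extBasis d J := by
      rw [map_sum, LinearMap.sum_apply]
      refine Finset.sum_congr rfl fun J _ => ?_
      rw [kRep_tmul, kOp_tmul, cliffordRep_one_eq, Module.Basis.map_apply,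
        LinearEquiv.apply_symm_apply]
      exact congrArg (· ⊗ₜ _) (L2.leftOp_coe (f J) ψ)
    rw [h2] at h1
    have h3 := congrArg (fun ξ => S.extCoord ξ I) h1
    simp only [map_sum, Finsupp.coe_finsetSum, Finset.sum_apply, extCoord_tmul,
      Module.Basis.repr_self, Finsupp.single_apply, ite_smul, one_smul, zero_smul,
      Finset.sum_ite_eq', Finset.mem_univ, if_true, map_zero, Finsupp.zero_apply] at h3
    rw [← Completion.norm_coe, h3, norm_zero]
  rw [hI, TensorProduct.zero_tmul]

end TwistedSystem

/-- Each generator satisfies `(ρ^i)^* ρ^i = -(ρ^i)² = 1`, and products of such elements are again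
such. This bounds `φ(f ⊗ c)` by `φ(f ⊗ 1)`. -/
lemma span_star_mul_self_eq_one (d : ℕ) :
    Submodule.span ℝ {c : Cl d | star c * c = 1} = ⊤ := by
  set U : Set (Cl d) := {c : Cl d | star c * c = 1} with hU
  have hmul : ∀ a ∈ Submodule.span ℝ U, ∀ b ∈ Submodule.span ℝ U, a * b ∈ Submodule.span ℝ U := by
    intro a ha b hb
    have h := Submodule.mul_mem_mul ha hb
    rw [Submodule.span_mul_span] at h
    refine Submodule.span_mono ?_ h
    rintro _ ⟨u, hu, v, hv, rfl⟩
    change star (u * v) * (u * v) = 1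
    change star u * u = 1 at hu
    change star v * v = 1 at hv
    rw [star_mul, mul_assoc, ← mul_assoc (star u), hu, one_mul, hv]
  have h1 : (1 : Cl d) ∈ Submodule.span ℝ U := Submodule.subset_span (by simp [hU])
  have hgen : ∀ i : Fin d, CliffordAlgebra.ι _ (Pi.single i 1) ∈ Submodule.span ℝ U := fun i => by
    refine Submodule.subset_span ?_
    change star _ * _ = (1 : Cl d)
    rw [CliffordAlgebra.star_ι, neg_mul, CliffordAlgebra.ι_sq_scalar,
      QuadraticMap.weightedSumSquares_apply, ← map_neg]
    simp [Pi.single_apply]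
  refine Submodule.eq_top_iff'.2 fun c => ?_
  induction c using CliffordAlgebra.induction with
  | algebraMap r => rw [Algebra.algebraMap_eq_smul_one]; exact Submodule.smul_mem _ r h1
  | ι v =>
    rw [pi_eq_sum_univ' v, map_sum]
    refine Submodule.sum_mem _ fun i _ => ?_
    rw [map_smul]
    exact Submodule.smul_mem _ _ (by simpa [Pi.single_apply, funext_iff] using! hgen i)
  | mul a b ha hb => exact hmul a ha b hb
  | add a b ha hb => exact Submodule.add_mem _ ha hb

/-! ### The full `C⋆`-completion. -/

namespace TwistedSystem

variable {𝕜 : Type v} {B : Type u} [RCLike 𝕜] [NonUnitalNormedRing B]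
  [StarRing B] [CStarRing B] [CompleteSpace B] [NormedSpace ℝ B] [NormedSpace 𝕜 B]
  [IsScalarTower ℝ 𝕜 B] [IsScalarTower 𝕜 B B] [SMulCommClass 𝕜 B B] [StarModule 𝕜 B]
  [RealCStar B] {d : ℕ} {S : TwistedSystem 𝕜 B d}

open RealCStar UniformSpace
open scoped ENNReal

variable [S.IsNormalized]

/-- A ⋆-representation of `C_c(ℝᵈ, B) ⊗ Cℓ_{0,d}` which is bounded for the `L¹`-norm. -/
def IsIntegrable {C : Type u} [NonUnitalCStarAlgebra C] (φ : S.CcCl →⋆ₙₐ[ℝ] C) : Prop :=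
  ∀ f : S.Cc, ‖φ (f ⊗ₜ 1)‖ ≤ ∫ x, ‖f x‖

/-- The constant comes from writing `c` as a combination of isometries, so it is the same for all
representations. This uniformity keeps the supremum finite and later gives separability. -/
lemma exists_norm_tmul_le (c : Cl d) : ∃ K : ℝ, 0 ≤ K ∧ ∀ {C : Type u} [NonUnitalCStarAlgebra C]
    (φ : S.CcCl →⋆ₙₐ[ℝ] C), IsIntegrable φ → ∀ f : S.Cc, ‖φ (f ⊗ₜ c)‖ ≤ K * ∫ x, ‖f x‖ := by
  have hc : c ∈ Submodule.span ℝ {c : Cl d | star c * c = 1} := by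
    rw [span_star_mul_self_eq_one]; trivial
  induction hc using Submodule.span_induction with
  | mem c hc =>
    refine ⟨1, zero_le_one, fun φ hφ f => ?_⟩
    rw [one_mul]
    refine le_trans (le_of_eq ?_) (hφ f)
    have h : star (φ (f ⊗ₜ c)) * φ (f ⊗ₜ c) = star (φ (f ⊗ₜ 1)) * φ (f ⊗ₜ 1) := by
      rw [← map_star, ← map_mul, ← map_star, ← map_mul, TensorProduct.star_tmul,
        Algebra.TensorProduct.tmul_mul_tmul, hc, TensorProduct.star_tmul,
        Algebra.TensorProduct.tmul_mul_tmul, star_one, one_mul]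
    have h2 := congrArg norm h
    rw [CStarRing.norm_star_mul_self, CStarRing.norm_star_mul_self] at h2
    exact (mul_self_inj (norm_nonneg _) (norm_nonneg _)).1 h2
  | zero => exact ⟨0, le_rfl, fun φ _ f => by simp⟩
  | add x y _ _ hx hy =>
    obtain ⟨K, hK, h⟩ := hx
    obtain ⟨K', hK', h'⟩ := hy
    refine ⟨K + K', by positivity, fun φ hφ f => ?_⟩
    rw [TensorProduct.tmul_add, map_add, add_mul]
    exact (norm_add_le _ _).trans (add_le_add (h φ hφ f) (h' φ hφ f))
  | smul r x _ hx =>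
    obtain ⟨K, hK, h⟩ := hx
    refine ⟨|r| * K, by positivity, fun φ hφ f => ?_⟩
    rw [TensorProduct.tmul_smul, map_smul, norm_smul, mul_assoc]
    exact mul_le_mul_of_nonneg_left (h φ hφ f) (abs_nonneg r)

/-- It ensures that the `sSup` in `fullNorm` is a true supremum and not the default value of an
unbounded set. -/
lemma exists_norm_le (a : S.CcCl) : ∃ K : ℝ, ∀ {C : Type u} [NonUnitalCStarAlgebra C]
    (φ : S.CcCl →⋆ₙₐ[ℝ] C), IsIntegrable φ → ‖φ a‖ ≤ K := by
  induction a using TensorProduct.induction_on with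
  | zero => exact ⟨0, fun φ _ => by simp⟩
  | tmul f c =>
    obtain ⟨K, _, h⟩ := exists_norm_tmul_le (S := S) c
    exact ⟨_, fun φ hφ => h φ hφ f⟩
  | add x y hx hy =>
    obtain ⟨K, h⟩ := hx
    obtain ⟨K', h'⟩ := hy
    refine ⟨K + K', fun φ hφ => ?_⟩
    rw [map_add]
    exact (norm_add_le _ _).trans (add_le_add (h φ hφ) (h' φ hφ))

lemma norm_le_fullNorm {C : Type u} [NonUnitalCStarAlgebra C] {φ : S.CcCl →⋆ₙₐ[ℝ] C}
    (hφ : IsIntegrable φ) (a : S.CcCl) : ‖φ a‖ ≤ S.fullNorm a := by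
  obtain ⟨K, hK⟩ := exists_norm_le a
  refine le_csSup ⟨K, ?_⟩ ⟨C, _, φ, hφ, rfl⟩
  rintro _ ⟨C', _, φ', hφ', rfl⟩
  exact hK φ' hφ'

variable (S) in
/-- The norms of the representations in the definition of the full norm. -/
def RepNorm : Type u := {p : S.CcCl → ℝ // ∃ (C : Type u) (_ : NonUnitalCStarAlgebra C)
  (φ : S.CcCl →⋆ₙₐ[ℝ] C), IsIntegrable φ ∧ p = fun a => ‖φ a‖}

namespace RepNorm

/-- A `C⋆`-algebra on which the norm `p` is realised. -/
def alg (p : RepNorm S) : Type u := Classical.choose p.2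

noncomputable instance (p : RepNorm S) : NonUnitalCStarAlgebra p.alg :=
  Classical.choose (Classical.choose_spec p.2)

/-- A representation which realises the norm `p`. -/
noncomputable def rep (p : RepNorm S) : S.CcCl →⋆ₙₐ[ℝ] p.alg :=
  Classical.choose (Classical.choose_spec (Classical.choose_spec p.2))

lemma isIntegrable_rep (p : RepNorm S) : IsIntegrable p.rep :=
  (Classical.choose_spec (Classical.choose_spec (Classical.choose_spec p.2))).1

lemma norm_rep (p : RepNorm S) (a : S.CcCl) : ‖p.rep a‖ = p.1 a :=
  (congrFun (Classical.choose_spec (Classical.choose_spec (Classical.choose_spec p.2))).2 a).symm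

end RepNorm

variable (S) in
/-- The product of all representations in the definition of the full norm. -/
abbrev RepProd : Type u := lp (fun p : RepNorm S => p.alg) ∞

noncomputable instance : NonUnitalCStarAlgebra (RepProd S) where

lemma memℓp_rep (a : S.CcCl) : Memℓp (fun p : RepNorm S => p.rep a) ∞ := by
  obtain ⟨K, hK⟩ := exists_norm_le a
  refine memℓp_infty ⟨K, ?_⟩
  rintro _ ⟨p, rfl⟩
  exact hK p.rep p.isIntegrable_rep

variable (S) in
/-- The direct sum of all representations in the definition of the full norm. -/
noncomputable def totalRep : S.CcCl →⋆ₙₐ[ℝ] RepProd S where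
  toFun a := ⟨fun p => p.rep a, memℓp_rep a⟩
  map_smul' r a := Subtype.ext <| funext fun p => map_smul p.rep r a
  map_zero' := Subtype.ext <| funext fun p => map_zero p.rep
  map_add' a b := Subtype.ext <| funext fun p => map_add p.rep a b
  map_mul' a b := Subtype.ext <| funext fun p => map_mul p.rep a b
  map_star' a := Subtype.ext <| funext fun p => map_star p.rep a

/-- Indexing the product by norm functions instead of representations keeps it in the universe `u`.
No norm is lost, so both suprema run over the same set of reals. -/
lemma norm_totalRep (a : S.CcCl) : ‖totalRep S a‖ = S.fullNorm a := by
  rw [lp.norm_eq_ciSup, fullNorm]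
  refine congrArg sSup (Set.ext fun r => ⟨?_, ?_⟩)
  · rintro ⟨p, rfl⟩
    exact ⟨p.alg, inferInstance, p.rep, p.isIntegrable_rep, rfl⟩
  · rintro ⟨C, _, φ, hφ, rfl⟩
    exact ⟨⟨fun a => ‖φ a‖, C, _, φ, hφ, rfl⟩, RepNorm.norm_rep _ a⟩

variable (S) in
/-- The range of the universal representation, closed up. -/
noncomputable def fullSubalgebra : NonUnitalStarSubalgebra ℝ (RepProd S) :=
  (NonUnitalStarAlgHom.range (totalRep S)).topologicalClosure

variable (S) in
/-- The full `C⋆`-completion of `C_c(ℝᵈ, B) ⊗ Cℓ_{0,d}`. -/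
def FullAlg : Type u := fullSubalgebra S

namespace FullAlg

noncomputable instance : NonUnitalNormedRing (FullAlg S) :=
  inferInstanceAs (NonUnitalNormedRing (fullSubalgebra S))
noncomputable instance : NormedSpace ℝ (FullAlg S) :=
  inferInstanceAs (NormedSpace ℝ (fullSubalgebra S))
noncomputable instance : StarRing (FullAlg S) := inferInstanceAs (StarRing (fullSubalgebra S))
instance : CompleteSpace (FullAlg S) :=
  (NonUnitalStarSubalgebra.isClosed_topologicalClosure _ :
    IsClosed (fullSubalgebra S : Set (RepProd S))).completeSpace_coe

instance : CStarRing (FullAlg S) where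
  norm_mul_self_le x := (CStarRing.norm_star_mul_self (x := (Subtype.val x : RepProd S))).symm.le

instance : RealCStar (FullAlg S) :=
  ⟨RepProd S, inferInstance,
    { toFun := Subtype.val
      map_mul' := fun _ _ => rfl
      map_zero' := rfl
      map_add' := fun _ _ => rfl
      map_star' := fun _ => rfl }, isometry_subtype_coe⟩

variable (S) in
/-- The canonical map to the full `C⋆`-completion. -/
noncomputable def of : S.CcCl →⋆ₙₐ[ℝ] FullAlg S where
  toFun a := ⟨totalRep S a, NonUnitalStarSubalgebra.le_topologicalClosure _ ⟨a, rfl⟩⟩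
  map_smul' r a := Subtype.ext <| map_smul (totalRep S) r a
  map_zero' := Subtype.ext <| map_zero (totalRep S)
  map_add' a b := Subtype.ext <| map_add (totalRep S) a b
  map_mul' a b := Subtype.ext <| map_mul (totalRep S) a b
  map_star' a := Subtype.ext <| map_star (totalRep S) a

lemma norm_of (a : S.CcCl) : ‖of S a‖ = S.fullNorm a := norm_totalRep a

lemma denseRange_of : DenseRange (of S) := by
  refine fun x => Metric.mem_closure_iff.2 fun ε hε => ?_
  obtain ⟨_, ⟨a, rfl⟩, ha⟩ := Metric.mem_closure_iff.1 x.2 ε hε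
  exact ⟨of S a, ⟨a, rfl⟩, ha⟩

end FullAlg

end TwistedSystem

/-! ### Scalars, grading and extension of maps on the completion. -/

namespace TwistedSystem

variable {𝕜 : Type v} {B : Type u} [RCLike 𝕜] [NonUnitalNormedRing B]
  [StarRing B] [CStarRing B] [CompleteSpace B] [NormedSpace ℝ B] [NormedSpace 𝕜 B]
  [IsScalarTower ℝ 𝕜 B] [IsScalarTower 𝕜 B B] [SMulCommClass 𝕜 B B] [StarModule 𝕜 B]
  [RealCStar B] {d : ℕ} {S : TwistedSystem 𝕜 B d}

open RealCStar UniformSpace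

variable [S.IsNormalized]

lemma star_smul_ccCl (k : 𝕜) (a : S.CcCl) : star (k • a) = star k • star a := by
  induction a using TensorProduct.induction_on with
  | zero => simp
  | tmul f c =>
    rw [TensorProduct.smul_tmul', TensorProduct.star_tmul, TensorProduct.star_tmul, star_smul,
      TensorProduct.smul_tmul']
  | add x y hx hy => rw [smul_add, star_add, hx, hy, star_add, smul_add]

lemma ccClGrading_smul (k : 𝕜) (a : S.CcCl) : S.ccClGrading (k • a) = k • S.ccClGrading a := by
  induction a using TensorProduct.induction_on with
  | zero => simp
  | tmul f c =>
    rw [TensorProduct.smul_tmul', ccClGrading_tmul, ccClGrading_tmul, TensorProduct.smul_tmul']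
  | add x y hx hy => rw [smul_add, map_add, hx, hy, map_add, smul_add]

lemma ccClGrading_ccClGrading (a : S.CcCl) : S.ccClGrading (S.ccClGrading a) = a := by
  induction a using TensorProduct.induction_on with
  | zero => simp
  | tmul f c => rw [ccClGrading_tmul, ccClGrading_tmul, CliffordAlgebra.involute_involute]
  | add x y hx hy => rw [map_add, map_add, hx, hy]

lemma ccClGrading_mul (a b : S.CcCl) :
    S.ccClGrading (a * b) = S.ccClGrading a * S.ccClGrading b := by
  induction a using TensorProduct.induction_on with
  | zero => simp
  | tmul f c =>
    induction b using TensorProduct.induction_on with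
    | zero => simp
    | tmul g c' =>
      rw [Algebra.TensorProduct.tmul_mul_tmul, ccClGrading_tmul, ccClGrading_tmul, ccClGrading_tmul,
        Algebra.TensorProduct.tmul_mul_tmul, map_mul]
    | add x y hx hy => rw [mul_add, map_add, hx, hy, map_add, mul_add]
  | add x y hx hy => rw [add_mul, map_add, hx, hy, map_add, add_mul]

lemma ccClGrading_star (a : S.CcCl) : S.ccClGrading (star a) = star (S.ccClGrading a) := by
  induction a using TensorProduct.induction_on with
  | zero => simp
  | tmul f c =>
    rw [TensorProduct.star_tmul, ccClGrading_tmul, ccClGrading_tmul, TensorProduct.star_tmul,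
      CliffordAlgebra.star_def, CliffordAlgebra.star_def, CliffordAlgebra.reverse_involute,
      CliffordAlgebra.involute_involute, CliffordAlgebra.involute_involute]
  | add x y hx hy => rw [star_add, map_add, hx, hy, map_add, star_add]

variable (S) in
/-- The grading automorphism of `C_c(ℝᵈ, B) ⊗ Cℓ_{0,d}`, as a ⋆-homomorphism. -/
noncomputable def ccClGradingHom : S.CcCl →⋆ₙₐ[ℝ] S.CcCl where
  toFun := S.ccClGrading
  map_smul' := map_smul S.ccClGrading
  map_zero' := map_zero S.ccClGrading
  map_add' := map_add S.ccClGrading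
  map_mul' := ccClGrading_mul
  map_star' := ccClGrading_star

/-- The grading fixes `f ⊗ 1`, so composing with it preserves the `L¹`-bound and permutes the
admissible representations. -/
lemma fullNorm_ccClGrading_le (a : S.CcCl) : S.fullNorm (S.ccClGrading a) ≤ S.fullNorm a := by
  refine Real.sSup_le ?_ ((norm_nonneg _).trans_eq (norm_totalRep a))
  rintro _ ⟨C, _, φ, hφ, rfl⟩
  refine norm_le_fullNorm (φ := φ.comp (ccClGradingHom S)) (fun f => ?_) a
  refine le_trans (le_of_eq ?_) (hφ f)
  change ‖φ (S.ccClGrading (f ⊗ₜ 1))‖ = _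
  rw [ccClGrading_tmul, map_one]

/-- Representations are only real linear, so `k` cannot be pulled out of them directly. But `(k a)^*
(k a) = |k|² a^* a` involves a real scalar, and the `C⋆`-identity finishes. -/
lemma fullNorm_smul (k : 𝕜) (a : S.CcCl) : S.fullNorm (k • a) = ‖k‖ * S.fullNorm a := by
  rw [← FullAlg.norm_of, ← FullAlg.norm_of]
  refine (mul_self_inj (norm_nonneg _) (by positivity)).1 ?_
  have h : star (k • a) * (k • a) = (‖k‖ * ‖k‖) • (star a * a) := by
    rw [star_smul_ccCl, smul_mul_assoc, mul_smul_comm, smul_smul, RCLike.star_def, RCLike.conj_mul,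
      ← algebraMap_smul 𝕜 (‖k‖ * ‖k‖) (star a * a), map_mul, pow_two]
  rw [← CStarRing.norm_star_mul_self, ← map_star, ← map_mul, h, map_smul, norm_smul, map_mul, map_star,
    CStarRing.norm_star_mul_self, Real.norm_of_nonneg (by positivity)]
  ring

namespace FullAlg

section Extend

variable {V : Type*} [NormedAddCommGroup V] [NormedSpace ℝ V] [CompleteSpace V]

/-- The extension to the full `C⋆`-completion of a linear map on `C_c(ℝᵈ, B) ⊗ Cℓ_{0,d}`. -/
noncomputable def extend (L : S.CcCl →ₗ[ℝ] V) : FullAlg S →L[ℝ] V :=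
  L.extendOfNorm (of S : S.CcCl →ₗ[ℝ] FullAlg S)

/-- Only under the bound `h` is `extend L` known to extend `L`. -/
lemma extend_of {L : S.CcCl →ₗ[ℝ] V} {K : ℝ} (h : ∀ a, ‖L a‖ ≤ K * S.fullNorm a) (a : S.CcCl) :
    extend L (of S a) = L a :=
  LinearMap.extendOfNorm_eq (e := (of S : S.CcCl →ₗ[ℝ] FullAlg S)) denseRange_of
    ⟨K, fun a => (h a).trans_eq (congrArg (K * ·) (norm_of a).symm)⟩ a

lemma norm_extend_le {L : S.CcCl →ₗ[ℝ] V} {K : ℝ} (h : ∀ a, ‖L a‖ ≤ K * S.fullNorm a)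
    (x : FullAlg S) : ‖extend L x‖ ≤ K * ‖x‖ :=
  LinearMap.norm_extendOfNorm_apply_le (e := (of S : S.CcCl →ₗ[ℝ] FullAlg S)) denseRange_of K
    (fun a => (h a).trans_eq (congrArg (K * ·) (norm_of a).symm)) x

end Extend

/-- Scalar multiplication on `C_c(ℝᵈ, B) ⊗ Cℓ_{0,d}`, followed by the canonical map. -/
noncomputable def smulOf (k : 𝕜) : S.CcCl →ₗ[ℝ] FullAlg S where
  toFun a := of S (k • a)
  map_add' a b := by rw [smul_add, map_add]
  map_smul' r a := by rw [smul_comm, map_smul, RingHom.id_apply]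

lemma norm_smulOf_le (k : 𝕜) (a : S.CcCl) : ‖smulOf k a‖ ≤ ‖k‖ * S.fullNorm a := by
  rw [← fullNorm_smul]
  exact (norm_of _).le

noncomputable instance : SMul 𝕜 (FullAlg S) := ⟨fun k => extend (smulOf k)⟩

lemma smul_of (k : 𝕜) (a : S.CcCl) : k • of S a = of S (k • a) := extend_of (norm_smulOf_le k) a

lemma norm_smul_le' (k : 𝕜) (x : FullAlg S) : ‖k • x‖ ≤ ‖k‖ * ‖x‖ :=
  norm_extend_le (norm_smulOf_le k) x

instance : ContinuousConstSMul 𝕜 (FullAlg S) := ⟨fun k => (extend (smulOf k)).continuous⟩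

lemma induction_of {P : FullAlg S → Prop} (hP : IsClosed {x | P x}) (h : ∀ a, P (of S a))
    (x : FullAlg S) : P x :=
  isClosed_property denseRange_of hP h x

lemma smul_add' (k : 𝕜) (x y : FullAlg S) : k • (x + y) = k • x + k • y :=
  map_add (extend (smulOf k)) x y

noncomputable instance : Module 𝕜 (FullAlg S) where
  one_smul x := by
    refine induction_of (isClosed_eq (continuous_const_smul _) continuous_id) (fun a => ?_) x
    rw [smul_of, one_smul]
    rfl
  mul_smul k l x := by
    refine induction_of (isClosed_eq (continuous_const_smul _)
      ((continuous_const_smul _).const_smul k)) (fun a => ?_) x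
    change (k * l) • of S a = k • l • of S a
    rw [smul_of, smul_of, smul_of, mul_smul]
  smul_zero k := map_zero (extend (smulOf k))
  smul_add := smul_add'
  add_smul k l x := by
    refine induction_of (isClosed_eq (continuous_const_smul _)
      ((continuous_const_smul _).add (continuous_const_smul _))) (fun a => ?_) x
    change (k + l) • of S a = k • of S a + l • of S a
    rw [smul_of, smul_of, smul_of, add_smul, map_add]
  zero_smul x := by
    refine induction_of (isClosed_eq (continuous_const_smul _) continuous_const) (fun a => ?_) x
    rw [smul_of, zero_smul, map_zero]

noncomputable instance : NormedSpace 𝕜 (FullAlg S) where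
  norm_smul_le := norm_smul_le'

instance : IsScalarTower 𝕜 (FullAlg S) (FullAlg S) where
  smul_assoc k x y := by
    simp only [smul_eq_mul]
    refine induction_of (isClosed_eq ((continuous_const_smul k).mul continuous_const)
      ((continuous_id.mul continuous_const).const_smul k)) (fun a => ?_) x
    refine induction_of (isClosed_eq (continuous_const.mul continuous_id)
      ((continuous_const.mul continuous_id).const_smul k)) (fun b => ?_) y
    change k • of S a * of S b = k • (of S a * of S b)
    rw [smul_of, ← map_mul, ← map_mul, smul_of, smul_mul_assoc]

instance : SMulCommClass 𝕜 (FullAlg S) (FullAlg S) where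
  smul_comm k x y := by
    simp only [smul_eq_mul]
    refine induction_of (isClosed_eq ((continuous_id.mul continuous_const).const_smul k)
      (continuous_id.mul continuous_const)) (fun a => ?_) x
    refine induction_of (isClosed_eq ((continuous_const.mul continuous_id).const_smul k)
      (continuous_const.mul (continuous_const_smul k))) (fun b => ?_) y
    change k • (of S a * of S b) = of S a * k • of S b
    rw [smul_of, ← map_mul, ← map_mul, smul_of, mul_smul_comm]

instance : StarModule 𝕜 (FullAlg S) where
  star_smul k x := by
    refine induction_of (isClosed_eq (continuous_const_smul k).star
      (continuous_star.const_smul (star k))) (fun a => ?_) x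
    change star (k • of S a) = star k • star (of S a)
    rw [smul_of, ← map_star, ← map_star, smul_of, star_smul_ccCl]

/-- The grading of `C_c(ℝᵈ, B) ⊗ Cℓ_{0,d}`, followed by the canonical map. -/
noncomputable def gradingOf : S.CcCl →ₗ[ℝ] FullAlg S :=
  (of S : S.CcCl →ₗ[ℝ] FullAlg S) ∘ₗ S.ccClGrading

lemma norm_gradingOf_le (a : S.CcCl) : ‖gradingOf a‖ ≤ 1 * S.fullNorm a := by
  rw [one_mul]
  exact (norm_of _).trans_le (fullNorm_ccClGrading_le a)

lemma extend_gradingOf (a : S.CcCl) : extend gradingOf (of S a) = of S (S.ccClGrading a) :=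
  extend_of norm_gradingOf_le a

lemma continuous_extend_gradingOf : Continuous (extend (gradingOf (S := S))) :=
  (extend gradingOf).continuous

variable (S) in
/-- The grading automorphism of the full `C⋆`-completion. -/
noncomputable def grading : FullAlg S →⋆ₙₐ[𝕜] FullAlg S where
  toFun := extend gradingOf
  map_smul' k x := by
    refine induction_of (isClosed_eq (continuous_extend_gradingOf.comp (continuous_const_smul k))
      (continuous_extend_gradingOf.const_smul k)) (fun a => ?_) x
    change extend gradingOf (k • of S a) = k • extend gradingOf (of S a)
    rw [smul_of, extend_gradingOf, extend_gradingOf, smul_of, ccClGrading_smul]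
  map_zero' := map_zero (extend gradingOf)
  map_add' := map_add (extend gradingOf)
  map_mul' x y := by
    refine induction_of (isClosed_eq
      (continuous_extend_gradingOf.comp (continuous_id.mul continuous_const))
      (continuous_extend_gradingOf.mul continuous_const)) (fun a => ?_) x
    refine induction_of (isClosed_eq
      (continuous_extend_gradingOf.comp (continuous_const.mul continuous_id))
      (continuous_const.mul continuous_extend_gradingOf)) (fun b => ?_) y
    change extend gradingOf (of S a * of S b) = extend gradingOf (of S a) * extend gradingOf (of S b)
    rw [← map_mul, extend_gradingOf, extend_gradingOf, extend_gradingOf, ccClGrading_mul, map_mul]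
  map_star' x := by
    refine induction_of (isClosed_eq (continuous_extend_gradingOf.comp continuous_star)
      continuous_extend_gradingOf.star) (fun a => ?_) x
    change extend gradingOf (star (of S a)) = star (extend gradingOf (of S a))
    rw [← map_star, extend_gradingOf, extend_gradingOf, ccClGrading_star, map_star]

lemma grading_of (a : S.CcCl) : grading S (of S a) = of S (S.ccClGrading a) := extend_gradingOf a

lemma continuous_grading : Continuous (grading S) := continuous_extend_gradingOf

lemma grading_grading (x : FullAlg S) : grading S (grading S x) = x := by
  refine induction_of (isClosed_eq (continuous_grading.comp continuous_grading) continuous_id)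
    (fun a => ?_) x
  change grading S (grading S (of S a)) = of S a
  rw [grading_of, grading_of, ccClGrading_ccClGrading]

variable (S) in
/-- The canonical map to the full `C⋆`-completion. -/
noncomputable def ofHom : S.CcCl →⋆ₙₐ[𝕜] FullAlg S where
  toFun := of S
  map_smul' k a := (smul_of k a).symm
  map_zero' := map_zero (of S)
  map_add' := map_add (of S)
  map_mul' := map_mul (of S)
  map_star' := map_star (of S)

end FullAlg

end TwistedSystem

/-! ### The representation of the completion on `L²(ℝᵈ, B) ⊗ ⋀^* ℝᵈ`. -/

namespace TwistedSystem

variable {𝕜 : Type v} {B : Type u} [RCLike 𝕜] [NonUnitalNormedRing B]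
  [StarRing B] [CStarRing B] [CompleteSpace B] [NormedSpace ℝ B] [NormedSpace 𝕜 B]
  [IsScalarTower ℝ 𝕜 B] [IsScalarTower 𝕜 B B] [SMulCommClass 𝕜 B B] [StarModule 𝕜 B]
  [RealCStar B] {d : ℕ} {S : TwistedSystem 𝕜 B d}

open RealCStar UniformSpace

variable [S.IsNormalized]

/-- Over the complex envelope of `B` the regular representation is one of those defining `fullNorm`,
and it restricts to the representation over `B` on an isometric copy of the module. The trivial
system only supplies the function space. -/
lemma norm_kRepSelf_le (a : S.CcCl) (ξ : S.KMod) :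
    S.kModData.norm (kRepSelf S a ξ) ≤ S.kModData.norm ξ * S.fullNorm a := by
  set S' := trivialSystem (Env B) d
  have hj := isometry_emb B
  have h1 : ‖kRepAdj S' hj a‖ ≤ S.fullNorm a :=
    norm_le_fullNorm (norm_kRepAdj_tmul_one_le hj) a
  have h2 : S'.kModData.norm (kRep S' hj a (mapK S' hj ξ)) ≤
      ‖kRepAdj S' hj a‖ * S'.kModData.norm (mapK S' hj ξ) :=
    (kRepAdj S' hj a).toCLM.le_opNorm (mapK S' hj ξ)
  rw [kRep_mapK, norm_mapK, norm_mapK] at h2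
  rw [mul_comm]
  exact h2.trans (mul_le_mul_of_nonneg_right h1 (HilbertModuleData.norm_nonneg _))

lemma eq_zero_of_fullNorm_eq_zero {a : S.CcCl} (h : S.fullNorm a = 0) : a = 0 := by
  refine eq_zero_of_forall_kRepSelf_eq_zero fun ξ => ?_
  refine (isHilbertModule_kModData S).norm_eq_zero ?_
  refine le_antisymm ?_ (HilbertModuleData.norm_nonneg _)
  have := norm_kRepSelf_le a ξ
  rwa [h, mul_zero] at this

variable (S) in
/-- `L²(ℝᵈ, B) ⊗ ⋀^* ℝᵈ` as a Banach space. -/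
abbrev KSpace : Type u := (isHilbertModule_kModData S).Space

noncomputable instance : NormedSpace ℝ (KSpace S) where
  toModule := inferInstanceAs (Module ℝ S.KMod)
  norm_smul_le r ξ := by
    have h : (algebraMap ℝ 𝕜 r) • (show S.KMod from ξ) = r • (show S.KMod from ξ) :=
      algebraMap_smul 𝕜 r (show S.KMod from ξ)
    change S.kModData.norm (r • (show S.KMod from ξ)) ≤ ‖r‖ * S.kModData.norm ξ
    rw [← norm_algebraMap' 𝕜 r, ← h]
    exact ((isHilbertModule_kModData S).norm_smul _ _).le

/-- The map `a ↦ a ξ` on `C_c(ℝᵈ, B) ⊗ Cℓ_{0,d}`. -/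
noncomputable def orbit (ξ : KSpace S) : S.CcCl →ₗ[ℝ] KSpace S where
  toFun a := kRepSelf S a ξ
  map_add' a b := by rw [map_add]; rfl
  map_smul' r a := by rw [map_smul]; rfl

lemma norm_orbit_le (ξ : KSpace S) (a : S.CcCl) : ‖orbit ξ a‖ ≤ ‖ξ‖ * S.fullNorm a :=
  norm_kRepSelf_le a ξ

variable (S) in
/-- The representation of the full `C⋆`-completion on `L²(ℝᵈ, B) ⊗ ⋀^* ℝᵈ`. -/
noncomputable def fullRep (x : FullAlg S) (ξ : KSpace S) : KSpace S := FullAlg.extend (orbit ξ) x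

lemma fullRep_of (a : S.CcCl) (ξ : KSpace S) : fullRep S (FullAlg.of S a) ξ = kRepSelf S a ξ :=
  FullAlg.extend_of (norm_orbit_le ξ) a

lemma norm_fullRep_le (x : FullAlg S) (ξ : KSpace S) : ‖fullRep S x ξ‖ ≤ ‖ξ‖ * ‖x‖ :=
  FullAlg.norm_extend_le (norm_orbit_le ξ) x

lemma continuous_fullRep_left (ξ : KSpace S) : Continuous fun x => fullRep S x ξ :=
  (FullAlg.extend (orbit ξ)).continuous

lemma fullRep_add_left (x y : FullAlg S) (ξ : KSpace S) :
    fullRep S (x + y) ξ = fullRep S x ξ + fullRep S y ξ := map_add (FullAlg.extend (orbit ξ)) x y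

/-- The extension is made separately for each vector, so additivity in the vector has to be
recovered by density. -/
lemma fullRep_add_right (x : FullAlg S) (ξ η : KSpace S) :
    fullRep S x (ξ + η) = fullRep S x ξ + fullRep S x η := by
  refine FullAlg.induction_of (isClosed_eq (continuous_fullRep_left _)
    ((continuous_fullRep_left ξ).add (continuous_fullRep_left η))) (fun a => ?_) x
  change fullRep S (FullAlg.of S a) (ξ + η) = fullRep S (FullAlg.of S a) ξ + fullRep S (FullAlg.of S a) η
  rw [fullRep_of, fullRep_of, fullRep_of]
  exact map_add (kRepSelf S a) ξ η

lemma continuous_fullRep_right (x : FullAlg S) : Continuous (fullRep S x) :=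
  AddMonoidHomClass.continuous_of_bound (AddMonoidHom.mk' (fullRep S x) (fullRep_add_right x)) ‖x‖
    fun ξ => (norm_fullRep_le x ξ).trans_eq (mul_comm _ _)

lemma kRep_smul_left (k : 𝕜) (a : S.CcCl) (ξ : S.KMod) :
    kRepSelf S (k • a) ξ = k • kRepSelf S a ξ := by
  induction a using TensorProduct.induction_on with
  | zero => simp
  | tmul f c =>
    rw [TensorProduct.smul_tmul', kRep_tmul, kRep_tmul]
    induction ξ using TensorProduct.induction_on with
    | zero => simp
    | tmul ψ ω =>
      have h : L2.leftOp S (k • f) ψ = k • L2.leftOp S f ψ := by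
        induction ψ using Completion.induction_on with
        | hp => exact isClosed_eq (by fun_prop) ((L2.leftOp S f).continuous.const_smul k)
        | ih ψ => rw [L2.leftOp_coe, L2.leftOp_coe, smul_mul_assoc, Completion.coe_smul]
      rw [kOp_tmul, kOp_tmul, h, TensorProduct.smul_tmul']
    | add x y hx hy => rw [map_add, map_add, hx, hy, smul_add]
  | add x y hx hy => rw [smul_add, map_add, map_add, LinearMap.add_apply, LinearMap.add_apply, hx, hy,
      smul_add]

lemma fullRep_smul_left (k : 𝕜) (x : FullAlg S) (ξ : KSpace S) :
    fullRep S (k • x) ξ = k • fullRep S x ξ := by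
  refine FullAlg.induction_of (isClosed_eq ((continuous_fullRep_left ξ).comp
    (continuous_const_smul k)) ((continuous_fullRep_left ξ).const_smul k)) (fun a => ?_) x
  change fullRep S (k • FullAlg.of S a) ξ = k • fullRep S (FullAlg.of S a) ξ
  rw [FullAlg.smul_of, fullRep_of, fullRep_of]
  exact kRep_smul_left k a ξ

lemma fullRep_mul (x y : FullAlg S) (ξ : KSpace S) :
    fullRep S (x * y) ξ = fullRep S x (fullRep S y ξ) := by
  refine FullAlg.induction_of (isClosed_eq ((continuous_fullRep_left ξ).comp
    (continuous_id.mul continuous_const)) (continuous_fullRep_left _)) (fun a => ?_) x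
  refine FullAlg.induction_of (isClosed_eq ((continuous_fullRep_left ξ).comp
    (continuous_const.mul continuous_id)) ((continuous_fullRep_right _).comp
    (continuous_fullRep_left ξ))) (fun b => ?_) y
  change fullRep S (FullAlg.of S a * FullAlg.of S b) ξ =
    fullRep S (FullAlg.of S a) (fullRep S (FullAlg.of S b) ξ)
  rw [← map_mul, fullRep_of, fullRep_of, fullRep_of]
  exact kRep_mul _ a b ξ

lemma isAdjoint_fullRep (x : FullAlg S) :
    S.kModData.IsAdjoint (fullRep S x) (fullRep S (star x)) := by
  have hM := isHilbertModule_kModData S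
  suffices key : ∀ ξ η : KSpace S, S.kModData.inner (fullRep S x ξ) η =
      S.kModData.inner ξ (fullRep S (star x) η) from key
  intro ξ η
  refine FullAlg.induction_of (isClosed_eq ((hM.continuous_inner_left η).comp
    (continuous_fullRep_left ξ)) ((hM.continuous_inner_right ξ).comp
    ((continuous_fullRep_left η).comp continuous_star))) (fun a => ?_) x
  change S.kModData.inner (fullRep S (FullAlg.of S a) ξ) η =
    S.kModData.inner ξ (fullRep S (star (FullAlg.of S a)) η)
  rw [← map_star, fullRep_of, fullRep_of]
  exact isAdjoint_kRep _ a ξ η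

variable (S) in
/-- The grading operator of `L²(ℝᵈ, B) ⊗ ⋀^* ℝᵈ`, on the Banach space. -/
noncomputable def kSpaceGrading (ξ : KSpace S) : KSpace S := S.kModGrading ξ

lemma continuous_kSpaceGrading : Continuous (kSpaceGrading S) :=
  AddMonoidHomClass.continuous_of_bound
    (AddMonoidHom.mk' (kSpaceGrading S) fun ξ η => map_add S.kModGrading ξ η) 1 fun ξ => by
    rw [one_mul]
    exact le_of_eq (congrArg Real.sqrt (congrArg norm (inner_kModGrading ξ ξ)))

lemma kSpaceGrading_fullRep (x : FullAlg S) (ξ : KSpace S) :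
    kSpaceGrading S (fullRep S x ξ) = fullRep S (FullAlg.grading S x) (kSpaceGrading S ξ) := by
  refine FullAlg.induction_of (isClosed_eq
    (continuous_kSpaceGrading.comp (continuous_fullRep_left ξ))
    ((continuous_fullRep_left _).comp FullAlg.continuous_grading)) (fun a => ?_) x
  change kSpaceGrading S (fullRep S (FullAlg.of S a) ξ) =
    fullRep S (FullAlg.grading S (FullAlg.of S a)) (kSpaceGrading S ξ)
  rw [FullAlg.grading_of, fullRep_of, fullRep_of]
  exact kModGrading_kRep a ξ

/-! ### Separability -/

omit [S.IsNormalized] in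
-- The space `L¹(ℝᵈ, B)` is separable, hence so is the image of `C_c` in it, with a countable dense
-- subset taken inside that image.
lemma Cc.exists_countable_dense [TopologicalSpace.SeparableSpace B] : ∃ D : Set S.Cc, D.Countable ∧
    ∀ f : S.Cc, ∀ ε > 0, ∃ g ∈ D, ∫ x, ‖f x - g x‖ < ε := by
  have hi : ∀ f : S.Cc, Integrable f := fun f =>
    f.continuous.integrable_of_hasCompactSupport f.hasCompactSupport
  let L : S.Cc → (Fin d → ℝ) →₁[volume] B := fun f => (hi f).toL1 f
  have : Fact ((1 : ENNReal) ≠ ⊤) := ⟨ENNReal.one_ne_top⟩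
  obtain ⟨T, hTL, hT, hTd⟩ := (TopologicalSpace.IsSeparable.of_separableSpace (Set.range L)).exists_countable_dense_subset
  have hTL' : ∀ t ∈ T, ∃ f, L f = t := fun t ht => hTL ht
  choose! g hg using hTL'
  refine ⟨g '' T, hT.image g, fun f ε hε => ?_⟩
  obtain ⟨t, ht, hft⟩ := Metric.mem_closure_iff.1 (hTd ⟨f, rfl⟩) ε hε
  refine ⟨g t, ⟨t, ht, rfl⟩, ?_⟩
  rw [← hg t ht, dist_eq_norm, ← Integrable.toL1_sub, L1.norm_of_fun_eq_integral_norm] at hft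
  exact hft

lemma isSeparable_range_of_tmul [TopologicalSpace.SeparableSpace B] (c : Cl d) :
    TopologicalSpace.IsSeparable (Set.range fun f : S.Cc => FullAlg.of S (f ⊗ₜ c)) := by
  obtain ⟨D, hD, h⟩ := Cc.exists_countable_dense (S := S)
  obtain ⟨K, hK, hKc⟩ := exists_norm_tmul_le (S := S) c
  refine ⟨(fun f : S.Cc => FullAlg.of S (f ⊗ₜ c)) '' D, hD.image _, ?_⟩
  rintro _ ⟨f, rfl⟩
  refine Metric.mem_closure_iff.2 fun ε hε => ?_
  obtain ⟨g, hg, hfg⟩ := h f (ε / (K + 1)) (by positivity)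
  refine ⟨_, ⟨g, hg, rfl⟩, ?_⟩
  dsimp only
  have h1 : S.fullNorm ((f - g) ⊗ₜ c) ≤ K * ∫ x, ‖(f - g) x‖ := by
    refine Real.sSup_le ?_ (mul_nonneg hK (integral_nonneg fun x => norm_nonneg _))
    rintro _ ⟨C, _, φ, hφ, rfl⟩
    exact hKc φ hφ (f - g)
  rw [dist_eq_norm, ← map_sub, ← TensorProduct.sub_tmul, FullAlg.norm_of]
  refine h1.trans_lt ?_
  have h0 : 0 ≤ ∫ x, ‖(f - g) x‖ := integral_nonneg fun x => norm_nonneg _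
  calc K * ∫ x, ‖(f - g) x‖ ≤ (K + 1) * ∫ x, ‖(f - g) x‖ := by gcongr; linarith
    _ < (K + 1) * (ε / (K + 1)) := by
      refine mul_lt_mul_of_pos_left hfg (by positivity)
    _ = ε := by field_simp

/-- The algebra `Cℓ_{0,d}` is finite-dimensional, so finitely many separable sets `{f ⊗ b_I}` span a
dense subspace. -/
instance [TopologicalSpace.SeparableSpace B] : TopologicalSpace.SeparableSpace (FullAlg S) := by
  let b := (extBasis d).map (clEquiv d).symm
  have h1 : TopologicalSpace.IsSeparable
      (⋃ I, Set.range fun f : S.Cc => FullAlg.of S (f ⊗ₜ b I)) :=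
    TopologicalSpace.IsSeparable.iUnion fun I => isSeparable_range_of_tmul (b I)
  have h2 := (h1.span (R := ℝ)).closure
  rw [← TopologicalSpace.isSeparable_univ_iff]
  refine h2.mono fun x _ => closure_mono ?_ (FullAlg.denseRange_of x)
  rintro _ ⟨a, rfl⟩
  obtain ⟨f, rfl⟩ := exists_eq_sum_tmul b a
  rw [map_sum]
  exact Submodule.sum_mem _ fun I _ => Submodule.subset_span (Set.mem_iUnion.2 ⟨I, f I, rfl⟩)

end TwistedSystem

/-! ### Assembly of the Kasparov module. -/

namespace TwistedSystem

variable {𝕜 : Type v} {B : Type u} [RCLike 𝕜] [NonUnitalNormedRing B]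
  [StarRing B] [CStarRing B] [CompleteSpace B] [NormedSpace ℝ B] [NormedSpace 𝕜 B]
  [IsScalarTower ℝ 𝕜 B] [IsScalarTower 𝕜 B B] [SMulCommClass 𝕜 B B] [StarModule 𝕜 B]
  [RealCStar B] {d : ℕ} (S : TwistedSystem 𝕜 B d) [S.IsNormalized]

/-- The full `C⋆`-completion of `C_c(ℝᵈ, B) ⊗ Cℓ_{0,d}` as a `C⋆`-algebra over `𝕜`. -/
noncomputable def fullCStarAlg : CStarAlg.{u, v} 𝕜 where
  carrier := FullAlg S

lemma ofHom_injective : Function.Injective (FullAlg.ofHom S) := fun a b h => by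
  refine sub_eq_zero.1 (eq_zero_of_fullNorm_eq_zero ?_)
  have h' : FullAlg.of S a = FullAlg.of S b := h
  rw [← FullAlg.norm_of, map_sub, h', sub_self, norm_zero]

lemma fullRep_of_tmul (f ψ : S.Cc) (c : Cl d) (ω : ExtAlg d) :
    fullRep S (FullAlg.of S (f ⊗ₜ c)) ((ψ : S.L2) ⊗ₜ[ℝ] ω : S.KMod) =
      ((f * ψ : S.Cc) : S.L2) ⊗ₜ cliffordRep c ω :=
  (fullRep_of _ _).trans (congrArg (fun φ : S.L2 => φ ⊗ₜ cliffordRep c ω) (L2.leftOp_coe f ψ))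

theorem isUnboundedKasparovModule_fullRep [TopologicalSpace.SeparableSpace B] :
    IsUnboundedKasparovModule (fullCStarAlg S) (FullAlg.grading S)
      (NonUnitalStarAlgHom.range (FullAlg.ofHom S)) S.kModData S.kModGrading (fullRep S)
      S.diracX where
  hilbert := isHilbertModule_kModData S
  separable := inferInstanceAs (TopologicalSpace.SeparableSpace (FullAlg S))
  gA_gA := FullAlg.grading_grading
  dense := FullAlg.denseRange_of
  gA_mem := by
    rintro _ ⟨a, rfl⟩
    exact ⟨S.ccClGrading a, (FullAlg.grading_of a).symm⟩
  gE_gE := kModGrading_kModGrading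
  gE_act := kModGrading_act
  inner_gE := inner_kModGrading
  π_add := fullRep_add_left
  π_smul := fullRep_smul_left
  π_mul := fullRep_mul
  π_star := isAdjoint_fullRep
  π_graded := kSpaceGrading_fullRep
  D_selfAdjointRegular := diracX_isSelfAdjointRegular S
  D_odd _ _ := diracX_odd
  commutator := by
    rintro _ ⟨a, rfl⟩
    obtain ⟨T, hT, h⟩ := exists_commutator a
    refine ⟨T, hT, fun x y hxy => 
      ⟨T x + kRepSelf S (S.ccClGrading a) y, ?_, ?_⟩⟩
    · have h1 := h x y hxy
      rw [← show fullRep S (FullAlg.of S a) x = kRepSelf S a x from fullRep_of a x] at h1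
      exact h1
    · have h1 : fullRep S (FullAlg.grading S (FullAlg.of S a)) y =
          kRepSelf S (S.ccClGrading a) y :=
        (congrArg (fun z => fullRep S z y) (FullAlg.grading_of a)).trans (fullRep_of _ y)
      exact sub_eq_of_eq_add (congrArg (T x + ·) h1.symm)
  compact := by
    refine ⟨diracRes S, diracX_isInvSqrt S, ?_⟩
    rintro _ ⟨a, rfl⟩
    have h : (fun x => fullRep S (FullAlg.ofHom S a) (diracRes S x)) =
        fun x => kRepSelf S a (diracRes S x) := funext fun x => fullRep_of a _
    exact h ▸ isCompactOp_kRep_diracRes a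

end TwistedSystem

end KK

theorem mainTheorem5 {𝕜 : Type v} {B : Type u} [RCLike 𝕜] [NonUnitalNormedRing B] [StarRing B]
    [CStarRing B] [CompleteSpace B] [NormedSpace ℝ B] [NormedSpace 𝕜 B] [IsScalarTower ℝ 𝕜 B]
    [IsScalarTower 𝕜 B B] [SMulCommClass 𝕜 B B] [StarModule 𝕜 B] [RealCStar B]
    [TopologicalSpace.SeparableSpace B] {d : ℕ} (S : TwistedSystem 𝕜 B d) [S.IsNormalized] :
    ∃ (A : CStarAlg.{u, v} 𝕜) (gA : A →⋆ₙₐ[𝕜] A) (ι : S.CcCl →⋆ₙₐ[𝕜] A)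
      (π : A → S.KMod → S.KMod),
      Function.Injective ι ∧ (∀ a, ‖ι a‖ = S.fullNorm a) ∧
      (∀ a, gA (ι a) = ι (S.ccClGrading a)) ∧
      (∀ (f ψ : S.Cc) (c : Cl d) (ω : ExtAlg d),
        π (ι (f ⊗ₜ c)) ((ψ : S.L2) ⊗ₜ ω) = ((f * ψ : S.Cc) : S.L2) ⊗ₜ cliffordRep c ω) ∧
      IsUnboundedKasparovModule A gA (NonUnitalStarAlgHom.range ι) S.kModData S.kModGrading π
        S.diracX := ⟨TwistedSystem.fullCStarAlg S, TwistedSystem.FullAlg.grading S, TwistedSystem.FullAlg.ofHom S,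
    TwistedSystem.fullRep S, TwistedSystem.ofHom_injective S, TwistedSystem.FullAlg.norm_of,
    TwistedSystem.FullAlg.grading_of, TwistedSystem.fullRep_of_tmul S,
    TwistedSystem.isUnboundedKasparovModule_fullRep S⟩
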